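/- Let $M$ and $N$ be smooth Hausdorff manifolds modelled on Banach spaces which are $C^\infty$-paracompact (paracompact, and every open cover admits a subordinate smooth partition of unity). Let $p\colon M\to N$ be a smooth surjective submersion, i.e. around every point there are charts in which $p$ is the projection of the model space of $M$ onto a complemented subspace. Write $\pi_M\colon TM\to M$ for the bundle projection. For a subbundle $W$ of a tangent bundle, with projection $\pi\colon W\to M$ and total space regarded as a submanifold, a *spray* on $W$ is a smooth vector field $S\colon W\to TW$ such that $T\pi\circ S$ is the inclusion of $W$ and $S\circ h_\lambda=Th_\lambda(\lambda S)$ for all $\lambda\in\mathbb R$, where $h_\lambda$ is fibrewise multiplication by $\lambda$; its *exponential* is $\exp_S=\pi\circ\mathrm{Fl}^S_1$, defined on the vectors for which the flow $\mathrm{Fl}^S$ exists up to time $1$. A *local addition* on a manifold $M$ is a pair $(U,\Sigma)$ with $U\subseteq TM$ an open neighbourhood of the zero section and $\Sigma\colon U\to M$ with $\Sigma(0_m)=m$ for all $m\in M$, such that $(\pi_M,\Sigma)$ is a diffeomorphism of $U$ onto an open subset of $M\times M$. A *linear connection* on $W$ is a bundle map $K\colon TW\to W$ over $\pi$ which in local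 trivialisations has the form $(u,\xi,X,\eta)\mapsto(u,\eta+B(u)(X,\xi))$ with $B$ a smooth map into the continuous bilinear maps; *parallel transport* $P^{c}_{0,1}(v)$ along $c\colon[0,1]\to M$ is the value at time $1$ of the curve $\eta$ in $W$ over $c$ with $\eta(0)=v$ and $K\circ\dot\eta=0$. Fix the following data. 1. An Ehresmann connection for $p$: a smooth subbundle $\mathcal H\subseteq TM$ with $TM=\mathcal V\oplus\mathcal H$, where $\mathcal V=\ker Tp$. 2. A spray $S_N$ on $TN$ and a set $\Omega_N\subseteq TN$, contained in the domain of $\exp_{S_N}$, such that $\Sigma_N:=\exp_{S_N}|_{\Omega_N}$ is a local addition on $N$ with domain $\Omega_N$. 3. The lift $S_{\mathcal H}$ of $S_N$, i.e. the spray on $\mathcal H$ with $T(Tp|_{\mathcal H})\circ S_{\mathcal H}=S_N\circ Tp|_{\mathcal H}$. 4. A spray $S_{\mathcal V}$ on $\mathcal V$ and an open neighbourhood $O\subseteq\mathcal V$ of the zero section, contained in the domain of $\exp_{S_{\mathcal V}}$, such that $(\pi_M,\exp_{S_{\mathcal V}})$ is a diffeomorphism of $O$ onto an open subset of $M\times_pM$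 with $\exp_{S_{\mathcal V}}(0_m)=m$ for all $m\in M$ (a local addition on $p$). 5. A linear connection on $\mathcal V$, with parallel transport $P$. Then there is an open neighbourhood $\Omega_M\subseteq TM$ of the zero section such that, splitting elements of $\Omega_M$ as $(v,h)\in\mathcal V\oplus\mathcal H$, the map $$\Sigma_M\colon\Omega_M\to M,\qquad \Sigma_M(v,h):=\exp_{S_{\mathcal V}}\bigl(P^{c_h}_{0,1}(v)\bigr),\qquad c_h(t)=\exp_{S_{\mathcal H}}(th),$$ is well defined (for all $(v,h)\in\Omega_M$, $th$ lies in the domain of $\exp_{S_{\mathcal H}}$ for every $t\in[0,1]$, the parallel transport exists, and $P^{c_h}_{0,1}(v)\in O$), $(\Omega_M,\Sigma_M)$ is a local addition on $M$, and for all $(v,h)\in\Omega_M$ one has $Tp(h)\in\Omega_N$ and $p(\Sigma_M(v,h))=\Sigma_N(Tp(h))$; that is, $p\circ\Sigma_M=\Sigma_N\circ(0\oplus Tp|_{\mathcal H})$ on $\Omega_M$. -/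

import Mathlib

open Set Filter Topology Bundle Manifold
open scoped ContDiff

noncomputable section

namespace SubmersionAddition

universe u

/-! ### Smooth paracompactness -/

/-- A manifold is `C^∞`-paracompact if it is paracompact and every open cover admits a
subordinate smooth partition of unity. -/
structure IsSmoothlyParacompact (E : Type*) [NormedAddCommGroup E] [NormedSpace ℝ E]
    (M : Type*) [TopologicalSpace M] [ChartedSpace E M] : Prop where
  paracompact : ParacompactSpace M
  exists_partition : ∀ 𝒰 : Set (Set M), (∀ U ∈ 𝒰, IsOpen U) → ⋃₀ 𝒰 = univ →
    ∃ f : SmoothPartitionOfUnity 𝒰 𝓘(ℝ, E) M univ, f.IsSubordinate (fun U => (U : Set M))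

/-! ### Maps on (split) submanifolds -/

section Submanifolds

variable {E₁ H₁ E₂ H₂ : Type*} [NormedAddCommGroup E₁] [NormedSpace ℝ E₁] [TopologicalSpace H₁]
  [NormedAddCommGroup E₂] [NormedSpace ℝ E₂] [TopologicalSpace H₂]
  (I₁ : ModelWithCorners ℝ E₁ H₁) (I₂ : ModelWithCorners ℝ E₂ H₂)
  {X : Type*} [TopologicalSpace X] [ChartedSpace H₁ X]
  {Y : Type*} [TopologicalSpace Y] [ChartedSpace H₂ Y]

/-- `θ` restricts to a smooth diffeomorphism of `A` onto the subset `θ '' A`. It is used for open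
subsets `A`, `θ '' A` of split submanifolds, where `ContMDiffOn` is smoothness with respect to
the submanifold structure. -/
def IsDiffeoOntoImage (θ : X → Y) (A : Set X) : Prop :=
  ContMDiffOn I₁ I₂ ∞ θ A ∧
    ∃ g : Y → X, ContMDiffOn I₂ I₁ ∞ g (θ '' A) ∧ LeftInvOn g θ A

/-- `A` is a relatively open subset of `B`. -/
def IsRelOpen (A B : Set X) : Prop := ∃ O : Set X, IsOpen O ∧ A = B ∩ O

/-- The tangent bundle `TA ⊆ TX` of a split submanifold `A ⊆ X`: the velocities of curves
in `A`. -/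
def tangentSet (A : Set X) : Set (TangentBundle I₁ X) :=
  {w | ∃ γ : ℝ → X, (∀ᶠ t in 𝓝 (0 : ℝ), γ t ∈ A) ∧ MDifferentiableAt 𝓘(ℝ, ℝ) I₁ γ 0 ∧
    (⟨γ 0, mfderiv 𝓘(ℝ, ℝ) I₁ γ 0 (1 : ℝ)⟩ : TangentBundle I₁ X) = w}

end Submanifolds

section Bundles

variable {E : Type u} [NormedAddCommGroup E] [NormedSpace ℝ E]
  {M : Type*} [TopologicalSpace M] [ChartedSpace E M] [IsManifold 𝓘(ℝ, E) ∞ M]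

/-! ### Subbundles of the tangent bundle -/

/-- The total space of a family of subspaces of the tangent spaces, as a subset of `TM`. -/
def totalSet (W : ∀ x : M, Submodule ℝ (TangentSpace 𝓘(ℝ, E) x)) :
    Set (TangentBundle 𝓘(ℝ, E) M) :=
  {v | v.2 ∈ W v.1}

/-- `W ⊆ TM` is a smooth (split) vector subbundle: locally there is a smooth trivialisation
`U × (F × G) ≅ TM|_U` which identifies `U × (F × 0)` with `W|_U`. -/
def IsSmoothSubbundle (W : ∀ x : M, Submodule ℝ (TangentSpace 𝓘(ℝ, E) x)) : Prop :=
  ∀ x₀ : M, ∃ U : Set M, IsOpen U ∧ x₀ ∈ U ∧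
    ∃ (F : Type u) (_ : NormedAddCommGroup F) (_ : NormedSpace ℝ F)
      (G : Type u) (_ : NormedAddCommGroup G) (_ : NormedSpace ℝ G)
      (Θ : ∀ x : M, (F × G) ≃L[ℝ] TangentSpace 𝓘(ℝ, E) x),
      ContMDiffOn (𝓘(ℝ, E).prod 𝓘(ℝ, F × G)) 𝓘(ℝ, E).tangent ∞
        (fun z : M × (F × G) => (⟨z.1, Θ z.1 z.2⟩ : TangentBundle 𝓘(ℝ, E) M)) (U ×ˢ univ) ∧
      ∀ x ∈ U, ∀ (a : F) (b : G), Θ x (a, b) ∈ W x ↔ b = 0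

/-- Fibrewise multiplication by `c` on `TM`. -/
def fibreScale (c : ℝ) (v : TangentBundle 𝓘(ℝ, E) M) : TangentBundle 𝓘(ℝ, E) M :=
  ⟨v.1, c • v.2⟩

/-- The zero vector at `x`. -/
def zeroVec (x : M) : TangentBundle 𝓘(ℝ, E) M := ⟨x, 0⟩

/-! ### Sprays and their exponential maps -/

/-- `S` is a spray on the subbundle `W ⊆ TM`, anchored by the inclusion. Only the values of `S` on
the total space of `W` matter. For `W = TM` this is a spray on `M`. -/
structure IsSpray (W : ∀ x : M, Submodule ℝ (TangentSpace 𝓘(ℝ, E) x))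
    (S : ∀ v : TangentBundle 𝓘(ℝ, E) M, TangentSpace 𝓘(ℝ, E).tangent v) : Prop where
  /-- `S` is a vector field on the submanifold `W` of `TM`. -/
  mem_tangentSet : ∀ v ∈ totalSet W,
    (⟨v, S v⟩ : TangentBundle 𝓘(ℝ, E).tangent (TangentBundle 𝓘(ℝ, E) M)) ∈
      tangentSet 𝓘(ℝ, E).tangent (totalSet W)
  /-- `S` is smooth. -/
  smooth : ContMDiffOn 𝓘(ℝ, E).tangent 𝓘(ℝ, E).tangent.tangent ∞
    (fun v => (⟨v, S v⟩ : TangentBundle 𝓘(ℝ, E).tangent (TangentBundle 𝓘(ℝ, E) M)))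
    (totalSet W)
  /-- `S` lifts the anchor: `Tπ ∘ S` is the inclusion. -/
  anchor : ∀ v ∈ totalSet W,
    mfderiv 𝓘(ℝ, E).tangent 𝓘(ℝ, E) (TotalSpace.proj : TangentBundle 𝓘(ℝ, E) M → M) v (S v) = v.2
  /-- `S ∘ h_c = T h_c (c S)`, with `h_c` the fibrewise multiplication by `c`. -/
  homogeneous : ∀ (c : ℝ), ∀ v ∈ totalSet W,
    S (fibreScale c v) =
      mfderiv 𝓘(ℝ, E).tangent 𝓘(ℝ, E).tangent
        (fibreScale c : TangentBundle 𝓘(ℝ, E) M → TangentBundle 𝓘(ℝ, E) M) v (c • S v)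

/-- `γ` is an integral curve in `W` of the vector field `S`, on the time interval `[0, 1]`. -/
def IsFlowLine (W : ∀ x : M, Submodule ℝ (TangentSpace 𝓘(ℝ, E) x))
    (S : ∀ v : TangentBundle 𝓘(ℝ, E) M, TangentSpace 𝓘(ℝ, E).tangent v)
    (γ : ℝ → TangentBundle 𝓘(ℝ, E) M) : Prop :=
  (∀ t ∈ Icc (0 : ℝ) 1, γ t ∈ totalSet W) ∧
    IsMIntegralCurveOn (I := 𝓘(ℝ, E).tangent) γ S (Icc (0 : ℝ) 1)

/-- The vectors in `W` for which the flow of `S` is defined up to time `1`. -/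
def expDomain (W : ∀ x : M, Submodule ℝ (TangentSpace 𝓘(ℝ, E) x))
    (S : ∀ v : TangentBundle 𝓘(ℝ, E) M, TangentSpace 𝓘(ℝ, E).tangent v) :
    Set (TangentBundle 𝓘(ℝ, E) M) :=
  {v | ∃ γ : ℝ → TangentBundle 𝓘(ℝ, E) M, IsFlowLine W S γ ∧ γ 0 = v}

open Classical in
/-- The spray exponential map `exp_S = π ∘ Fl^S_1` (with a junk value off `expDomain W S`). -/
def sprayExp (W : ∀ x : M, Submodule ℝ (TangentSpace 𝓘(ℝ, E) x))
    (S : ∀ v : TangentBundle 𝓘(ℝ, E) M, TangentSpace 𝓘(ℝ, E).tangent v)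
    (v : TangentBundle 𝓘(ℝ, E) M) : M :=
  if h : ∃ γ : ℝ → TangentBundle 𝓘(ℝ, E) M, IsFlowLine W S γ ∧ γ 0 = v
  then (h.choose 1).proj else v.proj

/-! ### Linear connections and parallel transport -/

/-- `K : TW → W` is (the connector of) a linear connection on the subbundle `W ⊆ TM`: near every
point there are a smooth trivialisation `Θ : U × F ≅ W|_U`, with `U` a chart domain, and a smooth
map `B` from `U` to the continuous bilinear maps with
`K (TΘ (x, ξ, X, η)) = Θ (x, η + B x (X, ξ))`. Only the values of `K` on `TW` matter. -/
def IsLinearConnection (W : ∀ x : M, Submodule ℝ (TangentSpace 𝓘(ℝ, E) x))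
    (K : ∀ v : TangentBundle 𝓘(ℝ, E) M,
      TangentSpace 𝓘(ℝ, E).tangent v → TangentSpace 𝓘(ℝ, E) v.proj) : Prop :=
  ∀ x₀ : M, ∃ U : Set M, IsOpen U ∧ x₀ ∈ U ∧ U ⊆ (chartAt E x₀).source ∧
    ∃ (F : Type u) (_ : NormedAddCommGroup F) (_ : NormedSpace ℝ F) (_ : CompleteSpace F)
      (Θ : ∀ x : M, F →L[ℝ] TangentSpace 𝓘(ℝ, E) x) (B : M → E →L[ℝ] F →L[ℝ] F),
      ContMDiffOn (𝓘(ℝ, E).prod 𝓘(ℝ, F)) 𝓘(ℝ, E).tangent ∞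
        (fun z : M × F => (⟨z.1, Θ z.1 z.2⟩ : TangentBundle 𝓘(ℝ, E) M)) (U ×ˢ univ) ∧
      (∀ x ∈ U, Function.Injective (Θ x) ∧ (Θ x).range = W x) ∧
      ContMDiffOn 𝓘(ℝ, E) 𝓘(ℝ, E →L[ℝ] F →L[ℝ] F) ∞ B U ∧
      ∀ x ∈ U, ∀ (ξ : F) (X : TangentSpace 𝓘(ℝ, E) x) (η : F),
        K ⟨x, Θ x ξ⟩
          (mfderiv (𝓘(ℝ, E).prod 𝓘(ℝ, F)) 𝓘(ℝ, E).tangent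
            (fun z : M × F => (⟨z.1, Θ z.1 z.2⟩ : TangentBundle 𝓘(ℝ, E) M)) (x, ξ) (X, η)) =
        Θ x (η + B x (trivializationAt E (TangentSpace 𝓘(ℝ, E)) x₀ ⟨x, X⟩).2 ξ)

/-- `η` is a parallel section of `W` along the curve `c : [0, 1] → M`, that is, `K ∘ η' = 0`.
In a trivialisation this is the equation `η' + B (c) (c', η) = 0`. -/
def IsParallelAlong (W : ∀ x : M, Submodule ℝ (TangentSpace 𝓘(ℝ, E) x))
    (K : ∀ v : TangentBundle 𝓘(ℝ, E) M,
      TangentSpace 𝓘(ℝ, E).tangent v → TangentSpace 𝓘(ℝ, E) v.proj)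
    (c : ℝ → M) (η : ℝ → TangentBundle 𝓘(ℝ, E) M) : Prop :=
  ∀ t ∈ Icc (0 : ℝ) 1, (η t).proj = c t ∧ η t ∈ totalSet W ∧
    ∃ w : TangentSpace 𝓘(ℝ, E).tangent (η t),
      HasMFDerivWithinAt 𝓘(ℝ, ℝ) 𝓘(ℝ, E).tangent η (Icc (0 : ℝ) 1) t
        ((1 : ℝ →L[ℝ] ℝ).smulRight w) ∧ K (η t) w = 0

open Classical in
/-- The parallel transport `P_{0,1}^c (v)` (with a junk value if `v` has no parallel extension
along `c`). -/
def parallelTransport (W : ∀ x : M, Submodule ℝ (TangentSpace 𝓘(ℝ, E) x))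
    (K : ∀ v : TangentBundle 𝓘(ℝ, E) M,
      TangentSpace 𝓘(ℝ, E).tangent v → TangentSpace 𝓘(ℝ, E) v.proj)
    (c : ℝ → M) (v : TangentBundle 𝓘(ℝ, E) M) : TangentBundle 𝓘(ℝ, E) M :=
  if h : ∃ η : ℝ → TangentBundle 𝓘(ℝ, E) M, IsParallelAlong W K c η ∧ η 0 = v
  then h.choose 1 else v

/-! ### Local additions on a manifold -/

/-- `(U, σ)` is a local addition on `M`. -/
structure IsLocalAddition (U : Set (TangentBundle 𝓘(ℝ, E) M))
    (σ : TangentBundle 𝓘(ℝ, E) M → M) : Prop where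
  isOpen : IsOpen U
  zero_mem : ∀ x : M, zeroVec x ∈ U
  map_zero : ∀ x : M, σ (zeroVec x) = x
  isOpen_image : IsOpen ((fun v => (v.proj, σ v)) '' U)
  diffeo : IsDiffeoOntoImage 𝓘(ℝ, E).tangent (𝓘(ℝ, E).prod 𝓘(ℝ, E))
    (fun v : TangentBundle 𝓘(ℝ, E) M => (v.proj, σ v)) U

end Bundles

/-! ### Submersions -/

section Submersions

variable {E : Type u} [NormedAddCommGroup E] [NormedSpace ℝ E]
  {M : Type*} [TopologicalSpace M] [ChartedSpace E M] [IsManifold 𝓘(ℝ, E) ∞ M]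
  {E' : Type*} [NormedAddCommGroup E'] [NormedSpace ℝ E']
  {N : Type*} [TopologicalSpace N] [ChartedSpace E' N]

/-- The vertical bundle `ker Tp`. -/
def vertical (E : Type u) [NormedAddCommGroup E] [NormedSpace ℝ E]
    {M : Type*} [TopologicalSpace M] [ChartedSpace E M]
    (E' : Type*) [NormedAddCommGroup E'] [NormedSpace ℝ E']
    {N : Type*} [TopologicalSpace N] [ChartedSpace E' N] (p : M → N) (x : M) :
    Submodule ℝ (TangentSpace 𝓘(ℝ, E) x) :=
  (mfderiv 𝓘(ℝ, E) 𝓘(ℝ, E') p x).ker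

/-- The fibre product `M ×_p M ⊆ M × M`. -/
def fibreProduct (p : M → N) : Set (M × M) := {z | p z.1 = p z.2}

/-- `(O, Ψ)` with `Ψ = (π, σ)` is a local addition on the submersion `p`. -/
structure IsLocalAdditionOn (E' : Type*) [NormedAddCommGroup E'] [NormedSpace ℝ E']
    {N : Type*} [TopologicalSpace N] [ChartedSpace E' N] (p : M → N)
    (O : Set (TangentBundle 𝓘(ℝ, E) M)) (σ : TangentBundle 𝓘(ℝ, E) M → M) : Prop where
  isRelOpen : IsRelOpen O (totalSet (vertical E E' p))
  zero_mem : ∀ x : M, zeroVec x ∈ O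
  map_zero : ∀ x : M, σ (zeroVec x) = x
  isRelOpen_image : IsRelOpen ((fun v => (v.proj, σ v)) '' O) (fibreProduct p)
  diffeo : IsDiffeoOntoImage 𝓘(ℝ, E).tangent (𝓘(ℝ, E).prod 𝓘(ℝ, E))
    (fun v : TangentBundle 𝓘(ℝ, E) M => (v.proj, σ v)) O

/-- An Ehresmann connection for `p`: a smooth subbundle of `TM` complementing the vertical
bundle. -/
structure EhresmannConnection (E : Type u) [NormedAddCommGroup E] [NormedSpace ℝ E]
    {M : Type*} [TopologicalSpace M] [ChartedSpace E M] [IsManifold 𝓘(ℝ, E) ∞ M]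
    (E' : Type*) [NormedAddCommGroup E'] [NormedSpace ℝ E']
    {N : Type*} [TopologicalSpace N] [ChartedSpace E' N] (p : M → N) where
  /-- The horizontal bundle. -/
  horizontal : ∀ x : M, Submodule ℝ (TangentSpace 𝓘(ℝ, E) x)
  smooth : IsSmoothSubbundle horizontal
  isCompl : ∀ x, IsCompl (vertical E E' p x) (horizontal x)

/-- The vertical component of a tangent vector. -/
def EhresmannConnection.verPart {p : M → N} (A : EhresmannConnection E E' p)
    (u : TangentBundle 𝓘(ℝ, E) M) : TangentBundle 𝓘(ℝ, E) M :=
  ⟨u.1, Submodule.projection _ _ (A.isCompl u.1) u.2⟩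

/-- The horizontal component of a tangent vector. -/
def EhresmannConnection.horPart {p : M → N} (A : EhresmannConnection E E' p)
    (u : TangentBundle 𝓘(ℝ, E) M) : TangentBundle 𝓘(ℝ, E) M :=
  ⟨u.1, Submodule.projection _ _ (A.isCompl u.1).symm u.2⟩

/-- `S_H` is the lift to the horizontal bundle of the spray `S_N` on `N`, that is, the spray on the
horizontal bundle which is related to `S_N` by the restriction of `Tp`. -/
structure IsSprayLift [IsManifold 𝓘(ℝ, E') ∞ N] {p : M → N} (A : EhresmannConnection E E' p)
    (S_N : ∀ v : TangentBundle 𝓘(ℝ, E') N, TangentSpace 𝓘(ℝ, E').tangent v)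
    (S_H : ∀ v : TangentBundle 𝓘(ℝ, E) M, TangentSpace 𝓘(ℝ, E).tangent v) : Prop where
  isSpray : IsSpray A.horizontal S_H
  related : ∀ h ∈ totalSet A.horizontal,
    mfderiv 𝓘(ℝ, E).tangent 𝓘(ℝ, E').tangent (tangentMap 𝓘(ℝ, E) 𝓘(ℝ, E') p) h (S_H h) =
      S_N (tangentMap 𝓘(ℝ, E) 𝓘(ℝ, E') p h)

/-- The curve `c_h (t) = exp_{S_H} (t h)`. -/
def horCurve {p : M → N} (A : EhresmannConnection E E' p)
    (S_H : ∀ v : TangentBundle 𝓘(ℝ, E) M, TangentSpace 𝓘(ℝ, E).tangent v)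
    (h : TangentBundle 𝓘(ℝ, E) M) (t : ℝ) : M :=
  sprayExp A.horizontal S_H (fibreScale t h)

/-- The map `(v, h) ↦ P_{0,1}^{c_h} (v)`. -/
def transported {p : M → N} (A : EhresmannConnection E E' p)
    (S_H : ∀ v : TangentBundle 𝓘(ℝ, E) M, TangentSpace 𝓘(ℝ, E).tangent v)
    (K : ∀ v : TangentBundle 𝓘(ℝ, E) M,
      TangentSpace 𝓘(ℝ, E).tangent v → TangentSpace 𝓘(ℝ, E) v.proj)
    (u : TangentBundle 𝓘(ℝ, E) M) : TangentBundle 𝓘(ℝ, E) M :=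
  parallelTransport (vertical E E' p) K (horCurve A S_H (A.horPart u)) (A.verPart u)

/-- The map `Σ_M (v, h) = exp_{S_V} (P_{0,1}^{c_h} (v))`. -/
def sigmaMap {p : M → N} (A : EhresmannConnection E E' p)
    (S_H S_V : ∀ v : TangentBundle 𝓘(ℝ, E) M, TangentSpace 𝓘(ℝ, E).tangent v)
    (K : ∀ v : TangentBundle 𝓘(ℝ, E) M,
      TangentSpace 𝓘(ℝ, E).tangent v → TangentSpace 𝓘(ℝ, E) v.proj)
    (u : TangentBundle 𝓘(ℝ, E) M) : M :=
  sprayExp (vertical E E' p) S_V (transported A S_H K u)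

end Submersions

end SubmersionAddition

end

/-!
The flow of `S_H` is related to the flow of `S_N` by `Tp`, so `p` maps `exp (h)` to
`Σ_N (Tp (h))`; since `exp_{S_V}` moves points inside the fibres of `p`, this is also
`p (Σ_M (v, h))`. Hence `(x, y) = (π (v, h), Σ_M (v, h))` determines `(v, h)` in stages: `Tp (h)` is
the preimage of `(p x, p y)` under `(π, Σ_N)`, it determines the horizontal vector `h` at `x`, then
`P (v)` is the preimage of `(exp (h), y)` under `(π, exp_{S_V})`, and `v` is recovered by inverse
parallel transport. Each stage is smooth near the diagonal, and the map `(π, Σ_M)`, being injective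
with local smooth sections around the diagonal, restricts to a diffeomorphism onto an open set
on some neighbourhood of the zero section.

Banach manifolds require smooth dependence of flows on initial values in infinite dimensions: the
integral equation is a smooth equation in the Banach space `C([0, 1], Z)`, to which the inverse
function theorem applies.
-/

noncomputable section

namespace SubmersionAddition

universe u

/-! ### Superposition operators on spaces of continuous maps -/

section Superposition

variable {K : Type*} [TopologicalSpace K]
  {Z W : Type*} [NormedAddCommGroup Z] [NormedAddCommGroup W] {U : Set Z} {f : Z → W} {γ : C(K, Z)}

open Classical in
/-- The superposition operator `γ ↦ f ∘ γ`, with value `0` where `f ∘ γ` is not continuous. -/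
def superposition (f : Z → W) (γ : C(K, Z)) : C(K, W) :=
  if h : Continuous (f ∘ γ) then ⟨f ∘ γ, h⟩ else 0

lemma superposition_apply (hf : ContinuousOn f U) (hγ : ∀ t, γ t ∈ U) (t : K) :
    superposition f γ t = f (γ t) := by
  have h : Continuous (f ∘ γ) := hf.comp_continuous γ.continuous hγ
  simp [superposition, h]

variable [CompactSpace K]

lemma isOpen_setOf_forall_mem (hU : IsOpen U) : IsOpen {γ : C(K, Z) | ∀ t, γ t ∈ U} := by
  simpa [MapsTo] using ContinuousMap.isOpen_setOfPred_mapsTo (X := K) (Y := Z) isCompact_univ hU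

lemma eventually_forall_mem_and_norm_sub_lt (hU : IsOpen U) (hf : ContinuousOn f U)
    (hγ : ∀ t, γ t ∈ U) {c : ℝ} (hc : 0 < c) :
    ∀ᶠ z in 𝓝 0, ∀ t, γ t + z ∈ U ∧ ‖f (γ t + z) - f (γ t)‖ < c := by
  suffices ∀ᶠ z in 𝓝 0, ∀ t ∈ univ, γ t + z ∈ U ∧ ‖f (γ t + z) - f (γ t)‖ < c by
    simpa only [mem_univ, true_imp_iff] using this
  refine isCompact_univ.eventually_forall_of_forall_eventually fun t₀ _ => ?_
  have hadd : ContinuousAt (fun q : Z × K => γ q.2 + q.1) (0, t₀) := by fun_prop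
  have hf₀ : ContinuousAt f (γ t₀) := hf.continuousAt (hU.mem_nhds (hγ t₀))
  have hsub : ContinuousAt (fun q : Z × K => ‖f (γ q.2 + q.1) - f (γ q.2)‖) (0, t₀) := by
    refine (ContinuousAt.sub ?_ ?_).norm
    · exact ContinuousAt.comp (g := f) (by simpa only [add_zero] using hf₀) hadd
    · exact ContinuousAt.comp (g := f) (f := fun q : Z × K => γ q.2) hf₀ (by fun_prop)
  filter_upwards [hadd.eventually_mem (by simpa only [add_zero] using hU.mem_nhds (hγ t₀)),
    hsub.eventually_lt_const (by simpa only [add_zero, sub_self, norm_zero] using hc)]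
    with q hmem hlt using ⟨hmem, hlt⟩

variable [NormedSpace ℝ Z] [NormedSpace ℝ W]

set_option synthInstance.maxHeartbeats 200000 in
-- The normed group structure of `C(K, Z →L[ℝ] W)` takes long to synthesize.
/-- Pointwise application of a continuous family of operators to a continuous map, as a bounded
bilinear map. It expresses the derivative of a superposition operator. -/
def pointwiseApply (K : Type*) [TopologicalSpace K] [CompactSpace K]
    (Z W : Type*) [NormedAddCommGroup Z] [NormedSpace ℝ Z] [NormedAddCommGroup W]
    [NormedSpace ℝ W] : C(K, Z →L[ℝ] W) →L[ℝ] C(K, Z) →L[ℝ] C(K, W) :=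
  LinearMap.mkContinuous₂
    (LinearMap.mk₂ ℝ (fun (A : C(K, Z →L[ℝ] W)) (δ : C(K, Z)) =>
        (⟨fun t => A t (δ t), A.continuous.clm_apply δ.continuous⟩ : C(K, W)))
      (fun _ _ _ => by ext; simp) (fun _ _ _ => by ext; simp) (fun _ _ _ => by ext; simp)
      (fun _ _ _ => by ext; simp)) 1
    (fun A δ => by
      rw [one_mul, ContinuousMap.norm_le _ (by positivity)]
      intro t
      exact ((A t).le_opNorm _).trans (mul_le_mul (A.norm_coe_le_norm t) (δ.norm_coe_le_norm t)
        (norm_nonneg _) (norm_nonneg A)))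

lemma pointwiseApply_apply (A : C(K, Z →L[ℝ] W)) (δ : C(K, Z)) (t : K) :
    pointwiseApply K Z W A δ t = A t (δ t) := rfl

lemma hasFDerivAt_superposition (hU : IsOpen U) (hf : ContDiffOn ℝ 1 f U) (hγ : ∀ t, γ t ∈ U) :
    HasFDerivAt (superposition f : C(K, Z) → C(K, W))
      (pointwiseApply K Z W (superposition (fderiv ℝ f) γ)) γ := by
  have hdf : ContinuousOn (fderiv ℝ f) U := hf.continuousOn_fderiv_of_isOpen hU le_rfl
  rw [hasFDerivAt_iff_isLittleO_nhds_zero, Asymptotics.isLittleO_iff]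
  intro c hc
  obtain ⟨r, hr, hball⟩ :=
    Metric.eventually_nhds_iff.1 (eventually_forall_mem_and_norm_sub_lt hU hdf hγ hc)
  have hnear : ∀ t, ∀ z ∈ Metric.ball (γ t) r, z ∈ U ∧ ‖fderiv ℝ f z - fderiv ℝ f (γ t)‖ < c := by
    intro t z hz
    simpa only [add_sub_cancel] using
      hball (y := z - γ t) (by simpa only [dist_zero_right] using mem_ball_iff_norm.1 hz) t
  filter_upwards [Metric.ball_mem_nhds (0 : C(K, Z)) hr] with δ hδ
  have hδ_ball : ∀ t, γ t + δ t ∈ Metric.ball (γ t) r := fun t => by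
    simpa using (δ.norm_coe_le_norm t).trans_lt (mem_ball_zero_iff.1 hδ)
  rw [ContinuousMap.norm_le _ (by positivity)]
  intro t
  rw [ContinuousMap.sub_apply, ContinuousMap.sub_apply,
    superposition_apply hf.continuousOn (γ := γ + δ) (fun t => (hnear t _ (hδ_ball t)).1),
    superposition_apply hf.continuousOn hγ, pointwiseApply_apply, superposition_apply hdf hγ]
  calc ‖f (γ t + δ t) - f (γ t) - fderiv ℝ f (γ t) (δ t)‖
      ≤ c * ‖δ t‖ := by
        simpa only [add_sub_cancel_left] using
          (convex_ball (γ t) r).norm_image_sub_le_of_norm_hasFDerivWithin_le'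
            (fun z hz => ((hf.differentiableOn one_ne_zero).differentiableAt
              (hU.mem_nhds (hnear t z hz).1)).hasFDerivAt.hasFDerivWithinAt)
            (fun z hz => (hnear t z hz).2.le) (Metric.mem_ball_self hr) (hδ_ball t)
    _ ≤ c * ‖δ‖ := by gcongr; exact δ.norm_coe_le_norm t

end Superposition

section SuperpositionSmooth

variable {K : Type*} [TopologicalSpace K] [CompactSpace K]
  {Z : Type u} [NormedAddCommGroup Z] [NormedSpace ℝ Z] {U : Set Z}

set_option synthInstance.maxHeartbeats 200000 in
-- The normed group structure of `C(K, Z →L[ℝ] W)` takes long to synthesize.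
lemma contDiffOn_nat_superposition (hU : IsOpen U) (n : ℕ) :
    ∀ {W : Type u} [NormedAddCommGroup W] [NormedSpace ℝ W] {f : Z → W},
      ContDiffOn ℝ ∞ f U →
      ContDiffOn ℝ n (superposition f : C(K, Z) → C(K, W)) {γ | ∀ t, γ t ∈ U} := by
  induction n with
  | zero =>
    intro W _ _ f hf
    rw [Nat.cast_zero, contDiffOn_zero]
    exact fun γ hγ => (hasFDerivAt_superposition hU (hf.of_le (by norm_cast))
      hγ).continuousAt.continuousWithinAt
  | succ n ih =>
    intro W _ _ f hf
    have hderiv : ∀ γ ∈ {γ : C(K, Z) | ∀ t, γ t ∈ U}, HasFDerivAt (superposition f)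
        (pointwiseApply K Z W (superposition (fderiv ℝ f) γ)) γ := fun γ hγ =>
      hasFDerivAt_superposition hU (hf.of_le (by norm_cast)) hγ
    rw [Nat.cast_succ, contDiffOn_succ_iff_fderiv_of_isOpen (isOpen_setOf_forall_mem hU)]
    refine ⟨fun γ hγ => (hderiv γ hγ).differentiableAt.differentiableWithinAt,
      fun h => by simp at h, ?_⟩
    have hcomp := (pointwiseApply K Z W).contDiff.comp_contDiffOn
      (ih (hf.fderiv_of_isOpen hU (m := ∞) (by norm_cast)))
    exact hcomp.congr fun γ hγ => (hderiv γ hγ).fderiv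

lemma contDiffOn_superposition (hU : IsOpen U)
    {W : Type u} [NormedAddCommGroup W] [NormedSpace ℝ W] {f : Z → W} (hf : ContDiffOn ℝ ∞ f U) :
    ContDiffOn ℝ ∞ (superposition f : C(K, Z) → C(K, W)) {γ | ∀ t, γ t ∈ U} :=
  contDiffOn_infty.2 fun n => contDiffOn_nat_superposition hU n hf

end SuperpositionSmooth

/-! ### Smooth dependence of solutions on the initial value -/

section Flow

variable {Z : Type*} [NormedAddCommGroup Z] [NormedSpace ℝ Z]

/-- The primitive vanishing at `0` of a continuous curve on the unit interval, as a bounded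
operator. -/
def primitive (Z : Type*) [NormedAddCommGroup Z] [NormedSpace ℝ Z] :
    C(Icc (0 : ℝ) 1, Z) →L[ℝ] C(Icc (0 : ℝ) 1, Z) :=
  LinearMap.mkContinuous
    { toFun := fun γ => ⟨fun t => ∫ s in (0 : ℝ)..t, IccExtend zero_le_one γ s,
        (intervalIntegral.continuous_primitive
          (fun _ _ => γ.continuous.Icc_extend'.intervalIntegrable _ _) 0).comp
          continuous_subtype_val⟩
      map_add' := fun γ δ => ContinuousMap.ext fun _ =>
        intervalIntegral.integral_add (γ.continuous.Icc_extend'.intervalIntegrable _ _)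
          (δ.continuous.Icc_extend'.intervalIntegrable _ _)
      map_smul' := fun c _ => ContinuousMap.ext fun _ => intervalIntegral.integral_smul c _ } 1
    (fun γ => by
      rw [one_mul, ContinuousMap.norm_le _ (norm_nonneg _)]
      intro t
      calc ‖∫ s in (0 : ℝ)..t, IccExtend zero_le_one γ s‖
          ≤ ‖γ‖ * |(t : ℝ) - 0| :=
            intervalIntegral.norm_integral_le_of_norm_le_const fun _ _ => γ.norm_coe_le_norm _
        _ ≤ ‖γ‖ := by
            rw [sub_zero, abs_of_nonneg t.2.1]
            exact mul_le_of_le_one_right (norm_nonneg _) t.2.2)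

lemma exists_contDiffOn_rightInverse {X Y : Type*} [NormedAddCommGroup X] [NormedSpace ℝ X]
    [CompleteSpace X] [NormedAddCommGroup Y] [NormedSpace ℝ Y] {Φ : X → Y}
    {S : Set X} (hS : IsOpen S) (hΦ : ContDiffOn ℝ ∞ Φ S) {a : X} (ha : a ∈ S)
    {L : X ≃L[ℝ] Y} (hL : HasFDerivAt Φ (L : X →L[ℝ] Y) a) :
    ∃ V : Set Y, IsOpen V ∧ Φ a ∈ V ∧ ∃ g : Y → X, ContDiffOn ℝ ∞ g V ∧
      ∀ q ∈ V, g q ∈ S ∧ Φ (g q) = q := by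
  have hΦ_at : ∀ x ∈ S, ContDiffAt ℝ ∞ Φ x := fun x hx => hΦ.contDiffAt (hS.mem_nhds hx)
  set e := (hΦ_at a ha).toOpenPartialHomeomorph Φ hL (by simp)
  have hae : a ∈ e.source := (hΦ_at a ha).mem_toOpenPartialHomeomorph_source hL (by simp)
  have heΦ : (e : X → Y) = Φ := (hΦ_at a ha).toOpenPartialHomeomorph_coe hL (by simp)
  -- A `C^∞` germ is only `C^n` on a neighbourhood depending on `n`; on the open set where the
  -- derivative is invertible, the inverse is `C^∞` at every point.
  set T : Set X := S ∩ fderiv ℝ Φ ⁻¹' range ((↑) : (X ≃L[ℝ] Y) → X →L[ℝ] Y)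
  have hT : IsOpen T := (hΦ.continuousOn_fderiv_of_isOpen hS (by norm_cast)).isOpen_inter_preimage
    hS ContinuousLinearEquiv.isOpen
  refine ⟨e.target ∩ e.symm ⁻¹' T, e.symm.isOpen_inter_preimage hT, ⟨?_, ?_⟩, e.symm, ?_, ?_⟩
  · exact heΦ ▸ e.map_source hae
  · rw [mem_preimage, ← heΦ, e.left_inv hae]
    exact ⟨ha, L, hL.fderiv.symm⟩
  · rintro q ⟨hq, hqS, L', hL'⟩
    refine (e.contDiffAt_symm hq (f₀' := L') ?_ (heΦ ▸ hΦ_at _ hqS)).contDiffWithinAt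
    rw [heΦ, hL']
    exact ((hΦ_at _ hqS).differentiableAt (by simp)).hasFDerivAt
  · rintro q ⟨hq, hqS, -⟩
    exact ⟨hqS, heΦ ▸ e.right_inv hq⟩

/-- The map `(γ, z, ε) ↦ (γ - z - ε ∫ f ∘ γ, z, ε)`. A preimage `(γ, z, ε)` of `(0, z, ε)` is the
solution of `γ' = ε f(γ)` on `[0, 1]` starting at `z`. -/
def picardMap (f : Z → Z) (q : C(Icc (0 : ℝ) 1, Z) × Z × ℝ) : C(Icc (0 : ℝ) 1, Z) × Z × ℝ :=
  (q.1 - ContinuousMap.const _ q.2.1 - q.2.2 • primitive Z (superposition f q.1), q.2)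

variable {f : Z → Z} {U : Set Z}

lemma eq_add_integral_of_picardMap_eq {γ : C(Icc (0 : ℝ) 1, Z)} {z : Z} {ε : ℝ}
    (h : picardMap f (γ, z, ε) = (0, z, ε)) {t : ℝ} (ht : t ∈ Icc (0 : ℝ) 1) :
    IccExtend zero_le_one γ t =
      z + ε • ∫ s in (0 : ℝ)..t, IccExtend zero_le_one (superposition f γ) s := by
  have hγ : γ - ContinuousMap.const _ z - ε • primitive Z (superposition f γ) = 0 :=
    congrArg Prod.fst h
  rw [IccExtend_of_mem _ _ ht]
  exact sub_eq_zero.1 ((sub_sub _ _ _).symm.trans (DFunLike.congr_fun hγ ⟨t, ht⟩))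

variable [CompleteSpace Z]

lemma hasDerivWithinAt_of_picardMap_eq (hf : ContinuousOn f U) {γ : C(Icc (0 : ℝ) 1, Z)}
    (hγ : ∀ t, γ t ∈ U) {z : Z} {ε : ℝ} (h : picardMap f (γ, z, ε) = (0, z, ε)) {t : ℝ}
    (ht : t ∈ Icc (0 : ℝ) 1) :
    HasDerivWithinAt (IccExtend zero_le_one γ) (ε • f (IccExtend zero_le_one γ t))
      (Icc (0 : ℝ) 1) t := by
  have hint : HasDerivWithinAt
      (fun t => z + ε • ∫ s in (0 : ℝ)..t, IccExtend zero_le_one (superposition f γ) s)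
      (ε • IccExtend zero_le_one (superposition f γ) t) (Icc (0 : ℝ) 1) t :=
    (((superposition f γ).continuous.Icc_extend'.integral_hasStrictDerivAt
      0 t).hasDerivAt.hasDerivWithinAt.const_smul ε).const_add z
  rw [IccExtend_of_mem _ _ ht, superposition_apply hf hγ] at hint
  rw [IccExtend_of_mem _ _ ht]
  exact hint.congr (fun s hs => eq_add_integral_of_picardMap_eq h hs)
    (eq_add_integral_of_picardMap_eq h ht)

end Flow

section SmoothFlow

variable {Z : Type u} [NormedAddCommGroup Z] [NormedSpace ℝ Z]
  {f : Z → Z} {U : Set Z}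

lemma contDiffOn_primitive_superposition (hU : IsOpen U) (hf : ContDiffOn ℝ ∞ f U) :
    ContDiffOn ℝ ∞
      (fun q : C(Icc (0 : ℝ) 1, Z) × Z × ℝ => primitive Z (superposition f q.1))
      ({γ | ∀ t, γ t ∈ U} ×ˢ univ) :=
  (primitive Z).contDiff.comp_contDiffOn
    ((contDiffOn_superposition hU hf).comp contDiff_fst.contDiffOn fun _ hq => hq.1)

lemma contDiffOn_picardMap (hU : IsOpen U) (hf : ContDiffOn ℝ ∞ f U) :
    ContDiffOn ℝ ∞ (picardMap f) ({γ | ∀ t, γ t ∈ U} ×ˢ univ) := by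
  have hconst : ContDiff ℝ ∞ fun q : C(Icc (0 : ℝ) 1, Z) × Z × ℝ =>
      ContinuousMap.const (Icc (0 : ℝ) 1) q.2.1 :=
    ContDiff.comp (g := ContinuousLinearMap.const ℝ (Icc (0 : ℝ) 1))
      (ContinuousLinearMap.contDiff _) (contDiff_fst.comp contDiff_snd)
  exact ((contDiff_fst.contDiffOn.sub hconst.contDiffOn).sub
    ((contDiff_snd.comp contDiff_snd).contDiffOn.smul
      (contDiffOn_primitive_superposition hU hf))).prodMk contDiff_snd.contDiffOn

/-- At `ε = 0` the derivative of the Picard map is unipotent, hence invertible. -/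
lemma exists_equiv_hasFDerivAt_picardMap (hU : IsOpen U) (hf : ContDiffOn ℝ ∞ f U) {z : Z}
    (hz : z ∈ U) :
    ∃ L : (C(Icc (0 : ℝ) 1, Z) × Z × ℝ) ≃L[ℝ] (C(Icc (0 : ℝ) 1, Z) × Z × ℝ),
      HasFDerivAt (picardMap f) (L : _ →L[ℝ] _) (ContinuousMap.const _ z, z, 0) := by
  let C := C(Icc (0 : ℝ) 1, Z)
  let const : Z →L[ℝ] C := ContinuousLinearMap.const ℝ (Icc (0 : ℝ) 1)
  let a : C × Z × ℝ := (const z, z, 0)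
  let b : C := primitive Z (superposition f (const z))
  let fstZ : C × Z × ℝ →L[ℝ] Z := .comp (.fst ℝ Z ℝ) (.snd ℝ C (Z × ℝ))
  let sndR : C × Z × ℝ →L[ℝ] ℝ := .comp (.snd ℝ Z ℝ) (.snd ℝ C (Z × ℝ))
  let N : C × Z × ℝ →L[ℝ] C × Z × ℝ :=
    (const.comp fstZ + sndR.smulRight b).prod 0
  have hN : ∀ q, N q = (const q.2.1 + q.2.2 • b, 0) := fun q => rfl
  refine ⟨ContinuousLinearEquiv.equivOfInverse (.id ℝ _ - N) (.id ℝ _ + N)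
    (fun q => by ext <;> simp [hN]) (fun q => by ext <;> simp [hN]), ?_⟩
  have hmem : {γ : C | ∀ t, γ t ∈ U} ×ˢ (univ : Set (Z × ℝ)) ∈ 𝓝 a :=
    ((isOpen_setOf_forall_mem hU).prod isOpen_univ).mem_nhds ⟨fun _ => hz, mem_univ _⟩
  have hint := (((contDiffOn_primitive_superposition hU hf).contDiffAt hmem).differentiableAt
    (by simp)).hasFDerivAt
  refine ((((hasFDerivAt_fst (p := a)).sub (const.comp fstZ).hasFDerivAt).sub
    (sndR.hasFDerivAt.smul hint)).prodMk hasFDerivAt_snd).congr_fderiv ?_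
  refine ContinuousLinearMap.ext fun q => Prod.ext ?_ (sub_zero q.2).symm
  change q.1 - const q.2.1 - ((0 : ℝ) • _ + q.2.2 • b) = q.1 - (const q.2.1 + q.2.2 • b)
  rw [zero_smul, zero_add, sub_sub]

theorem exists_contDiffOn_flow [CompleteSpace Z] (hU : IsOpen U) (hf : ContDiffOn ℝ ∞ f U)
    {z₀ : Z} (hz₀ : z₀ ∈ U) :
    ∃ ε : ℝ, 0 < ε ∧ ∃ D : Set Z, IsOpen D ∧ z₀ ∈ D ∧ ∃ Γ : Z → ℝ → Z,
      (∀ z ∈ D, Γ z 0 = z ∧ ∀ t ∈ Icc (0 : ℝ) 1, Γ z t ∈ U ∧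
        HasDerivWithinAt (Γ z) (ε • f (Γ z t)) (Icc (0 : ℝ) 1) t) ∧
      ContDiffOn ℝ ∞ (fun z => Γ z 1) D := by
  obtain ⟨L, hL⟩ := exists_equiv_hasFDerivAt_picardMap hU hf hz₀
  obtain ⟨V, hV, haV, g, hg, hgV⟩ := exists_contDiffOn_rightInverse
    ((isOpen_setOf_forall_mem hU).prod isOpen_univ) (contDiffOn_picardMap hU hf)
    ⟨fun _ => hz₀, mem_univ _⟩ hL
  obtain ⟨ε, hεV, hε⟩ : ∃ ε : ℝ, ((0 : C(Icc (0 : ℝ) 1, Z)), z₀, ε) ∈ V ∧ 0 < ε := by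
    have hmem : ∀ᶠ ε : ℝ in 𝓝 0, ((0 : C(Icc (0 : ℝ) 1, Z)), z₀, ε) ∈ V := by
      refine (by fun_prop : Continuous fun ε : ℝ => ((0 : C(Icc (0 : ℝ) 1, Z)), z₀, ε)).continuousAt
        |>.eventually_mem (hV.mem_nhds ?_)
      simpa [picardMap] using haV
    exact ((hmem.filter_mono nhdsWithin_le_nhds).and
      (self_mem_nhdsWithin : Ioi (0 : ℝ) ∈ 𝓝[>] 0)).exists
  have hslice : ContDiff ℝ ∞ fun z : Z => ((0 : C(Icc (0 : ℝ) 1, Z)), z, ε) :=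
    contDiff_const.prodMk (contDiff_id.prodMk contDiff_const)
  let D : Set Z := (fun z => ((0 : C(Icc (0 : ℝ) 1, Z)), z, ε)) ⁻¹' V
  let γ : Z → C(Icc (0 : ℝ) 1, Z) := fun z => (g (0, z, ε)).1
  have hγ : ∀ z ∈ D, (∀ t, γ z t ∈ U) ∧ picardMap f (γ z, z, ε) = (0, z, ε) := by
    intro z hz
    obtain ⟨hmem, hpre⟩ := hgV (0, z, ε) hz
    have hg_eq : (γ z, z, ε) = g (0, z, ε) := Prod.ext rfl (congrArg Prod.snd hpre).symm
    exact ⟨hmem.1, hg_eq ▸ hpre⟩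
  refine ⟨ε, hε, D, hV.preimage hslice.continuous, hεV, fun z => IccExtend zero_le_one (γ z),
    fun z hz => ⟨?_, fun t ht => ⟨?_, ?_⟩⟩, ?_⟩
  · simpa using eq_add_integral_of_picardMap_eq (hγ z hz).2 (left_mem_Icc.2 zero_le_one)
  · exact (hγ z hz).1 _
  · exact hasDerivWithinAt_of_picardMap_eq hf.continuousOn (hγ z hz).1 (hγ z hz).2 ht
  · refine ((ContinuousMap.evalCLM ℝ (1 : Icc (0 : ℝ) 1)).contDiff.comp_contDiffOn
      (contDiff_fst.comp_contDiffOn (hg.comp hslice.contDiffOn fun z hz => hz))).congr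
        fun z _ => ?_
    exact IccExtend_right zero_le_one (γ z)

end SmoothFlow

/-! ### Flow lines in a submanifold -/

lemma eventuallyEq_of_hasDerivWithinAt {Z : Type*} [NormedAddCommGroup Z] [NormedSpace ℝ Z]
    {g : Z → Z} {z₀ z₁ : ℝ → Z} {t : ℝ} (hg : ContDiffAt ℝ 1 g (z₀ t))
    (h₀ : ∀ᶠ s in 𝓝[≥] t, HasDerivWithinAt z₀ (g (z₀ s)) (Ici t) s)
    (h₁ : ∀ᶠ s in 𝓝[≥] t, HasDerivWithinAt z₁ (g (z₁ s)) (Ici t) s)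
    (heq : z₀ t = z₁ t) : z₀ =ᶠ[𝓝[≥] t] z₁ := by
  obtain ⟨K, V, hV, hlip⟩ := hg.exists_lipschitzOnWith
  have hV₀ : ∀ᶠ s in 𝓝[≥] t, z₀ s ∈ V :=
    (h₀.self_of_nhdsWithin self_mem_Ici).continuousWithinAt.eventually_mem hV
  have hV₁ : ∀ᶠ s in 𝓝[≥] t, z₁ s ∈ V :=
    (h₁.self_of_nhdsWithin self_mem_Ici).continuousWithinAt.eventually_mem (heq ▸ hV)
  obtain ⟨b, hb, hsub⟩ := mem_nhdsGE_iff_exists_Icc_subset.1 ((h₀.and hV₀).and (h₁.and hV₁))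
  have hcont : ∀ {z : ℝ → Z}, (∀ s ∈ Icc t b, HasDerivWithinAt z (g (z s)) (Ici t) s) →
      ContinuousOn z (Icc t b) := fun hz s hs =>
    (hz s hs).continuousWithinAt.mono Icc_subset_Ici_self
  have hderiv : ∀ {z : ℝ → Z}, (∀ s ∈ Icc t b, HasDerivWithinAt z (g (z s)) (Ici t) s) →
      ∀ s ∈ Ico t b, HasDerivWithinAt z (g (z s)) (Ici s) s := fun hz s hs =>
    (hz s (Ico_subset_Icc_self hs)).mono (Ici_subset_Ici.2 hs.1)
  have heqOn : EqOn z₀ z₁ (Icc t b) :=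
    ODE_solution_unique_of_mem_Icc_right (v := fun _ => g) (fun _ _ => hlip)
      (hcont fun s hs => (hsub hs).1.1) (hderiv fun s hs => (hsub hs).1.1)
      (fun s hs => (hsub (Ico_subset_Icc_self hs)).1.2)
      (hcont fun s hs => (hsub hs).2.1) (hderiv fun s hs => (hsub hs).2.1)
      (fun s hs => (hsub (Ico_subset_Icc_self hs)).2.2) heq
  filter_upwards [Icc_mem_nhdsGE hb] with s hs using heqOn hs

section Velocity

variable {Z : Type*} [NormedAddCommGroup Z] [NormedSpace ℝ Z]
  {E₁ H₁ : Type*} [NormedAddCommGroup E₁] [NormedSpace ℝ E₁] [TopologicalSpace H₁]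
  {I₁ : ModelWithCorners ℝ E₁ H₁} {X : Type*} [TopologicalSpace X] [ChartedSpace H₁ X]
  {E₂ H₂ : Type*} [NormedAddCommGroup E₂] [NormedSpace ℝ E₂] [TopologicalSpace H₂]
  {I₂ : ModelWithCorners ℝ E₂ H₂} {Y : Type*} [TopologicalSpace Y] [ChartedSpace H₂ Y]

lemma hasMFDerivWithinAt_smulRight_iff {z : ℝ → Z} {z' : Z} {s : Set ℝ} {t : ℝ} :
    HasMFDerivWithinAt 𝓘(ℝ, ℝ) 𝓘(ℝ, Z) z s t ((1 : ℝ →L[ℝ] ℝ).smulRight z') ↔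
      HasDerivWithinAt z z' s t := by
  have h : (1 : ℝ →L[ℝ] ℝ).smulRight z' = ContinuousLinearMap.toSpanSingleton ℝ z' :=
    ContinuousLinearMap.ext fun a => by simp
  exact hasMFDerivWithinAt_iff_hasFDerivWithinAt.trans
    ((iff_of_eq (congrArg (fun L : ℝ →L[ℝ] Z => HasFDerivWithinAt z L s t) h)).trans
      hasDerivWithinAt_iff_hasFDerivWithinAt.symm)

lemma hasMFDerivWithinAt_comp_velocity {γ : ℝ → X} {s : Set ℝ} {t : ℝ}
    {v : TangentSpace I₁ (γ t)}
    (hγ : HasMFDerivWithinAt 𝓘(ℝ, ℝ) I₁ γ s t ((1 : ℝ →L[ℝ] ℝ).smulRight v)) {f : X → Y}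
    {f' : TangentSpace I₁ (γ t) →L[ℝ] TangentSpace I₂ (f (γ t))}
    (hf : HasMFDerivAt I₁ I₂ f (γ t) f') :
    HasMFDerivWithinAt 𝓘(ℝ, ℝ) I₂ (f ∘ γ) s t ((1 : ℝ →L[ℝ] ℝ).smulRight (f' v)) :=
  (hf.comp_hasMFDerivWithinAt t hγ).congr_mfderiv
    (ContinuousLinearMap.ext fun (a : ℝ) => map_smul f' a v)

end Velocity

section SubmanifoldChart

variable {E₁ H₁ : Type*} [NormedAddCommGroup E₁] [NormedSpace ℝ E₁] [TopologicalSpace H₁]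
  {X : Type*} [TopologicalSpace X] [ChartedSpace H₁ X]
  {Z : Type*} [NormedAddCommGroup Z] [NormedSpace ℝ Z]

/-- A smooth local parametrisation `invFun` of the subset `W` of the manifold `X` by an open subset
of `Z`, together with a smooth extension `toFun` of its inverse to an open subset of `X`. This is
what is needed to study vector fields tangent to `W` in coordinates. -/
structure SubmanifoldChart (I₁ : ModelWithCorners ℝ E₁ H₁) {X : Type*} [TopologicalSpace X]
    [ChartedSpace H₁ X] (W : Set X) (Z : Type*) [NormedAddCommGroup Z] [NormedSpace ℝ Z] where
  toFun : X → Z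
  invFun : Z → X
  source : Set X
  target : Set Z
  isOpen_source : IsOpen source
  isOpen_target : IsOpen target
  contMDiffOn_toFun : ContMDiffOn I₁ 𝓘(ℝ, Z) ∞ toFun source
  contMDiffOn_invFun : ContMDiffOn 𝓘(ℝ, Z) I₁ ∞ invFun target
  map_source : ∀ w ∈ W, w ∈ source → toFun w ∈ target
  map_target : ∀ z ∈ target, invFun z ∈ W ∧ invFun z ∈ source
  left_inv : ∀ w ∈ W, w ∈ source → invFun (toFun w) = w
  right_inv : ∀ z ∈ target, toFun (invFun z) = z

namespace SubmanifoldChart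

variable {I₁ : ModelWithCorners ℝ E₁ H₁} {W : Set X} (χ : SubmanifoldChart I₁ W Z)
  {S : ∀ x : X, TangentSpace I₁ x}

lemma mdifferentiableAt_toFun {w : X} (hw : w ∈ χ.source) :
    MDifferentiableAt I₁ 𝓘(ℝ, Z) χ.toFun w :=
  (χ.contMDiffOn_toFun.contMDiffAt (χ.isOpen_source.mem_nhds hw)).mdifferentiableAt (by simp)

lemma mdifferentiableAt_invFun {z : Z} (hz : z ∈ χ.target) :
    MDifferentiableAt 𝓘(ℝ, Z) I₁ χ.invFun z :=
  (χ.contMDiffOn_invFun.contMDiffAt (χ.isOpen_target.mem_nhds hz)).mdifferentiableAt (by simp)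

/-- The representative in the chart `χ` of a vector field tangent to the submanifold. -/
def localField (S : ∀ x : X, TangentSpace I₁ x) (z : Z) : Z :=
  mfderiv I₁ 𝓘(ℝ, Z) χ.toFun (χ.invFun z) (S (χ.invFun z))

lemma localField_toFun {w : X} (hw : w ∈ W) (hws : w ∈ χ.source) :
    χ.localField S (χ.toFun w) = mfderiv I₁ 𝓘(ℝ, Z) χ.toFun w (S w) :=
  congrArg (fun x => (mfderiv I₁ 𝓘(ℝ, Z) χ.toFun x (S x) : Z)) (χ.left_inv w hw hws)

lemma contDiffOn_localField [IsManifold I₁ ∞ X]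
    (hS : ContMDiffOn I₁ I₁.tangent ∞ (fun v => (⟨v, S v⟩ : TangentBundle I₁ X)) W) :
    ContDiffOn ℝ ∞ (χ.localField S) χ.target := by
  have : IsManifold I₁ 1 X := .of_le (n := ∞) (by norm_cast)
  have hfield : ContMDiffOn 𝓘(ℝ, Z) I₁.tangent ∞
      (fun z => (⟨χ.invFun z, S (χ.invFun z)⟩ : TangentBundle I₁ X)) χ.target :=
    hS.comp χ.contMDiffOn_invFun fun z hz => (χ.map_target z hz).1
  have htangent := (χ.contMDiffOn_toFun.contMDiffOn_tangentMapWithin (m := ∞) (by simp)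
    χ.isOpen_source.uniqueMDiffOn).comp hfield fun z hz => (χ.map_target z hz).2
  rw [← contMDiffOn_iff_contDiffOn]
  refine ((contMDiff_snd_tangentBundle_modelSpace (I := 𝓘(ℝ, Z)) (n := ∞)).comp_contMDiffOn
    htangent).congr fun z hz => ?_
  simp only [Function.comp, tangentMapWithin, localField]
  rw [mfderivWithin_of_isOpen χ.isOpen_source (χ.map_target z hz).2]

lemma mfderiv_invFun_mfderiv_toFun {w : X} (s : TangentSpace I₁ w)
    (hs : (⟨w, s⟩ : TangentBundle I₁ X) ∈ tangentSet I₁ W) (hw : w ∈ χ.source) {z : Z}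
    (hz : z ∈ χ.target) (hwz : χ.toFun w = z) :
    mfderiv 𝓘(ℝ, Z) I₁ χ.invFun z (mfderiv I₁ 𝓘(ℝ, Z) χ.toFun w s) = s := by
  obtain ⟨γ, hγW, hγd, hγ⟩ := hs
  cases hγ
  subst hwz
  have hto := χ.mdifferentiableAt_toFun hw
  have hleft : (χ.invFun ∘ (χ.toFun ∘ γ)) =ᶠ[𝓝 0] γ := by
    filter_upwards [hγW, hγd.continuousAt.eventually_mem (χ.isOpen_source.mem_nhds hw)]
      with t ht ht' using χ.left_inv _ ht ht'
  have hcomp : mfderiv 𝓘(ℝ, ℝ) I₁ (χ.invFun ∘ (χ.toFun ∘ γ)) (0 : ℝ) =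
      (mfderiv 𝓘(ℝ, Z) I₁ χ.invFun (χ.toFun (γ 0))).comp
        ((mfderiv I₁ 𝓘(ℝ, Z) χ.toFun (γ 0)).comp (mfderiv 𝓘(ℝ, ℝ) I₁ γ (0 : ℝ))) := by
    rw [mfderiv_comp (0 : ℝ) (χ.mdifferentiableAt_invFun hz) (hto.comp (0 : ℝ) hγd),
      mfderiv_comp (0 : ℝ) hto hγd]
    rfl
  exact congrArg (fun L : ℝ →L[ℝ] E₁ => L 1) (hcomp.symm.trans hleft.mfderiv_eq)

lemma hasDerivWithinAt_toFun_comp {γ : ℝ → X} {s : Set ℝ} {t : ℝ}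
    (hγ : HasMFDerivWithinAt 𝓘(ℝ, ℝ) I₁ γ s t ((1 : ℝ →L[ℝ] ℝ).smulRight (S (γ t))))
    (hW : γ t ∈ W) (ht : γ t ∈ χ.source) :
    HasDerivWithinAt (χ.toFun ∘ γ) (χ.localField S (χ.toFun (γ t))) s t := by
  rw [χ.localField_toFun hW ht]
  exact hasMFDerivWithinAt_smulRight_iff.1 (hasMFDerivWithinAt_comp_velocity hγ
    (χ.mdifferentiableAt_toFun ht).hasMFDerivAt)

lemma hasMFDerivWithinAt_invFun_comp
    (hS : ∀ w ∈ W, (⟨w, S w⟩ : TangentBundle I₁ X) ∈ tangentSet I₁ W) {z : ℝ → Z} {s : Set ℝ}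
    {t c : ℝ} (hz : HasDerivWithinAt z (c • χ.localField S (z t)) s t) (ht : z t ∈ χ.target) :
    HasMFDerivWithinAt 𝓘(ℝ, ℝ) I₁ (χ.invFun ∘ z) s t
      ((1 : ℝ →L[ℝ] ℝ).smulRight (c • S (χ.invFun (z t)))) := by
  have hlocal : mfderiv 𝓘(ℝ, Z) I₁ χ.invFun (z t) (χ.localField S (z t)) = S (χ.invFun (z t)) :=
    χ.mfderiv_invFun_mfderiv_toFun _ (hS _ (χ.map_target _ ht).1) (χ.map_target _ ht).2 ht
      (χ.right_inv _ ht)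
  refine (hasMFDerivWithinAt_comp_velocity (hasMFDerivWithinAt_smulRight_iff.2 hz)
    (χ.mdifferentiableAt_invFun ht).hasMFDerivAt).congr_mfderiv ?_
  rw [← hlocal]
  exact congrArg (ContinuousLinearMap.smulRight (1 : ℝ →L[ℝ] ℝ)) (map_smul _ _ _)

variable {a b : ℝ} {γ γ₀ γ₁ : ℝ → X}

lemma eventually_hasDerivWithinAt_toFun_comp (hγ : IsMIntegralCurveOn γ S (Icc a b))
    (hW : ∀ t ∈ Icc a b, γ t ∈ W) {t : ℝ} (ht : t ∈ Ico a b) (htχ : γ t ∈ χ.source) :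
    ∀ᶠ s in 𝓝[≥] t, (γ s ∈ W ∧ γ s ∈ χ.source) ∧
      HasDerivWithinAt (χ.toFun ∘ γ) (χ.localField S (χ.toFun (γ s))) (Ici t) s := by
  have hsource : ∀ᶠ s in 𝓝[≥] t, γ s ∈ χ.source :=
    ((hγ.continuousWithinAt (Ico_subset_Icc_self ht)).eventually_mem
      (χ.isOpen_source.mem_nhds htχ)).filter_mono
        (nhdsWithin_le_of_mem (Icc_mem_nhdsGE_of_mem ht))
  filter_upwards [hsource, Ico_mem_nhdsGE_of_mem ht, self_mem_nhdsWithin] with s hs hsI _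
  have hsI' := Ico_subset_Icc_self hsI
  refine ⟨⟨hW s hsI', hs⟩,
    (χ.hasDerivWithinAt_toFun_comp (hγ s hsI') (hW s hsI') hs).mono_of_mem_nhdsWithin ?_⟩
  filter_upwards [self_mem_nhdsWithin, mem_nhdsWithin_of_mem_nhds (Iio_mem_nhds hsI.2)]
    with r htr hrb using ⟨ht.1.trans htr, hrb.le⟩

lemma eventuallyEq_of_isMIntegralCurveOn [IsManifold I₁ ∞ X]
    (hS : ContMDiffOn I₁ I₁.tangent ∞ (fun v => (⟨v, S v⟩ : TangentBundle I₁ X)) W)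
    (h₀ : IsMIntegralCurveOn γ₀ S (Icc a b)) (h₁ : IsMIntegralCurveOn γ₁ S (Icc a b))
    (hW₀ : ∀ t ∈ Icc a b, γ₀ t ∈ W) (hW₁ : ∀ t ∈ Icc a b, γ₁ t ∈ W) {t : ℝ}
    (ht : t ∈ Ico a b) (htχ : γ₀ t ∈ χ.source) (heq : γ₀ t = γ₁ t) :
    γ₀ =ᶠ[𝓝[≥] t] γ₁ := by
  have hsmooth : ContDiffAt ℝ 1 (χ.localField S) ((χ.toFun ∘ γ₀) t) :=
    ((χ.contDiffOn_localField hS).contDiffAt (χ.isOpen_target.mem_nhds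
      (χ.map_source _ (hW₀ t (Ico_subset_Icc_self ht)) htχ))).of_le (by norm_cast)
  have hev₀ := χ.eventually_hasDerivWithinAt_toFun_comp h₀ hW₀ ht htχ
  have hev₁ := χ.eventually_hasDerivWithinAt_toFun_comp h₁ hW₁ ht (heq ▸ htχ)
  filter_upwards [eventuallyEq_of_hasDerivWithinAt hsmooth (hev₀.mono fun _ h => h.2)
    (hev₁.mono fun _ h => h.2) (congrArg χ.toFun heq), hev₀, hev₁] with s hs hs₀ hs₁
  rw [← χ.left_inv _ hs₀.1.1 hs₀.1.2, ← χ.left_inv _ hs₁.1.1 hs₁.1.2]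
  exact congrArg χ.invFun hs

end SubmanifoldChart

theorem eqOn_of_isMIntegralCurveOn [T2Space X] {I₁ : ModelWithCorners ℝ E₁ H₁}
    [IsManifold I₁ ∞ X] {W : Set X}
    (hW : ∀ w ∈ W, ∃ (Z : Type u) (_ : NormedAddCommGroup Z) (_ : NormedSpace ℝ Z)
      (χ : SubmanifoldChart I₁ W Z), w ∈ χ.source)
    {S : ∀ x : X, TangentSpace I₁ x}
    (hS : ContMDiffOn I₁ I₁.tangent ∞ (fun v => (⟨v, S v⟩ : TangentBundle I₁ X)) W) {a b : ℝ}
    {γ₀ γ₁ : ℝ → X} (h₀ : IsMIntegralCurveOn γ₀ S (Icc a b))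
    (h₁ : IsMIntegralCurveOn γ₁ S (Icc a b)) (hW₀ : ∀ t ∈ Icc a b, γ₀ t ∈ W)
    (hW₁ : ∀ t ∈ Icc a b, γ₁ t ∈ W) (heq : γ₀ a = γ₁ a) : EqOn γ₀ γ₁ (Icc a b) := by
  have hclosed : IsClosed ({t | γ₀ t = γ₁ t} ∩ Icc a b) := by
    rw [inter_comm]
    exact (h₀.continuousOn.prodMk h₁.continuousOn).preimage_isClosed_of_isClosed isClosed_Icc
      isClosed_diagonal
  refine hclosed.Icc_subset_of_forall_mem_nhdsWithin heq ?_
  rintro t ⟨ht, htI⟩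
  obtain ⟨Z, _, _, χ, hχ⟩ := hW _ (hW₀ t (Ico_subset_Icc_self htI))
  exact (χ.eventuallyEq_of_isMIntegralCurveOn hS h₀ h₁ hW₀ hW₁ htI hχ ht).filter_mono
    (nhdsWithin_mono t Ioi_subset_Ici_self)

end SubmanifoldChart

/-! ### Local frames of subbundles -/

section Operators

variable {E : Type*} [NormedAddCommGroup E] [NormedSpace ℝ E]
  {M : Type*} [TopologicalSpace M] [ChartedSpace E M]
  {F : Type*} [NormedAddCommGroup F] [NormedSpace ℝ F]
  {E₂ : Type*} [NormedAddCommGroup E₂] [NormedSpace ℝ E₂]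

-- The family is its own fibre derivative, and derivatives are smooth in the operator norm.
lemma contMDiffOn_clm_of_uncurry [IsManifold 𝓘(ℝ, E) ∞ M] {L : M → F →L[ℝ] E₂} {U : Set M}
    (hU : IsOpen U)
    (h : ContMDiffOn (𝓘(ℝ, E).prod 𝓘(ℝ, F)) 𝓘(ℝ, E₂) ∞ (fun z : M × F => L z.1 z.2)
      (U ×ˢ univ)) : ContMDiffOn 𝓘(ℝ, E) 𝓘(ℝ, F →L[ℝ] E₂) ∞ L U := by
  intro x hx
  have huncurry : ContMDiffAt (𝓘(ℝ, E).prod 𝓘(ℝ, F)) 𝓘(ℝ, E₂) ∞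
      (Function.uncurry fun (x : M) (ξ : F) => L x ξ) (x, 0) :=
    h.contMDiffAt ((hU.prod isOpen_univ).mem_nhds ⟨hx, mem_univ _⟩)
  have hderiv := ContMDiffAt.mfderiv (fun (x : M) (ξ : F) => L x ξ) (fun _ => (0 : F)) (m := ∞)
    huncurry contMDiffAt_const (by simp)
  refine (hderiv.congr_of_eventuallyEq (Eventually.of_forall fun y => ?_)).contMDiffWithinAt
  refine Eq.trans ?_ (congrFun (inTangentCoordinates_model_space (I := 𝓘(ℝ, F)) (I' := 𝓘(ℝ, E₂))
    (fun _ : M => (0 : F)) (fun x => L x 0)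
    (fun x => mfderiv 𝓘(ℝ, F) 𝓘(ℝ, E₂) (fun ξ => L x ξ) 0) x) y).symm
  change L y = mfderiv 𝓘(ℝ, F) 𝓘(ℝ, E₂) (L y) 0
  rw [mfderiv_eq_fderiv, (L y).fderiv]

lemma exists_coe_eq_of_bijective [CompleteSpace F] [CompleteSpace E₂] {L : F →L[ℝ] E₂}
    (hbij : Function.Bijective L) : ∃ L' : F ≃L[ℝ] E₂, (L' : F →L[ℝ] E₂) = L :=
  ⟨_, ContinuousLinearEquiv.coe_ofBijective L (LinearMap.ker_eq_bot.2 hbij.1)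
    (LinearMap.range_eq_top.2 hbij.2)⟩

lemma contMDiffOn_clm_inverse [CompleteSpace F] [CompleteSpace E₂]
    {E₃ H₃ : Type*} [NormedAddCommGroup E₃] [NormedSpace ℝ E₃] [TopologicalSpace H₃]
    {I₃ : ModelWithCorners ℝ E₃ H₃} {X : Type*} [TopologicalSpace X] [ChartedSpace H₃ X]
    {L : X → F →L[ℝ] E₂} {s : Set X} (h : ContMDiffOn I₃ 𝓘(ℝ, F →L[ℝ] E₂) ∞ L s)
    (hbij : ∀ x ∈ s, Function.Bijective (L x)) :
    ContMDiffOn I₃ 𝓘(ℝ, E₂ →L[ℝ] F) ∞ (fun x => (L x).inverse) s := by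
  intro x hx
  obtain ⟨L', hL'⟩ := exists_coe_eq_of_bijective (hbij x hx)
  exact (hL' ▸ contDiffAt_map_inverse L').contMDiffAt.comp_contMDiffWithinAt x (h x hx)

lemma clm_inverse_apply_apply [CompleteSpace F] [CompleteSpace E₂] {L : F →L[ℝ] E₂}
    (hbij : Function.Bijective L) (ξ : F) : L.inverse (L ξ) = ξ := by
  obtain ⟨L', rfl⟩ := exists_coe_eq_of_bijective hbij
  simp

lemma clm_apply_inverse_apply [CompleteSpace F] [CompleteSpace E₂] {L : F →L[ℝ] E₂}
    (hbij : Function.Bijective L) (e : E₂) : L (L.inverse e) = e := by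
  obtain ⟨L', rfl⟩ := exists_coe_eq_of_bijective hbij
  simp

end Operators

section Frames

variable {E : Type u} [NormedAddCommGroup E] [NormedSpace ℝ E]
  {M : Type*} [TopologicalSpace M] [ChartedSpace E M] [IsManifold 𝓘(ℝ, E) ∞ M]
  {F : Type*} [NormedAddCommGroup F] [NormedSpace ℝ F]
  {G : Type*} [NormedAddCommGroup G] [NormedSpace ℝ G]

lemma contMDiffOn_trivializationAt_snd (x₀ : M) :
    ContMDiffOn 𝓘(ℝ, E).tangent 𝓘(ℝ, E) ∞ (fun u : TangentBundle 𝓘(ℝ, E) M =>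
      (trivializationAt E (TangentSpace 𝓘(ℝ, E)) x₀ u).2)
      {u | u.proj ∈ (chartAt E x₀).source} :=
  contMDiff_snd.comp_contMDiffOn
    (trivializationAt E (TangentSpace 𝓘(ℝ, E) : M → Type _) x₀).contMDiffOn

lemma contMDiffOn_tangentBundle_of_trivializationAt {E₂ H₂ : Type*} [NormedAddCommGroup E₂]
    [NormedSpace ℝ E₂] [TopologicalSpace H₂] {I₂ : ModelWithCorners ℝ E₂ H₂} {Y : Type*}
    [TopologicalSpace Y] [ChartedSpace H₂ Y] {f : Y → TangentBundle 𝓘(ℝ, E) M} {s : Set Y}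
    (x₀ : M) (hs : ∀ y ∈ s, (f y).proj ∈ (chartAt E x₀).source)
    (hproj : ContMDiffOn I₂ 𝓘(ℝ, E) ∞ (fun y => (f y).proj) s)
    (hsnd : ContMDiffOn I₂ 𝓘(ℝ, E) ∞
      (fun y => (trivializationAt E (TangentSpace 𝓘(ℝ, E)) x₀ (f y)).2) s) :
    ContMDiffOn I₂ 𝓘(ℝ, E).tangent ∞ f s := fun y hy =>
  ((trivializationAt E (TangentSpace 𝓘(ℝ, E) : M → Type _) x₀).contMDiffWithinAt_iff
    (n := ∞) (IB := 𝓘(ℝ, E)) (hs y hy)).2 ⟨hproj y hy, hsnd y hy⟩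

lemma trivializationAt_snd_eq {x₀ x : M} (hx : x ∈ (chartAt E x₀).source)
    (v : TangentSpace 𝓘(ℝ, E) x) :
    (trivializationAt E (TangentSpace 𝓘(ℝ, E)) x₀ ⟨x, v⟩).2 =
      (trivializationAt E (TangentSpace 𝓘(ℝ, E)) x₀).continuousLinearMapAt ℝ x v :=
  (congrFun ((trivializationAt E (TangentSpace 𝓘(ℝ, E)) x₀).coe_linearMapAt_of_mem
    (R := ℝ) hx) v).symm

lemma bijective_continuousLinearMapAt {x₀ x : M} (hx : x ∈ (chartAt E x₀).source) :
    Function.Bijective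
      ((trivializationAt E (TangentSpace 𝓘(ℝ, E)) x₀).continuousLinearMapAt ℝ x) := by
  rw [← (trivializationAt E (TangentSpace 𝓘(ℝ, E)) x₀).coe_continuousLinearEquivAt_eq' hx]
  exact ((trivializationAt E (TangentSpace 𝓘(ℝ, E)) x₀).continuousLinearEquivAt ℝ x hx).bijective

/-- A smooth family `Θ` of linear parametrisations of the fibres over `U` of a family `W` of
subspaces of the tangent spaces. -/
structure IsFrameOn (W : ∀ x : M, Submodule ℝ (TangentSpace 𝓘(ℝ, E) x)) (U : Set M)
    (Θ : ∀ x : M, F →L[ℝ] TangentSpace 𝓘(ℝ, E) x) : Prop where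
  contMDiffOn : ContMDiffOn (𝓘(ℝ, E).prod 𝓘(ℝ, F)) 𝓘(ℝ, E).tangent ∞
    (fun z : M × F => (⟨z.1, Θ z.1 z.2⟩ : TangentBundle 𝓘(ℝ, E) M)) (U ×ˢ univ)
  injective : ∀ x ∈ U, Function.Injective (Θ x)
  range_eq : ∀ x ∈ U, (Θ x).range = W x

/-- A local frame of `W`: a frame over an open subset `U` of the domain of the chart at `x₀`,
together with a family `coord` of linear maps on the whole tangent spaces which is smooth over `U`
and restricts to the coordinates of `W`. -/
structure LocalFrame (W : ∀ x : M, Submodule ℝ (TangentSpace 𝓘(ℝ, E) x)) (x₀ : M) (U : Set M)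
    (F : Type*) [NormedAddCommGroup F] [NormedSpace ℝ F] where
  frame : ∀ x : M, F →L[ℝ] TangentSpace 𝓘(ℝ, E) x
  coord : ∀ x : M, TangentSpace 𝓘(ℝ, E) x →L[ℝ] F
  isOpen_base : IsOpen U
  base_subset : U ⊆ (chartAt E x₀).source
  contMDiffOn_frame : ContMDiffOn (𝓘(ℝ, E).prod 𝓘(ℝ, F)) 𝓘(ℝ, E).tangent ∞
    (fun z : M × F => (⟨z.1, frame z.1 z.2⟩ : TangentBundle 𝓘(ℝ, E) M)) (U ×ˢ univ)
  contMDiffOn_coord : ContMDiffOn 𝓘(ℝ, E).tangent 𝓘(ℝ, F) ∞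
    (fun u : TangentBundle 𝓘(ℝ, E) M => coord u.1 u.2) {u | u.proj ∈ U}
  frame_mem : ∀ x ∈ U, ∀ ξ, frame x ξ ∈ W x
  coord_frame : ∀ x ∈ U, ∀ ξ, coord x (frame x ξ) = ξ
  frame_coord : ∀ x ∈ U, ∀ v ∈ W x, frame x (coord x v) = v

/-- Around every point `W` has a local frame modelled on a Banach space. -/
def HasLocalFrames (W : ∀ x : M, Submodule ℝ (TangentSpace 𝓘(ℝ, E) x)) : Prop :=
  ∀ x₀ : M, ∃ U : Set M, x₀ ∈ U ∧ ∃ (F : Type u) (_ : NormedAddCommGroup F) (_ : NormedSpace ℝ F)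
    (_ : CompleteSpace F), Nonempty (LocalFrame W x₀ U F)

variable {V H W : ∀ x : M, Submodule ℝ (TangentSpace 𝓘(ℝ, E) x)} {U U' : Set M} {x₀ : M}
  {ΘV : ∀ x : M, F →L[ℝ] TangentSpace 𝓘(ℝ, E) x} {ΘH : ∀ x : M, G →L[ℝ] TangentSpace 𝓘(ℝ, E) x}

namespace IsFrameOn

lemma mono (hΘ : IsFrameOn W U ΘV) (h : U' ⊆ U) : IsFrameOn W U' ΘV where
  contMDiffOn := hΘ.contMDiffOn.mono (prod_mono h subset_rfl)
  injective x hx := hΘ.injective x (h hx)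
  range_eq x hx := hΘ.range_eq x (h hx)

lemma contMDiffOn_trivializationAt (hΘ : IsFrameOn W U ΘV) (hU : U ⊆ (chartAt E x₀).source) :
    ContMDiffOn (𝓘(ℝ, E).prod 𝓘(ℝ, F)) 𝓘(ℝ, E) ∞ (fun z : M × F =>
      (trivializationAt E (TangentSpace 𝓘(ℝ, E)) x₀).continuousLinearMapAt ℝ z.1 (ΘV z.1 z.2))
      (U ×ˢ univ) :=
  ((contMDiffOn_trivializationAt_snd x₀).comp hΘ.contMDiffOn fun _ hz => hU hz.1).congr
    fun _ hz => (trivializationAt_snd_eq (hU hz.1) _).symm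

lemma coprod (hV : IsFrameOn V U ΘV) (hH : IsFrameOn H U ΘH) (hVH : ∀ x, IsCompl (V x) (H x))
    (hU : U ⊆ (chartAt E x₀).source) :
    IsFrameOn (fun _ => ⊤) U (fun x => (ΘV x).coprod (ΘH x)) where
  contMDiffOn := by
    refine contMDiffOn_tangentBundle_of_trivializationAt x₀ (fun z hz => hU hz.1)
      contMDiff_fst.contMDiffOn ?_
    have hfst : ContMDiffOn (𝓘(ℝ, E).prod 𝓘(ℝ, F × G)) (𝓘(ℝ, E).prod 𝓘(ℝ, F)) ∞
        (fun z : M × F × G => (z.1, z.2.1)) (U ×ˢ univ) :=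
      (contMDiff_fst.prodMk ((ContinuousLinearMap.fst ℝ F G).contDiff.contMDiff.comp
        contMDiff_snd)).contMDiffOn
    have hsnd : ContMDiffOn (𝓘(ℝ, E).prod 𝓘(ℝ, F × G)) (𝓘(ℝ, E).prod 𝓘(ℝ, G)) ∞
        (fun z : M × F × G => (z.1, z.2.2)) (U ×ˢ univ) :=
      (contMDiff_fst.prodMk ((ContinuousLinearMap.snd ℝ F G).contDiff.contMDiff.comp
        contMDiff_snd)).contMDiffOn
    have hV' := (hV.contMDiffOn_trivializationAt hU).comp hfst fun z hz => ⟨hz.1, mem_univ _⟩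
    have hH' := (hH.contMDiffOn_trivializationAt hU).comp hsnd fun z hz => ⟨hz.1, mem_univ _⟩
    exact (hV'.add hH').congr fun z hz =>
      (trivializationAt_snd_eq (hU hz.1) _).trans (map_add _ _ _)
  injective x hx := by
    have hdisj : Disjoint (ΘV x).range (ΘH x).range := by
      rw [hV.range_eq x hx, hH.range_eq x hx]
      exact (hVH x).disjoint
    refine LinearMap.ker_eq_bot.1 ((LinearMap.ker_coprod_of_disjoint_range _ _ hdisj).trans ?_)
    rw [LinearMap.ker_eq_bot.2 (hV.injective x hx), LinearMap.ker_eq_bot.2 (hH.injective x hx),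
      Submodule.prod_bot]
  range_eq x hx := by
    refine (LinearMap.range_coprod _ _).trans ?_
    exact (congrArg₂ _ (hV.range_eq x hx) (hH.range_eq x hx)).trans (hVH x).sup_eq_top

lemma bijective (hΘ : IsFrameOn (fun _ => ⊤) U ΘV) {x : M} (hx : x ∈ U) :
    Function.Bijective (ΘV x) :=
  ⟨hΘ.injective x hx, LinearMap.range_eq_top.1 (hΘ.range_eq x hx)⟩

variable [CompleteSpace E] [CompleteSpace F]

lemma inverse_apply_apply (hΘ : IsFrameOn (fun _ => ⊤) U ΘV) {x : M} (hx : x ∈ U) (ξ : F) :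
    (ΘV x).inverse (ΘV x ξ) = ξ :=
  clm_inverse_apply_apply (E₂ := E) (hΘ.bijective hx) ξ

lemma contMDiffOn_inverse (hΘ : IsFrameOn (fun _ => ⊤) U ΘV) (hU : IsOpen U)
    (hUs : U ⊆ (chartAt E x₀).source) :
    ContMDiffOn 𝓘(ℝ, E).tangent 𝓘(ℝ, F) ∞
      (fun u : TangentBundle 𝓘(ℝ, E) M => (ΘV u.1).inverse u.2) {u | u.proj ∈ U} := by
  let τ : ∀ x : M, TangentSpace 𝓘(ℝ, E) x →L[ℝ] E := fun x =>
    (trivializationAt E (TangentSpace 𝓘(ℝ, E)) x₀).continuousLinearMapAt ℝ x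
  let L : M → F →L[ℝ] E := fun x => (τ x).comp (ΘV x)
  have hL : ∀ x ∈ U, Function.Bijective (L x) := fun x hx =>
    (bijective_continuousLinearMapAt (hUs hx)).comp (hΘ.bijective hx)
  have hLinv := (contMDiffOn_clm_inverse (contMDiffOn_clm_of_uncurry hU
    (hΘ.contMDiffOn_trivializationAt hUs)) hL).comp
    (contMDiff_proj (TangentSpace 𝓘(ℝ, E))).contMDiffOn
    fun (u : TangentBundle 𝓘(ℝ, E) M) (hu : u.proj ∈ U) => hu
  refine (hLinv.clm_apply ((contMDiffOn_trivializationAt_snd x₀).mono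
    fun u (hu : u.proj ∈ U) => hUs hu)).congr fun u (hu : u.proj ∈ U) => ?_
  obtain ⟨ξ, hξ⟩ := (hΘ.bijective hu).2 u.2
  rw [← hξ, hΘ.inverse_apply_apply hu]
  refine (clm_inverse_apply_apply (hL u.proj hu) ξ).symm.trans ?_
  exact congrArg (L u.proj).inverse
    ((congrArg (τ u.proj) hξ).trans (trivializationAt_snd_eq (hUs hu) u.2).symm)

end IsFrameOn

lemma LocalFrame.isFrameOn (fr : LocalFrame W x₀ U F) : IsFrameOn W U fr.frame where
  contMDiffOn := fr.contMDiffOn_frame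
  injective x hx := Function.LeftInverse.injective (fr.coord_frame x hx)
  range_eq x hx := le_antisymm (by rintro _ ⟨ξ, rfl⟩; exact fr.frame_mem x hx ξ)
    fun v hv => ⟨_, fr.frame_coord x hx v hv⟩

/-- The local frame given by a frame and a smooth left inverse of it. -/
def IsFrameOn.localFrame (hΘ : IsFrameOn W U ΘV) (hU : IsOpen U)
    (hUs : U ⊆ (chartAt E x₀).source) (R : ∀ x : M, TangentSpace 𝓘(ℝ, E) x →L[ℝ] F)
    (hR : ContMDiffOn 𝓘(ℝ, E).tangent 𝓘(ℝ, F) ∞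
      (fun u : TangentBundle 𝓘(ℝ, E) M => R u.1 u.2) {u | u.proj ∈ U})
    (hRΘ : ∀ x ∈ U, ∀ ξ, R x (ΘV x ξ) = ξ) : LocalFrame W x₀ U F where
  frame := ΘV
  coord := R
  isOpen_base := hU
  base_subset := hUs
  contMDiffOn_frame := hΘ.contMDiffOn
  contMDiffOn_coord := hR
  frame_mem x hx ξ := hΘ.range_eq x hx ▸ ⟨ξ, rfl⟩
  coord_frame := hRΘ
  frame_coord x hx v hv := by
    rw [← hΘ.range_eq x hx] at hv
    obtain ⟨ξ, rfl⟩ := hv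
    exact congrArg (ΘV x) (hRΘ x hx ξ)

/-- Local frames of two complementary subbundles whose coordinates vanish on the other one. -/
structure AdaptedFrame (V H : ∀ x : M, Submodule ℝ (TangentSpace 𝓘(ℝ, E) x)) (x₀ : M) (U : Set M)
    (F G : Type*) [NormedAddCommGroup F] [NormedSpace ℝ F] [NormedAddCommGroup G]
    [NormedSpace ℝ G] where
  ver : LocalFrame V x₀ U F
  hor : LocalFrame H x₀ U G
  ver_coord_eq_zero : ∀ x ∈ U, ∀ v ∈ H x, ver.coord x v = 0
  hor_coord_eq_zero : ∀ x ∈ U, ∀ v ∈ V x, hor.coord x v = 0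

variable [CompleteSpace E]

lemma hasLocalFrames_top :
    HasLocalFrames (fun x : M => (⊤ : Submodule ℝ (TangentSpace 𝓘(ℝ, E) x))) := by
  intro x₀
  let e := trivializationAt E (TangentSpace 𝓘(ℝ, E) : M → Type _) x₀
  refine ⟨(chartAt E x₀).source, mem_chart_source E x₀, E, inferInstance, inferInstance,
    inferInstance, ⟨{
      frame := e.symmL ℝ
      coord := e.continuousLinearMapAt ℝ
      isOpen_base := (chartAt E x₀).open_source
      base_subset := subset_rfl
      contMDiffOn_frame := ?_
      contMDiffOn_coord := (contMDiffOn_trivializationAt_snd x₀).congr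
        fun u hu => (trivializationAt_snd_eq hu u.2).symm
      frame_mem := fun _ _ _ => Submodule.mem_top
      coord_frame := fun x hx ξ => e.continuousLinearMapAt_symmL hx ξ
      frame_coord := fun x hx v _ => e.symmL_continuousLinearMapAt hx v }⟩⟩
  refine contMDiffOn_tangentBundle_of_trivializationAt x₀ (fun z hz => hz.1)
    contMDiff_fst.contMDiffOn (contMDiff_snd.contMDiffOn.congr fun z hz => ?_)
  exact (trivializationAt_snd_eq hz.1 _).trans (e.continuousLinearMapAt_symmL hz.1 z.2)

lemma IsSmoothSubbundle.hasLocalFrames (hW : IsSmoothSubbundle W) : HasLocalFrames W := by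
  intro x₀
  obtain ⟨U', hU', hx₀, F, _, _, G, _, _, Θ, hΘ, hmem⟩ := hW x₀
  let Θ₀ : (F × G) ≃L[ℝ] E := Θ x₀
  have : CompleteSpace (F × G) :=
    (completeSpace_congr (e := Θ₀.toEquiv) Θ₀.isUniformEmbedding).2 inferInstance
  have : CompleteSpace F := .fst_of_prod (β := G)
  let U := U' ∩ (chartAt E x₀).source
  have hU : IsOpen U := hU'.inter (chartAt E x₀).open_source
  have hframe : IsFrameOn (fun _ => ⊤) U
      (fun x => (Θ x : F × G →L[ℝ] TangentSpace 𝓘(ℝ, E) x)) :=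
    { contMDiffOn := hΘ.mono (prod_mono inter_subset_left subset_rfl)
      injective := fun x _ => (Θ x).injective
      range_eq := fun x _ => LinearMap.range_eq_top.2 (Θ x).surjective }
  refine ⟨U, ⟨hx₀, mem_chart_source E x₀⟩, F, _, _, ‹_›, ⟨{
    frame := fun x => (Θ x : F × G →L[ℝ] TangentSpace 𝓘(ℝ, E) x).comp
      (ContinuousLinearMap.inl ℝ F G)
    coord := fun x => (ContinuousLinearMap.fst ℝ F G).comp
      ((Θ x).symm : TangentSpace 𝓘(ℝ, E) x →L[ℝ] F × G)
    isOpen_base := hU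
    base_subset := inter_subset_right
    contMDiffOn_frame := ?_
    contMDiffOn_coord := ?_
    frame_mem := fun x hx ξ => (hmem x hx.1 ξ 0).2 rfl
    coord_frame := fun x _ ξ => by simp
    frame_coord := fun x hx v hv => ?_ }⟩⟩
  · exact hframe.contMDiffOn.comp (contMDiff_fst.prodMk
      ((ContinuousLinearMap.inl ℝ F G).contDiff.contMDiff.comp contMDiff_snd)).contMDiffOn
      fun z hz => ⟨hz.1, mem_univ _⟩
  · refine ((ContinuousLinearMap.fst ℝ F G).contDiff.contMDiff.comp_contMDiffOn
      (hframe.contMDiffOn_inverse hU inter_subset_right)).congr fun u _ => ?_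
    simp
  · obtain ⟨⟨ξ, b⟩, rfl⟩ := (Θ x).surjective v
    obtain rfl := (hmem x hx.1 ξ b).1 hv
    simp

lemma exists_adaptedFrame [CompleteSpace F] [CompleteSpace G] (hU : IsOpen U)
    (hUs : U ⊆ (chartAt E x₀).source) (hV : IsFrameOn V U ΘV) (hH : IsFrameOn H U ΘH)
    (hVH : ∀ x, IsCompl (V x) (H x)) :
    ∃ fr : AdaptedFrame V H x₀ U F G, fr.ver.frame = ΘV := by
  have hΘ := hV.coprod hH hVH hUs
  let R : ∀ x : M, TangentSpace 𝓘(ℝ, E) x →L[ℝ] F × G := fun x =>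
    ((ΘV x).coprod (ΘH x)).inverse
  have hRV : ∀ x ∈ U, ∀ ξ, R x (ΘV x ξ) = (ξ, 0) := fun x hx ξ => by
    simpa using hΘ.inverse_apply_apply hx (ξ, 0)
  have hRH : ∀ x ∈ U, ∀ a, R x (ΘH x a) = (0, a) := fun x hx a => by
    simpa using hΘ.inverse_apply_apply hx (0, a)
  have hR := hΘ.contMDiffOn_inverse hU hUs
  refine ⟨{
    ver := hV.localFrame hU hUs (fun x => (ContinuousLinearMap.fst ℝ F G).comp (R x))
      ((ContinuousLinearMap.fst ℝ F G).contDiff.contMDiff.comp_contMDiffOn hR)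
      fun x hx ξ => congrArg Prod.fst (hRV x hx ξ)
    hor := hH.localFrame hU hUs (fun x => (ContinuousLinearMap.snd ℝ F G).comp (R x))
      ((ContinuousLinearMap.snd ℝ F G).contDiff.contMDiff.comp_contMDiffOn hR)
      fun x hx a => congrArg Prod.snd (hRH x hx a)
    ver_coord_eq_zero := fun x hx v hv => ?_
    hor_coord_eq_zero := fun x hx v hv => ?_ }, rfl⟩
  · rw [← hH.range_eq x hx] at hv
    obtain ⟨a, rfl⟩ := hv
    exact congrArg Prod.fst (hRH x hx a)
  · rw [← hV.range_eq x hx] at hv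
    obtain ⟨ξ, rfl⟩ := hv
    exact congrArg Prod.snd (hRV x hx ξ)

end Frames

/-! ### Flow lines of sprays -/

section FlowLines

variable {E : Type u} [NormedAddCommGroup E] [NormedSpace ℝ E]
  {M : Type*} [TopologicalSpace M] [ChartedSpace E M]

/-- The part of the domain of the inverse chart at `x₀` which lies over `U`. -/
def chartPreimage (E : Type u) [NormedAddCommGroup E] [NormedSpace ℝ E]
    {M : Type*} [TopologicalSpace M] [ChartedSpace E M] (x₀ : M) (U : Set M) : Set E :=
  (extChartAt 𝓘(ℝ, E) x₀).target ∩ (extChartAt 𝓘(ℝ, E) x₀).symm ⁻¹' U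

lemma isOpen_chartPreimage {U : Set M} (x₀ : M) (hU : IsOpen U) :
    IsOpen (chartPreimage E x₀ U) :=
  (continuousOn_extChartAt_symm x₀).isOpen_inter_preimage (isOpen_extChartAt_target x₀) hU

lemma extChartAt_mem_chartPreimage {U : Set M} {x₀ x : M} (hUs : U ⊆ (chartAt E x₀).source)
    (hx : x ∈ U) : extChartAt 𝓘(ℝ, E) x₀ x ∈ chartPreimage E x₀ U := by
  have hxs : x ∈ (extChartAt 𝓘(ℝ, E) x₀).source := by rw [extChartAt_source]; exact hUs hx
  refine ⟨(extChartAt 𝓘(ℝ, E) x₀).map_source hxs, ?_⟩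
  rwa [mem_preimage, (extChartAt 𝓘(ℝ, E) x₀).left_inv hxs]

variable [IsManifold 𝓘(ℝ, E) ∞ M]

/-- The chart of the total space of `W` given by a chart of `M` and a local frame of `W`. -/
def LocalFrame.chart {W : ∀ x : M, Submodule ℝ (TangentSpace 𝓘(ℝ, E) x)} {x₀ : M} {U : Set M}
    {F : Type*} [NormedAddCommGroup F] [NormedSpace ℝ F] (fr : LocalFrame W x₀ U F) :
    SubmanifoldChart 𝓘(ℝ, E).tangent (totalSet W) (E × F) where
  toFun u := (extChartAt 𝓘(ℝ, E) x₀ u.proj, fr.coord u.1 u.2)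
  invFun q := ⟨(extChartAt 𝓘(ℝ, E) x₀).symm q.1,
    fr.frame ((extChartAt 𝓘(ℝ, E) x₀).symm q.1) q.2⟩
  source := {u | u.proj ∈ U}
  target := chartPreimage E x₀ U ×ˢ univ
  isOpen_source := fr.isOpen_base.preimage (FiberBundle.continuous_proj E _)
  isOpen_target := (isOpen_chartPreimage x₀ fr.isOpen_base).prod isOpen_univ
  contMDiffOn_toFun := ((contMDiffOn_extChartAt (n := ∞)).comp
    (contMDiff_proj (TangentSpace 𝓘(ℝ, E))).contMDiffOn fun _ hu => fr.base_subset hu).prodMk_space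
    fr.contMDiffOn_coord
  contMDiffOn_invFun := by
    have hproj : ContMDiffOn 𝓘(ℝ, E × F) 𝓘(ℝ, E) ∞
        (fun q : E × F => (extChartAt 𝓘(ℝ, E) x₀).symm q.1) (chartPreimage E x₀ U ×ˢ univ) :=
      (contMDiffOn_extChartAt_symm x₀).comp
        (contDiff_fst (𝕜 := ℝ) (E := E) (F := F)).contMDiff.contMDiffOn fun q hq => hq.1.1
    exact fr.contMDiffOn_frame.comp (hproj.prodMk
      (contDiff_snd (𝕜 := ℝ) (E := E) (F := F)).contMDiff.contMDiffOn)
      fun q hq => ⟨hq.1.2, mem_univ _⟩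
  map_source u _ hu := ⟨extChartAt_mem_chartPreimage fr.base_subset hu, mem_univ _⟩
  map_target q hq := ⟨fr.frame_mem _ hq.1.2 _, hq.1.2⟩
  left_inv u hu hus := by
    have hxs : u.proj ∈ (extChartAt 𝓘(ℝ, E) x₀).source := by
      rw [extChartAt_source]
      exact fr.base_subset hus
    rw [(extChartAt 𝓘(ℝ, E) x₀).left_inv hxs, fr.frame_coord _ hus _ hu]
  right_inv q hq :=
    Prod.ext ((extChartAt 𝓘(ℝ, E) x₀).right_inv hq.1.1) (fr.coord_frame _ hq.1.2 q.2)

lemma t2Space_tangentBundle [T2Space M] : T2Space (TangentBundle 𝓘(ℝ, E) M) := by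
  refine ⟨fun v w hvw => ?_⟩
  by_cases h : v.proj = w.proj
  · let e := trivializationAt E (TangentSpace 𝓘(ℝ, E) : M → Type _) v.proj
    have hv : v ∈ e.source := e.mem_source.2 (mem_baseSet_trivializationAt _ _ _)
    have hw : w ∈ e.source := e.mem_source.2 (h ▸ mem_baseSet_trivializationAt _ _ _)
    obtain ⟨A, B, hA, hB, hvA, hwB, hAB⟩ := t2_separation fun h' => hvw (e.injOn hv hw h')
    exact ⟨_, _, e.toOpenPartialHomeomorph.isOpen_inter_preimage hA,
      e.toOpenPartialHomeomorph.isOpen_inter_preimage hB, ⟨hv, hvA⟩, ⟨hw, hwB⟩,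
      (hAB.preimage e).mono inter_subset_right inter_subset_right⟩
  · exact separated_by_continuous (FiberBundle.continuous_proj E _) h

lemma trivializationAt_fibreScale (c : ℝ) (x₀ : M) {v : TangentBundle 𝓘(ℝ, E) M}
    (hv : v.proj ∈ (chartAt E x₀).source) :
    (trivializationAt E (TangentSpace 𝓘(ℝ, E)) x₀ (fibreScale c v)).2 =
      c • (trivializationAt E (TangentSpace 𝓘(ℝ, E)) x₀ v).2 :=
  ((trivializationAt E (TangentSpace 𝓘(ℝ, E)) x₀).linear ℝ
    (b := v.proj) hv).map_smul c v.2

lemma contMDiff_fibreScale (c : ℝ) : ContMDiff 𝓘(ℝ, E).tangent 𝓘(ℝ, E).tangent ∞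
    (fibreScale c : TangentBundle 𝓘(ℝ, E) M → TangentBundle 𝓘(ℝ, E) M) := by
  intro v₀
  have hopen : IsOpen {v : TangentBundle 𝓘(ℝ, E) M | v.proj ∈ (chartAt E v₀.proj).source} :=
    (chartAt E v₀.proj).open_source.preimage (FiberBundle.continuous_proj E _)
  refine ContMDiffOn.contMDiffAt ?_ (hopen.mem_nhds (mem_chart_source E v₀.proj))
  refine contMDiffOn_tangentBundle_of_trivializationAt v₀.proj (fun _ hv => hv)
    (contMDiff_proj (TangentSpace 𝓘(ℝ, E))).contMDiffOn ?_
  exact ((c • ContinuousLinearMap.id ℝ E).contDiff.contMDiff.comp_contMDiffOn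
    (contMDiffOn_trivializationAt_snd v₀.proj)).congr
    fun v hv => trivializationAt_fibreScale c v₀.proj hv

variable {W : ∀ x : M, Submodule ℝ (TangentSpace 𝓘(ℝ, E) x)}
  {S : ∀ v : TangentBundle 𝓘(ℝ, E) M, TangentSpace 𝓘(ℝ, E).tangent v}
  {γ γ₀ γ₁ : ℝ → TangentBundle 𝓘(ℝ, E) M}

namespace IsSpray

lemma isFlowLine_fibreScale (hS : IsSpray W S) (c : ℝ)
    (hW : ∀ t ∈ Icc (0 : ℝ) 1, γ t ∈ totalSet W)
    (hγ : ∀ t ∈ Icc (0 : ℝ) 1, HasMFDerivWithinAt 𝓘(ℝ, ℝ) 𝓘(ℝ, E).tangent γ (Icc (0 : ℝ) 1) t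
      ((1 : ℝ →L[ℝ] ℝ).smulRight (c • S (γ t)))) :
    IsFlowLine W S (fibreScale c ∘ γ) := by
  refine ⟨fun t ht => (W _).smul_mem c (hW t ht), fun t ht => ?_⟩
  have hd := (((contMDiff_fibreScale c).contMDiffAt (x := γ t)).mdifferentiableAt
    (by simp)).hasMFDerivAt
  have h := hasMFDerivWithinAt_comp_velocity (hγ t ht) hd
  rwa [← hS.homogeneous c (γ t) (hW t ht)] at h

lemma isFlowLine_fibreScale_comp_mul (hS : IsSpray W S) (hγ : IsFlowLine W S γ) {c : ℝ}
    (hc : c ∈ Icc (0 : ℝ) 1) : IsFlowLine W S (fun t => fibreScale c (γ (c * t))) := by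
  have hmaps : ∀ t ∈ Icc (0 : ℝ) 1, c * t ∈ Icc (0 : ℝ) 1 := fun t ht =>
    ⟨mul_nonneg hc.1 ht.1, mul_le_one₀ hc.2 ht.1 ht.2⟩
  refine hS.isFlowLine_fibreScale c (γ := fun t => γ (c * t)) (fun t ht => hγ.1 _ (hmaps t ht))
    fun t ht => ?_
  have hmul : HasMFDerivWithinAt 𝓘(ℝ, ℝ) 𝓘(ℝ, ℝ) (fun t : ℝ => c * t) (Icc (0 : ℝ) 1) t
      ((1 : ℝ →L[ℝ] ℝ).smulRight c) := by
    have := (hasDerivWithinAt_id t (Icc (0 : ℝ) 1)).const_mul c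
    exact hasMFDerivWithinAt_smulRight_iff.2 (by rwa [mul_one] at this)
  refine ((hγ.2 _ (hmaps t ht)).comp t hmul hmaps).congr_mfderiv ?_
  exact ContinuousLinearMap.ext fun (a : ℝ) => mul_smul a c (S (γ (c * t)))

lemma isFlowLine_zeroVec (hS : IsSpray W S) (x : M) : IsFlowLine W S (fun _ => zeroVec x) := by
  have hz : (zeroVec x : TangentBundle 𝓘(ℝ, E) M) ∈ totalSet W := (W x).zero_mem
  have h := hS.isFlowLine_fibreScale 0 (γ := fun _ => zeroVec x) (fun _ _ => hz) fun t _ => by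
    refine (hasMFDerivWithinAt_const (zeroVec x) _ t).congr_mfderiv ?_
    refine ContinuousLinearMap.ext fun (a : ℝ) => ?_
    exact ((congrArg (a • ·) (zero_smul ℝ (S (zeroVec x)))).trans (smul_zero a)).symm
  have hcomp : (fibreScale 0 ∘ fun _ : ℝ => (zeroVec x : TangentBundle 𝓘(ℝ, E) M)) =
      fun _ => zeroVec x := by
    funext t
    simp [fibreScale, zeroVec]
  rwa [hcomp] at h

lemma eqOn_of_isFlowLine [T2Space M] (hS : IsSpray W S) (hW : HasLocalFrames W)
    (h₀ : IsFlowLine W S γ₀) (h₁ : IsFlowLine W S γ₁) (h : γ₀ 0 = γ₁ 0) :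
    EqOn γ₀ γ₁ (Icc (0 : ℝ) 1) := by
  have := t2Space_tangentBundle (E := E) (M := M)
  refine eqOn_of_isMIntegralCurveOn (fun w _ => ?_) hS.smooth h₀.2 h₁.2 h₀.1 h₁.1 h
  obtain ⟨U, hxU, F, _, _, _, ⟨fr⟩⟩ := hW w.proj
  exact ⟨E × F, inferInstance, inferInstance, fr.chart, hxU⟩

lemma sprayExp_eq [T2Space M] (hS : IsSpray W S) (hW : HasLocalFrames W)
    (hγ : IsFlowLine W S γ) : sprayExp W S (γ 0) = (γ 1).proj := by
  have h : ∃ γ' : ℝ → TangentBundle 𝓘(ℝ, E) M, IsFlowLine W S γ' ∧ γ' 0 = γ 0 := ⟨γ, hγ, rfl⟩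
  rw [sprayExp, dif_pos h,
    hS.eqOn_of_isFlowLine hW h.choose_spec.1 hγ h.choose_spec.2 (right_mem_Icc.2 zero_le_one)]

lemma fibreScale_mem_expDomain (hS : IsSpray W S) (hγ : IsFlowLine W S γ) {t : ℝ}
    (ht : t ∈ Icc (0 : ℝ) 1) : fibreScale t (γ 0) ∈ expDomain W S :=
  ⟨_, hS.isFlowLine_fibreScale_comp_mul hγ ht, by rw [mul_zero]⟩

lemma sprayExp_fibreScale [T2Space M] (hS : IsSpray W S) (hW : HasLocalFrames W)
    (hγ : IsFlowLine W S γ) {t : ℝ} (ht : t ∈ Icc (0 : ℝ) 1) :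
    sprayExp W S (fibreScale t (γ 0)) = (γ t).proj := by
  have h := hS.sprayExp_eq hW (hS.isFlowLine_fibreScale_comp_mul hγ ht)
  rwa [mul_zero, mul_one] at h

lemma hasMFDerivWithinAt_proj (hS : IsSpray W S) (hγ : IsFlowLine W S γ) {t : ℝ}
    (ht : t ∈ Icc (0 : ℝ) 1) :
    HasMFDerivWithinAt 𝓘(ℝ, ℝ) 𝓘(ℝ, E) (fun s => (γ s).proj) (Icc (0 : ℝ) 1) t
      ((1 : ℝ →L[ℝ] ℝ).smulRight (γ t).2) := by
  have hproj := (contMDiff_proj (n := ∞) (IB := 𝓘(ℝ, E))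
    (TangentSpace 𝓘(ℝ, E) : M → Type _)).mdifferentiableAt (x := γ t) (by simp)
  have h := hasMFDerivWithinAt_comp_velocity (hγ.2 t ht) hproj.hasMFDerivAt
  rwa [hS.anchor _ (hγ.1 t ht)] at h

end IsSpray

end FlowLines

/-! ### Parallel transport in a local frame -/

lemma eqOn_Icc_of_hasDerivWithinAt_clm_apply {F : Type*} [NormedAddCommGroup F] [NormedSpace ℝ F]
    {a b : ℝ} {L : ℝ → F →L[ℝ] F} (hL : ContinuousOn L (Icc a b)) {y z : ℝ → F}
    (hy : ∀ t ∈ Icc a b, HasDerivWithinAt y (L t (y t)) (Icc a b) t)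
    (hz : ∀ t ∈ Icc a b, HasDerivWithinAt z (L t (z t)) (Icc a b) t) (h : y a = z a) :
    EqOn y z (Icc a b) := by
  obtain ⟨C, hC⟩ := isCompact_Icc.exists_bound_of_continuousOn hL
  have hLip : ∀ t ∈ Ico a b, LipschitzOnWith C.toNNReal (fun ζ : F => L t ζ) univ := fun t ht =>
    ((L t).lipschitz.weaken ((hC t (Ico_subset_Icc_self ht)).trans
      (Real.le_coe_toNNReal C))).lipschitzOnWith
  have hright : ∀ {w : ℝ → F}, (∀ t ∈ Icc a b, HasDerivWithinAt w (L t (w t)) (Icc a b) t) →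
      ∀ t ∈ Ico a b, HasDerivWithinAt w (L t (w t)) (Ici t) t := fun hw t ht =>
    (hw t (Ico_subset_Icc_self ht)).mono_of_mem_nhdsWithin (Icc_mem_nhdsGE_of_mem ht)
  exact ODE_solution_unique_of_mem_Icc_right (s := fun _ => univ) hLip
    (fun t ht => (hy t ht).continuousWithinAt) (hright hy) (fun _ _ => mem_univ _)
    (fun t ht => (hz t ht).continuousWithinAt) (hright hz) (fun _ _ => mem_univ _) h

section ParallelTransport

variable {E : Type u} [NormedAddCommGroup E] [NormedSpace ℝ E]
  {M : Type*} [TopologicalSpace M] [ChartedSpace E M] [IsManifold 𝓘(ℝ, E) ∞ M]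
  {F : Type*} [NormedAddCommGroup F] [NormedSpace ℝ F]

/-- The value `B x (X, ·)` of the Christoffel form `B` at the tangent vector `X`, which is
represented in the trivialisation of `TM` at `x₀`. -/
def connectionMatrix (x₀ : M) (B : M → E →L[ℝ] F →L[ℝ] F) (X : TangentBundle 𝓘(ℝ, E) M) :
    F →L[ℝ] F :=
  B X.proj (trivializationAt E (TangentSpace 𝓘(ℝ, E)) x₀ X).2

variable {V : ∀ x : M, Submodule ℝ (TangentSpace 𝓘(ℝ, E) x)} {x₀ : M} {U : Set M}
  {B : M → E →L[ℝ] F →L[ℝ] F}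

lemma contMDiffOn_connectionMatrix (hB : ContMDiffOn 𝓘(ℝ, E) 𝓘(ℝ, E →L[ℝ] F →L[ℝ] F) ∞ B U)
    (hUs : U ⊆ (chartAt E x₀).source) :
    ContMDiffOn 𝓘(ℝ, E).tangent 𝓘(ℝ, F →L[ℝ] F) ∞ (connectionMatrix x₀ B) {u | u.proj ∈ U} :=
  (hB.comp (contMDiff_proj (TangentSpace 𝓘(ℝ, E))).contMDiffOn fun _ hu => hu).clm_apply
    ((contMDiffOn_trivializationAt_snd x₀).mono fun _ hu => hUs hu)

lemma connectionMatrix_fibreScale (c : ℝ) {X : TangentBundle 𝓘(ℝ, E) M}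
    (hX : X.proj ∈ (chartAt E x₀).source) :
    connectionMatrix x₀ B (fibreScale c X) = c • connectionMatrix x₀ B X := by
  rw [connectionMatrix, trivializationAt_fibreScale c x₀ hX, map_smul]
  rfl

/-- In the frame `fr`, the connector `K` has the Christoffel form `B`. -/
def LocalFrame.IsChristoffelForm (fr : LocalFrame V x₀ U F)
    (K : ∀ v : TangentBundle 𝓘(ℝ, E) M,
      TangentSpace 𝓘(ℝ, E).tangent v → TangentSpace 𝓘(ℝ, E) v.proj)
    (B : M → E →L[ℝ] F →L[ℝ] F) : Prop :=
  ∀ x ∈ U, ∀ (ξ : F) (X : TangentSpace 𝓘(ℝ, E) x) (η : F),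
    K ⟨x, fr.frame x ξ⟩
      (mfderiv (𝓘(ℝ, E).prod 𝓘(ℝ, F)) 𝓘(ℝ, E).tangent
        (fun z : M × F => (⟨z.1, fr.frame z.1 z.2⟩ : TangentBundle 𝓘(ℝ, E) M))
        (x, ξ) (X, η)) =
    fr.frame x (η + connectionMatrix x₀ B ⟨x, X⟩ ξ)

variable {fr : LocalFrame V x₀ U F}
  {K : ∀ v : TangentBundle 𝓘(ℝ, E) M,
    TangentSpace 𝓘(ℝ, E).tangent v → TangentSpace 𝓘(ℝ, E) v.proj}

lemma connector_eq_zero_congr {v v' : TangentBundle 𝓘(ℝ, E) M} (h : v = v')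
    {w : TangentSpace 𝓘(ℝ, E).tangent v} {w' : TangentSpace 𝓘(ℝ, E).tangent v'}
    (hw : (w : E × E) = w') (h0 : K v w = 0) : K v' w' = 0 := by
  subst h
  cases hw
  exact h0

lemma LocalFrame.IsChristoffelForm.exists_velocity (hK : fr.IsChristoffelForm K B) {c : ℝ → M}
    {s : Set ℝ} {t : ℝ} (ht : c t ∈ U) {X : TangentSpace 𝓘(ℝ, E) (c t)}
    (hX : HasMFDerivWithinAt 𝓘(ℝ, ℝ) 𝓘(ℝ, E) c s t ((1 : ℝ →L[ℝ] ℝ).smulRight X)) {ξ : ℝ → F}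
    {ξ' : F} (hξ : HasDerivWithinAt ξ ξ' s t) :
    ∃ w : TangentSpace 𝓘(ℝ, E).tangent
        (⟨c t, fr.frame (c t) (ξ t)⟩ : TangentBundle 𝓘(ℝ, E) M),
      HasMFDerivWithinAt 𝓘(ℝ, ℝ) 𝓘(ℝ, E).tangent
        (fun r => (⟨c r, fr.frame (c r) (ξ r)⟩ : TangentBundle 𝓘(ℝ, E) M)) s t
        ((1 : ℝ →L[ℝ] ℝ).smulRight w) ∧
      K ⟨c t, fr.frame (c t) (ξ t)⟩ w =
        fr.frame (c t) (ξ' + connectionMatrix x₀ B ⟨c t, X⟩ (ξ t)) := by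
  have hpair : HasMFDerivWithinAt 𝓘(ℝ, ℝ) (𝓘(ℝ, E).prod 𝓘(ℝ, F)) (fun r => (c r, ξ r)) s t
      ((1 : ℝ →L[ℝ] ℝ).smulRight
        ((X, ξ') : TangentSpace (𝓘(ℝ, E).prod 𝓘(ℝ, F)) (c t, ξ t))) :=
    hX.prodMk (hasMFDerivWithinAt_smulRight_iff.2 hξ)
  have hframe := (fr.contMDiffOn_frame.contMDiffAt (x := (c t, ξ t))
    ((fr.isOpen_base.prod isOpen_univ).mem_nhds ⟨ht, mem_univ _⟩)).mdifferentiableAt (by simp)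
  exact ⟨_, hasMFDerivWithinAt_comp_velocity hpair hframe.hasMFDerivAt, hK (c t) ht (ξ t) X ξ'⟩

lemma isParallelAlong_congr {c c' : ℝ → M} (h : EqOn c c' (Icc (0 : ℝ) 1)) :
    IsParallelAlong V K c = IsParallelAlong V K c' := by
  funext η
  exact propext (forall₂_congr fun t ht => by rw [h ht])

lemma parallelTransport_congr {c c' : ℝ → M} (h : EqOn c c' (Icc (0 : ℝ) 1)) :
    parallelTransport V K c = parallelTransport V K c' := by
  funext v
  unfold parallelTransport
  rw [isParallelAlong_congr h]

lemma IsParallelAlong.eq_frame_coord {c : ℝ → M} {η : ℝ → TangentBundle 𝓘(ℝ, E) M}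
    (hη : IsParallelAlong V K c η) (fr : LocalFrame V x₀ U F) {t : ℝ} (ht : t ∈ Icc (0 : ℝ) 1)
    (hct : c t ∈ U) : η t = ⟨c t, fr.frame (c t) (fr.coord (η t).1 (η t).2)⟩ := by
  obtain ⟨hproj, hmem, -⟩ := hη t ht
  rw [← hproj] at hct ⊢
  exact congrArg (TotalSpace.mk (η t).proj) (fr.frame_coord _ hct _ hmem).symm

-- In the frame, `K ∘ η' = 0` is the linear equation `ξ' + B (c) (c', ξ) = 0`.
lemma IsParallelAlong.hasDerivWithinAt_coord {c : ℝ → M} {η : ℝ → TangentBundle 𝓘(ℝ, E) M}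
    (hη : IsParallelAlong V K c η) (hK : fr.IsChristoffelForm K B)
    (hcU : ∀ t ∈ Icc (0 : ℝ) 1, c t ∈ U) {t : ℝ} (ht : t ∈ Icc (0 : ℝ) 1)
    {X : TangentSpace 𝓘(ℝ, E) (c t)}
    (hX : HasMFDerivWithinAt 𝓘(ℝ, ℝ) 𝓘(ℝ, E) c (Icc (0 : ℝ) 1) t
      ((1 : ℝ →L[ℝ] ℝ).smulRight X)) :
    HasDerivWithinAt (fun s => fr.coord (η s).1 (η s).2)
      (-connectionMatrix x₀ B ⟨c t, X⟩ (fr.coord (η t).1 (η t).2)) (Icc (0 : ℝ) 1) t := by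
  obtain ⟨hproj, -, w, hw, hKw⟩ := hη t ht
  have hopen : IsOpen {u : TangentBundle 𝓘(ℝ, E) M | u.proj ∈ U} :=
    fr.isOpen_base.preimage (FiberBundle.continuous_proj E _)
  have hcoord := (fr.contMDiffOn_coord.contMDiffAt
    (hopen.mem_nhds (show (η t).proj ∈ U from hproj ▸ hcU t ht))).mdifferentiableAt (by simp)
  have hξ : HasDerivWithinAt (fun s => fr.coord (η s).1 (η s).2) _ (Icc (0 : ℝ) 1) t :=
    hasMFDerivWithinAt_smulRight_iff.1 (hasMFDerivWithinAt_comp_velocity hw hcoord.hasMFDerivAt)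
  obtain ⟨w', hw', hKw'⟩ := hK.exists_velocity (hcU t ht) hX hξ
  have hηfr : ∀ s ∈ Icc (0 : ℝ) 1, _ := fun s hs => hη.eq_frame_coord fr hs (hcU s hs)
  have hvelocity : (w : E × E) = w' := by
    have huniq : UniqueMDiffWithinAt 𝓘(ℝ, ℝ) (Icc (0 : ℝ) 1) t :=
      (uniqueDiffOn_Icc (zero_lt_one' ℝ) t ht).uniqueMDiffWithinAt
    have hone : ∀ v : E × E, ((1 : ℝ →L[ℝ] ℝ).smulRight v) (1 : ℝ) = v := fun v => by simp
    have heq := congrArg (fun L : ℝ →L[ℝ] E × E => L 1) (huniq.eq hw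
      (hw'.congr_of_eventuallyEq (eventually_of_mem self_mem_nhdsWithin hηfr) (hηfr t ht)))
    exact ((hone w).symm.trans heq).trans (hone w')
  rw [connector_eq_zero_congr (hηfr t ht) hvelocity hKw] at hKw'
  have hzero := congrArg (fr.coord (c t)) hKw'
  rw [map_zero, fr.coord_frame _ (hcU t ht)] at hzero
  rwa [eq_neg_of_add_eq_zero_left hzero.symm] at hξ

/-- The curve `γ` in `TM` is the velocity of its projection to `M`, which stays in `U`, and `A` is
the matrix of the parallel transport along this projection for the connection with the Christoffel
form `B`. -/
structure IsTransportMatrix (x₀ : M) (U : Set M) (B : M → E →L[ℝ] F →L[ℝ] F)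
    (γ : ℝ → TangentBundle 𝓘(ℝ, E) M) (A : ℝ → F →L[ℝ] F) : Prop where
  mem : ∀ t ∈ Icc (0 : ℝ) 1, (γ t).proj ∈ U
  velocity : ∀ t ∈ Icc (0 : ℝ) 1, HasMFDerivWithinAt 𝓘(ℝ, ℝ) 𝓘(ℝ, E) (fun s => (γ s).proj)
    (Icc (0 : ℝ) 1) t ((1 : ℝ →L[ℝ] ℝ).smulRight (γ t).2)
  continuousOn : ContinuousOn γ (Icc (0 : ℝ) 1)
  zero : A 0 = 1
  hasDerivWithinAt : ∀ t ∈ Icc (0 : ℝ) 1,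
    HasDerivWithinAt A (-(connectionMatrix x₀ B (γ t)).comp (A t)) (Icc (0 : ℝ) 1) t

namespace IsTransportMatrix

variable {γ : ℝ → TangentBundle 𝓘(ℝ, E) M} {A : ℝ → F →L[ℝ] F}

lemma hasDerivWithinAt_apply (hA : IsTransportMatrix x₀ U B γ A) (ξ : F) {t : ℝ}
    (ht : t ∈ Icc (0 : ℝ) 1) : HasDerivWithinAt (fun s => A s ξ)
      (-connectionMatrix x₀ B (γ t) (A t ξ)) (Icc (0 : ℝ) 1) t := by
  simpa using (hA.hasDerivWithinAt t ht).clm_apply (hasDerivWithinAt_const t _ ξ)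

lemma isParallelAlong (hA : IsTransportMatrix x₀ U B γ A) (hK : fr.IsChristoffelForm K B)
    (ξ : F) : IsParallelAlong V K (fun t => (γ t).proj)
      (fun t => ⟨(γ t).proj, fr.frame (γ t).proj (A t ξ)⟩) := by
  intro t ht
  obtain ⟨w, hw, hKw⟩ :=
    hK.exists_velocity (hA.mem t ht) (hA.velocity t ht) (hA.hasDerivWithinAt_apply ξ ht)
  exact ⟨rfl, fr.frame_mem _ (hA.mem t ht) _, w, hw, by rw [hKw, neg_add_cancel, map_zero]⟩

lemma exists_isParallelAlong (hA : IsTransportMatrix x₀ U B γ A) (hK : fr.IsChristoffelForm K B)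
    (ξ : F) : ∃ η, IsParallelAlong V K (fun t => (γ t).proj) η ∧
      η 0 = ⟨(γ 0).proj, fr.frame (γ 0).proj ξ⟩ :=
  ⟨_, hA.isParallelAlong hK ξ, by simp [hA.zero]⟩

lemma eq_of_isParallelAlong (hA : IsTransportMatrix x₀ U B γ A)
    (hB : ContMDiffOn 𝓘(ℝ, E) 𝓘(ℝ, E →L[ℝ] F →L[ℝ] F) ∞ B U) (hK : fr.IsChristoffelForm K B)
    {η : ℝ → TangentBundle 𝓘(ℝ, E) M} (hη : IsParallelAlong V K (fun t => (γ t).proj) η) :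
    η 1 = ⟨(γ 1).proj, fr.frame (γ 1).proj (A 1 (fr.coord (η 0).1 (η 0).2))⟩ := by
  have hL : ContinuousOn (fun t => -connectionMatrix x₀ B (γ t)) (Icc (0 : ℝ) 1) :=
    ((contMDiffOn_connectionMatrix hB fr.base_subset).continuousOn.comp hA.continuousOn hA.mem).neg
  have hone : (1 : ℝ) ∈ Icc (0 : ℝ) 1 := right_mem_Icc.2 zero_le_one
  have hcoord : fr.coord (η 1).1 (η 1).2 = A 1 (fr.coord (η 0).1 (η 0).2) :=
    eqOn_Icc_of_hasDerivWithinAt_clm_apply hL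
      (fun t ht => hη.hasDerivWithinAt_coord hK hA.mem ht (hA.velocity t ht))
      (fun t ht => hA.hasDerivWithinAt_apply (fr.coord (η 0).1 (η 0).2) ht)
      (by simp [hA.zero]) hone
  rw [hη.eq_frame_coord fr hone (hA.mem 1 hone), hcoord]

lemma parallelTransport_eq (hA : IsTransportMatrix x₀ U B γ A)
    (hB : ContMDiffOn 𝓘(ℝ, E) 𝓘(ℝ, E →L[ℝ] F →L[ℝ] F) ∞ B U) (hK : fr.IsChristoffelForm K B)
    (ξ : F) : parallelTransport V K (fun t => (γ t).proj) ⟨(γ 0).proj, fr.frame (γ 0).proj ξ⟩ =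
      ⟨(γ 1).proj, fr.frame (γ 1).proj (A 1 ξ)⟩ := by
  have hex := hA.exists_isParallelAlong hK ξ
  rw [parallelTransport, dif_pos hex, hA.eq_of_isParallelAlong hB hK hex.choose_spec.1,
    hex.choose_spec.2, fr.coord_frame _ (hA.mem 0 (left_mem_Icc.2 zero_le_one))]

end IsTransportMatrix

end ParallelTransport

/-! ### Horizontal flow and parallel transport -/

section Transport

variable {E : Type u} [NormedAddCommGroup E] [NormedSpace ℝ E]
  {M : Type*} [TopologicalSpace M] [ChartedSpace E M] [IsManifold 𝓘(ℝ, E) ∞ M]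
  {F G : Type*} [NormedAddCommGroup F] [NormedSpace ℝ F] [NormedAddCommGroup G] [NormedSpace ℝ G]
  {V H : ∀ x : M, Submodule ℝ (TangentSpace 𝓘(ℝ, E) x)} {x₀ : M} {U : Set M}
  {B : M → E →L[ℝ] F →L[ℝ] F}
  {S : ∀ v : TangentBundle 𝓘(ℝ, E) M, TangentSpace 𝓘(ℝ, E).tangent v}

/-- The vector field whose integral curves are the flow lines of `S`, in the chart given by the
frame `fr`, paired with solutions of the matrix equation of parallel transport along them. -/
def LocalFrame.transportField (fr : LocalFrame H x₀ U G)
    (S : ∀ v : TangentBundle 𝓘(ℝ, E) M, TangentSpace 𝓘(ℝ, E).tangent v)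
    (B : M → E →L[ℝ] F →L[ℝ] F) (z : (E × G) × (F →L[ℝ] F)) : (E × G) × (F →L[ℝ] F) :=
  (fr.chart.localField S z.1, -(connectionMatrix x₀ B (fr.chart.invFun z.1)).comp z.2)

namespace LocalFrame

variable {fr : LocalFrame H x₀ U G}

lemma contDiffOn_transportField (hS : IsSpray H S)
    (hB : ContMDiffOn 𝓘(ℝ, E) 𝓘(ℝ, E →L[ℝ] F →L[ℝ] F) ∞ B U) (s : Set (F →L[ℝ] F)) :
    ContDiffOn ℝ ∞ (fr.transportField S B) (fr.chart.target ×ˢ s) := by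
  have hmatrix : ContDiffOn ℝ ∞ (fun q => connectionMatrix x₀ B (fr.chart.invFun q))
      fr.chart.target :=
    contMDiffOn_iff_contDiffOn.1 ((contMDiffOn_connectionMatrix hB fr.base_subset).comp
      fr.chart.contMDiffOn_invFun fun q hq => (fr.chart.map_target q hq).2)
  have hfst : MapsTo Prod.fst (fr.chart.target ×ˢ s) fr.chart.target := fun z hz => hz.1
  exact ((fr.chart.contDiffOn_localField hS.smooth).comp contDiff_fst.contDiffOn hfst).prodMk
    ((hmatrix.comp contDiff_fst.contDiffOn hfst).clm_comp contDiff_snd.contDiffOn).neg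

variable {Z : ℝ → (E × G) × (F →L[ℝ] F)} {ε : ℝ}

lemma isFlowLine_of_hasDerivWithinAt (hS : IsSpray H S)
    (hZ : ∀ t ∈ Icc (0 : ℝ) 1, (Z t).1 ∈ fr.chart.target ∧
      HasDerivWithinAt Z (ε • fr.transportField S B (Z t)) (Icc (0 : ℝ) 1) t) :
    IsFlowLine H S (fun t => fibreScale ε (fr.chart.invFun (Z t).1)) :=
  hS.isFlowLine_fibreScale ε (γ := fun t => fr.chart.invFun (Z t).1)
    (fun t ht => (fr.chart.map_target _ (hZ t ht).1).1) fun t ht =>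
    fr.chart.hasMFDerivWithinAt_invFun_comp hS.mem_tangentSet (hZ t ht).2.fst (hZ t ht).1

lemma isTransportMatrix_of_hasDerivWithinAt (hS : IsSpray H S)
    (hZ : ∀ t ∈ Icc (0 : ℝ) 1, (Z t).1 ∈ fr.chart.target ∧
      HasDerivWithinAt Z (ε • fr.transportField S B (Z t)) (Icc (0 : ℝ) 1) t)
    (hZ₀ : (Z 0).2 = 1) :
    IsTransportMatrix x₀ U B (fun t => fibreScale ε (fr.chart.invFun (Z t).1))
      (fun t => (Z t).2) where
  mem t ht := (fr.chart.map_target _ (hZ t ht).1).2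
  velocity _ ht := hS.hasMFDerivWithinAt_proj (isFlowLine_of_hasDerivWithinAt hS hZ) ht
  continuousOn := (isFlowLine_of_hasDerivWithinAt hS hZ).2.continuousOn
  zero := hZ₀
  hasDerivWithinAt t ht := by
    rw [connectionMatrix_fibreScale ε (fr.base_subset (fr.chart.map_target _ (hZ t ht).1).2),
      ContinuousLinearMap.smul_comp, ← smul_neg]
    exact (hZ t ht).2.snd

theorem exists_transport [CompleteSpace E] [CompleteSpace F] [CompleteSpace G]
    (fr : LocalFrame H x₀ U G) (hx₀ : x₀ ∈ U) (hS : IsSpray H S)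
    (hB : ContMDiffOn 𝓘(ℝ, E) 𝓘(ℝ, E →L[ℝ] F →L[ℝ] F) ∞ B U) :
    ∃ dom : Set (M × G), IsOpen dom ∧ (x₀, 0) ∈ dom ∧
      ∃ (endpoint : M × G → M) (matrix : M × G → F →L[ℝ] F),
        ContMDiffOn (𝓘(ℝ, E).prod 𝓘(ℝ, G)) 𝓘(ℝ, E) ∞ endpoint dom ∧
        ContMDiffOn (𝓘(ℝ, E).prod 𝓘(ℝ, G)) 𝓘(ℝ, F →L[ℝ] F) ∞ matrix dom ∧
        ∀ z ∈ dom, IsUnit (matrix z) ∧ ∃ γ A, IsFlowLine H S γ ∧ γ 0 = ⟨z.1, fr.frame z.1 z.2⟩ ∧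
          IsTransportMatrix x₀ U B γ A ∧ (γ 1).proj = endpoint z ∧ A 1 = matrix z := by
  have hopen : IsOpen (fr.chart.target ×ˢ {A : F →L[ℝ] F | IsUnit A}) :=
    fr.chart.isOpen_target.prod Units.isOpen
  obtain ⟨ε, hε, D, hD, hDx₀, Γ, hΓ, hΓ_smooth⟩ := exists_contDiffOn_flow hopen
    (contDiffOn_transportField hS hB _) (z₀ := ((extChartAt 𝓘(ℝ, E) x₀ x₀, 0), 1))
    ⟨⟨extChartAt_mem_chartPreimage fr.base_subset hx₀, mem_univ _⟩, isUnit_one⟩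
  -- The flow of `S` is followed for a time `ε`; by homogeneity this is time `1` for `ε⁻¹`-scaled
  -- initial values.
  let j : M × G → (E × G) × (F →L[ℝ] F) := fun z => ((extChartAt 𝓘(ℝ, E) x₀ z.1, ε⁻¹ • z.2), 1)
  have hj : ContMDiffOn (𝓘(ℝ, E).prod 𝓘(ℝ, G)) 𝓘(ℝ, (E × G) × (F →L[ℝ] F)) ∞ j (U ×ˢ univ) :=
    ((contMDiffOn_extChartAt.comp contMDiff_fst.contMDiffOn
      fun z hz => fr.base_subset hz.1).prodMk_space
        ((contDiff_const_smul ε⁻¹).contMDiff.comp contMDiff_snd).contMDiffOn).prodMk_space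
      contMDiffOn_const
  let dom : Set (M × G) := (U ×ˢ univ) ∩ j ⁻¹' D
  have hend : ContMDiffOn (𝓘(ℝ, E).prod 𝓘(ℝ, G)) 𝓘(ℝ, (E × G) × (F →L[ℝ] F)) ∞
      (fun z => Γ (j z) 1) dom :=
    hΓ_smooth.contMDiffOn.comp (hj.mono inter_subset_left) fun z hz => hz.2
  refine ⟨dom, hj.continuousOn.isOpen_inter_preimage (fr.isOpen_base.prod isOpen_univ) hD,
    ⟨⟨hx₀, mem_univ _⟩, by simpa [j] using hDx₀⟩,
    fun z => (fr.chart.invFun (Γ (j z) 1).1).proj, fun z => (Γ (j z) 1).2, ?_,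
    contDiff_snd.contMDiff.comp_contMDiffOn hend, fun z hz => ⟨?_, ?_⟩⟩
  · exact (contMDiff_proj (TangentSpace 𝓘(ℝ, E))).comp_contMDiffOn
      (fr.chart.contMDiffOn_invFun.comp (contDiff_fst.contMDiff.comp_contMDiffOn hend)
        fun z hz => ((hΓ (j z) hz.2).2 1 (right_mem_Icc.2 zero_le_one)).1.1)
  · exact ((hΓ (j z) hz.2).2 1 (right_mem_Icc.2 zero_le_one)).1.2
  · obtain ⟨hΓ₀, hΓt⟩ := hΓ (j z) hz.2
    have hsol := fun t ht => (⟨(hΓt t ht).1.1, (hΓt t ht).2⟩ :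
      (Γ (j z) t).1 ∈ fr.chart.target ∧ _)
    refine ⟨_, _, isFlowLine_of_hasDerivWithinAt hS hsol, ?_,
      isTransportMatrix_of_hasDerivWithinAt hS hsol (by rw [hΓ₀]), rfl, rfl⟩
    have hinit : fr.chart.invFun (j z).1 = ⟨z.1, fr.frame z.1 (ε⁻¹ • z.2)⟩ := by
      rw [← fr.chart.left_inv ⟨z.1, fr.frame z.1 (ε⁻¹ • z.2)⟩ (fr.frame_mem _ hz.1.1 _) hz.1.1]
      exact congrArg (fun a => fr.chart.invFun (extChartAt 𝓘(ℝ, E) x₀ z.1, a))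
        (fr.coord_frame _ hz.1.1 _).symm
    rw [hΓ₀, hinit, fibreScale, map_smul, smul_inv_smul₀ hε.ne']

end LocalFrame

/-- Around `x₀`, an adapted frame in which `K` has a Christoffel form, together with the end point
`endpoint (x, a)` of the flow line of `S` with the initial value of coordinates `a ∈ G` at `x`, and
the matrix `matrix (x, a)` of the parallel transport along its projection to `M`. -/
structure TransportChart (V H : ∀ x : M, Submodule ℝ (TangentSpace 𝓘(ℝ, E) x))
    (S : ∀ v : TangentBundle 𝓘(ℝ, E) M, TangentSpace 𝓘(ℝ, E).tangent v)
    (K : ∀ v : TangentBundle 𝓘(ℝ, E) M,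
      TangentSpace 𝓘(ℝ, E).tangent v → TangentSpace 𝓘(ℝ, E) v.proj) (x₀ : M) (U : Set M)
    (F G : Type*) [NormedAddCommGroup F] [NormedSpace ℝ F] [NormedAddCommGroup G]
    [NormedSpace ℝ G] where
  frame : AdaptedFrame V H x₀ U F G
  christoffel : M → E →L[ℝ] F →L[ℝ] F
  contMDiffOn_christoffel : ContMDiffOn 𝓘(ℝ, E) 𝓘(ℝ, E →L[ℝ] F →L[ℝ] F) ∞ christoffel U
  isChristoffelForm : frame.ver.IsChristoffelForm K christoffel
  dom : Set (M × G)
  isOpen_dom : IsOpen dom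
  mem_dom : (x₀, 0) ∈ dom
  endpoint : M × G → M
  matrix : M × G → F →L[ℝ] F
  contMDiffOn_endpoint : ContMDiffOn (𝓘(ℝ, E).prod 𝓘(ℝ, G)) 𝓘(ℝ, E) ∞ endpoint dom
  contMDiffOn_matrix : ContMDiffOn (𝓘(ℝ, E).prod 𝓘(ℝ, G)) 𝓘(ℝ, F →L[ℝ] F) ∞ matrix dom
  isUnit_matrix : ∀ z ∈ dom, IsUnit (matrix z)
  exists_transport : ∀ z ∈ dom, ∃ γ A, IsFlowLine H S γ ∧
    γ 0 = ⟨z.1, frame.hor.frame z.1 z.2⟩ ∧ IsTransportMatrix x₀ U christoffel γ A ∧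
    (γ 1).proj = endpoint z ∧ A 1 = matrix z

variable {K : ∀ v : TangentBundle 𝓘(ℝ, E) M,
  TangentSpace 𝓘(ℝ, E).tangent v → TangentSpace 𝓘(ℝ, E) v.proj}

theorem exists_transportChart [CompleteSpace E] (hK : IsLinearConnection V K)
    (hH : HasLocalFrames H) (hVH : ∀ x, IsCompl (V x) (H x)) (hS : IsSpray H S) (x₀ : M) :
    ∃ U : Set M, ∃ (F G : Type u) (_ : NormedAddCommGroup F) (_ : NormedSpace ℝ F)
      (_ : NormedAddCommGroup G) (_ : NormedSpace ℝ G) (_ : CompleteSpace F)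
      (_ : CompleteSpace G), Nonempty (TransportChart V H S K x₀ U F G) := by
  obtain ⟨U₁, hU₁, hx₁, hU₁s, F, _, _, _, ΘV, B, hΘV, hinj, hB, hKB⟩ := hK x₀
  obtain ⟨U₂, hx₂, G, _, _, _, ⟨frH⟩⟩ := hH x₀
  have hframeV : IsFrameOn V U₁ ΘV :=
    ⟨hΘV, fun x hx => (hinj x hx).1, fun x hx => (hinj x hx).2⟩
  obtain ⟨fr, rfl⟩ := exists_adaptedFrame (hU₁.inter frH.isOpen_base)
    (inter_subset_left.trans hU₁s) (hframeV.mono inter_subset_left)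
    (frH.isFrameOn.mono inter_subset_right) hVH
  have hB' := hB.mono (inter_subset_left (t := U₂))
  obtain ⟨dom, hdom, hx₀, endpoint, matrix, hend, hmat, htransport⟩ :=
    fr.hor.exists_transport ⟨hx₁, hx₂⟩ hS hB'
  exact ⟨U₁ ∩ U₂, F, G, _, _, _, _, ‹_›, ‹_›, ⟨{
    frame := fr
    christoffel := B
    contMDiffOn_christoffel := hB'
    isChristoffelForm := fun x hx => hKB x hx.1
    dom := dom
    isOpen_dom := hdom
    mem_dom := hx₀
    endpoint := endpoint
    matrix := matrix
    contMDiffOn_endpoint := hend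
    contMDiffOn_matrix := hmat
    isUnit_matrix := fun z hz => (htransport z hz).1
    exists_transport := fun z hz => (htransport z hz).2 }⟩⟩

end Transport

/-! ### Submersions and horizontal lifts -/

section MaximalAtlas

variable {E : Type*} [NormedAddCommGroup E] [NormedSpace ℝ E]
  {M : Type*} [TopologicalSpace M] [ChartedSpace E M]
  {E' : Type*} [NormedAddCommGroup E'] [NormedSpace ℝ E']
  {N : Type*} [TopologicalSpace N] [ChartedSpace E' N]
  {p : M → N} {x : M}

lemma mdifferentiable_of_mem_maximalAtlas {φ : OpenPartialHomeomorph M E}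
    (hφ : φ ∈ IsManifold.maximalAtlas 𝓘(ℝ, E) ∞ M) : φ.MDifferentiable 𝓘(ℝ, E) 𝓘(ℝ, E) :=
  ⟨(contMDiffOn_of_mem_maximalAtlas hφ).mdifferentiableOn (by simp),
    (contMDiffOn_symm_of_mem_maximalAtlas hφ).mdifferentiableOn (by simp)⟩

lemma exists_codChart_comp_eventuallyEq (h : IsSubmersionAt 𝓘(ℝ, E) 𝓘(ℝ, E') ∞ p x) :
    ∃ pr : E →L[ℝ] E', Function.Surjective pr ∧ h.codChart ∘ p =ᶠ[𝓝 x] pr ∘ h.domChart := by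
  refine ⟨(ContinuousLinearMap.fst ℝ E' h.complement).comp
    (h.equiv : E →L[ℝ] E' × h.complement), Prod.fst_surjective.comp h.equiv.surjective, ?_⟩
  filter_upwards [h.domChart.open_source.mem_nhds h.mem_domChart_source] with z hz
  have hz' : h.domChart z ∈ (h.domChart.extend 𝓘(ℝ, E)).target := by
    simpa using h.domChart.map_source hz
  simpa [h.domChart.left_inv hz] using h.writtenInCharts hz'

lemma surjective_mfderiv_of_isSubmersionAt (h : IsSubmersionAt 𝓘(ℝ, E) 𝓘(ℝ, E') ∞ p x) :
    Function.Surjective (mfderiv 𝓘(ℝ, E) 𝓘(ℝ, E') p x) := by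
  have hdom := mdifferentiable_of_mem_maximalAtlas h.domChart_mem_maximalAtlas
  have hcod := mdifferentiable_of_mem_maximalAtlas h.codChart_mem_maximalAtlas
  obtain ⟨pr, hpr, heq⟩ := exists_codChart_comp_eventuallyEq h
  have hderiv := heq.mfderiv_eq (I := 𝓘(ℝ, E)) (I' := 𝓘(ℝ, E'))
  rw [mfderiv_comp x (hcod.mdifferentiableAt h.mem_codChart_source)
      (h.contMDiffAt.mdifferentiableAt (by simp)),
    mfderiv_comp x (pr.mdifferentiableAt (x := h.domChart x))
      (hdom.mdifferentiableAt h.mem_domChart_source), pr.mfderiv_eq] at hderiv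
  intro v
  obtain ⟨e, he⟩ := hpr (mfderiv 𝓘(ℝ, E') 𝓘(ℝ, E') h.codChart (p x) v)
  obtain ⟨u, hu⟩ := hdom.mfderiv_surjective h.mem_domChart_source e
  refine ⟨u, hcod.mfderiv_injective h.mem_codChart_source ?_⟩
  exact (congrArg (fun L : E →L[ℝ] E' => L u) hderiv).trans ((congrArg pr hu).trans he)

end MaximalAtlas

section Ehresmann

variable {E : Type u} [NormedAddCommGroup E] [NormedSpace ℝ E]
  {M : Type*} [TopologicalSpace M] [ChartedSpace E M]
  {E' : Type*} [NormedAddCommGroup E'] [NormedSpace ℝ E']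
  {N : Type*} [TopologicalSpace N] [ChartedSpace E' N]
  {p : M → N}

lemma tangentMap_zeroVec (x : M) :
    tangentMap 𝓘(ℝ, E) 𝓘(ℝ, E') p (zeroVec x) = zeroVec (p x) :=
  congrArg (TotalSpace.mk (p x)) (map_zero (mfderiv 𝓘(ℝ, E) 𝓘(ℝ, E') p x))

namespace EhresmannConnection

variable [IsManifold 𝓘(ℝ, E) ∞ M] (A : EhresmannConnection E E' p)

lemma eq_of_mfderiv_eq {x : M} {h h' : TangentSpace 𝓘(ℝ, E) x} (hh : h ∈ A.horizontal x)
    (hh' : h' ∈ A.horizontal x)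
    (heq : mfderiv 𝓘(ℝ, E) 𝓘(ℝ, E') p x h = mfderiv 𝓘(ℝ, E) 𝓘(ℝ, E') p x h') : h = h' := by
  have hver : h - h' ∈ vertical E E' p x := by
    change mfderiv 𝓘(ℝ, E) 𝓘(ℝ, E') p x (h - h') = 0
    rw [map_sub, heq, sub_self]
  exact sub_eq_zero.1 (Submodule.disjoint_def.1 (A.isCompl x).disjoint _ hver
    ((A.horizontal x).sub_mem hh hh'))

lemma verPart_mem (u : TangentBundle 𝓘(ℝ, E) M) : (A.verPart u).2 ∈ vertical E E' p u.proj :=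
  Submodule.projection_apply_mem _ _

lemma horPart_mem (u : TangentBundle 𝓘(ℝ, E) M) : (A.horPart u).2 ∈ A.horizontal u.proj :=
  Submodule.projection_apply_mem _ _

lemma horPart_zeroVec (x : M) : A.horPart (zeroVec x) = zeroVec x :=
  congrArg (TotalSpace.mk x) (map_zero _)

lemma horPart_eq_of_tangentMap_eq {u u' : TangentBundle 𝓘(ℝ, E) M} (hproj : u.proj = u'.proj)
    (h : tangentMap 𝓘(ℝ, E) 𝓘(ℝ, E') p (A.horPart u) =
      tangentMap 𝓘(ℝ, E) 𝓘(ℝ, E') p (A.horPart u')) : A.horPart u = A.horPart u' := by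
  obtain ⟨x, v⟩ := u
  obtain ⟨x', v'⟩ := u'
  obtain rfl : x = x' := hproj
  exact congrArg (TotalSpace.mk x) (A.eq_of_mfderiv_eq (A.horPart_mem ⟨x, v⟩)
    (A.horPart_mem ⟨x, v'⟩)
    (TotalSpace.mk_injective (F := E') (E := (TangentSpace 𝓘(ℝ, E') : N → Type _)) (p x) h))

variable {F G : Type*} [NormedAddCommGroup F] [NormedSpace ℝ F]
  [NormedAddCommGroup G] [NormedSpace ℝ G] {x₀ : M} {U : Set M}
  (fr : AdaptedFrame (vertical E E' p) A.horizontal x₀ U F G) {u : TangentBundle 𝓘(ℝ, E) M}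

lemma verPart_eq (hu : u.proj ∈ U) :
    A.verPart u = ⟨u.proj, fr.ver.frame u.proj (fr.ver.coord u.1 u.2)⟩ := by
  refine congrArg (TotalSpace.mk u.proj) ?_
  have hcoord := congrArg (fr.ver.coord u.proj)
    (Submodule.projection_add_projection_eq_self (A.isCompl u.proj) u.2)
  rw [map_add, fr.ver_coord_eq_zero _ hu _ (Submodule.projection_apply_mem _ _),
    add_zero] at hcoord
  rw [← hcoord]
  exact (fr.ver.frame_coord _ hu _ (A.verPart_mem u)).symm

lemma horPart_eq (hu : u.proj ∈ U) :
    A.horPart u = ⟨u.proj, fr.hor.frame u.proj (fr.hor.coord u.1 u.2)⟩ := by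
  refine congrArg (TotalSpace.mk u.proj) ?_
  have hcoord := congrArg (fr.hor.coord u.proj)
    (Submodule.projection_add_projection_eq_self (A.isCompl u.proj) u.2)
  rw [map_add, fr.hor_coord_eq_zero _ hu _ (Submodule.projection_apply_mem _ _),
    zero_add] at hcoord
  rw [← hcoord]
  exact (fr.hor.frame_coord _ hu _ (A.horPart_mem u)).symm

end EhresmannConnection

end Ehresmann

section HorizontalLift

variable {E : Type u} [NormedAddCommGroup E] [NormedSpace ℝ E]
  {M : Type*} [TopologicalSpace M] [ChartedSpace E M] [IsManifold 𝓘(ℝ, E) ∞ M]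
  {E' : Type*} [NormedAddCommGroup E'] [NormedSpace ℝ E']
  {N : Type*} [TopologicalSpace N] [ChartedSpace E' N] [IsManifold 𝓘(ℝ, E') ∞ N]
  {p : M → N} {A : EhresmannConnection E E' p}
  {G : Type*} [NormedAddCommGroup G] [NormedSpace ℝ G] {x₀ x : M} {U : Set M} {y₀ : N}

namespace LocalFrame

/-- The differential of `p` on the horizontal space at `x`, in a local frame and the trivialisation
of `TN` at `y₀`. -/
def horizontalMatrix (fr : LocalFrame A.horizontal x₀ U G) (y₀ : N) (x : M) : G →L[ℝ] E' :=
  ((trivializationAt E' (TangentSpace 𝓘(ℝ, E')) y₀).continuousLinearMapAt ℝ (p x)).comp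
    ((mfderiv 𝓘(ℝ, E) 𝓘(ℝ, E') p x).comp (fr.frame x))

/-- The coordinates of the horizontal lift at `x` of a tangent vector of `N` at `p x`. -/
def horizontalLift (fr : LocalFrame A.horizontal x₀ U G) (y₀ : N) (x : M)
    (n : TangentBundle 𝓘(ℝ, E') N) : G :=
  (fr.horizontalMatrix y₀ x).inverse (trivializationAt E' (TangentSpace 𝓘(ℝ, E')) y₀ n).2

variable (fr : LocalFrame A.horizontal x₀ U G)

lemma contMDiffOn_horizontalMatrix (hp : ContMDiff 𝓘(ℝ, E) 𝓘(ℝ, E') ∞ p) :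
    ContMDiffOn 𝓘(ℝ, E) 𝓘(ℝ, G →L[ℝ] E') ∞ (fr.horizontalMatrix y₀)
      (U ∩ p ⁻¹' (chartAt E' y₀).source) := by
  refine contMDiffOn_clm_of_uncurry (fr.isOpen_base.inter
    ((chartAt E' y₀).open_source.preimage hp.continuous)) ?_
  have hframe := (hp.contMDiff_tangentMap (m := ∞) (by simp)).comp_contMDiffOn
    (fr.contMDiffOn_frame.mono (prod_mono (inter_subset_left
      (t := p ⁻¹' (chartAt E' y₀).source)) subset_rfl))
  exact ((contMDiffOn_trivializationAt_snd y₀).comp hframe fun z hz => hz.1.2).congr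
    fun z hz => (trivializationAt_snd_eq hz.1.2 _).symm

lemma bijective_horizontalMatrix (hp : Function.Surjective (mfderiv 𝓘(ℝ, E) 𝓘(ℝ, E') p x))
    (hx : x ∈ U) (hpx : p x ∈ (chartAt E' y₀).source) :
    Function.Bijective (fr.horizontalMatrix y₀ x) := by
  refine (bijective_continuousLinearMapAt hpx).comp ⟨fun a b hab => ?_, fun v => ?_⟩
  · exact Function.LeftInverse.injective (fr.coord_frame x hx)
      (A.eq_of_mfderiv_eq (fr.frame_mem x hx a) (fr.frame_mem x hx b) hab)
  · obtain ⟨w, rfl⟩ := hp v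
    refine ⟨fr.coord x (A.horPart ⟨x, w⟩).2, ?_⟩
    have hver : mfderiv 𝓘(ℝ, E) 𝓘(ℝ, E') p x (Submodule.projection _ _ (A.isCompl x) w) = 0 :=
      A.verPart_mem ⟨x, w⟩
    have hw := congrArg (mfderiv 𝓘(ℝ, E) 𝓘(ℝ, E') p x)
      (Submodule.projection_add_projection_eq_self (A.isCompl x) w)
    rw [map_add, hver, zero_add] at hw
    exact (congrArg (mfderiv 𝓘(ℝ, E) 𝓘(ℝ, E') p x)
      (fr.frame_coord x hx _ (A.horPart_mem ⟨x, w⟩))).trans hw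

lemma horizontalLift_zeroVec (hpx : p x ∈ (chartAt E' y₀).source) :
    fr.horizontalLift y₀ x (zeroVec (p x)) = 0 := by
  rw [horizontalLift, zeroVec, trivializationAt_snd_eq hpx, map_zero, map_zero]

variable [CompleteSpace E'] [CompleteSpace G]

lemma contMDiffOn_horizontalLift (hp : ∀ x, IsSubmersionAt 𝓘(ℝ, E) 𝓘(ℝ, E') ∞ p x) :
    ContMDiffOn (𝓘(ℝ, E).prod 𝓘(ℝ, E').tangent) 𝓘(ℝ, G) ∞
      (fun z : M × TangentBundle 𝓘(ℝ, E') N => fr.horizontalLift y₀ z.1 z.2)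
      ((U ∩ p ⁻¹' (chartAt E' y₀).source) ×ˢ {n | n.proj ∈ (chartAt E' y₀).source}) :=
  ((contMDiffOn_clm_inverse
      (fr.contMDiffOn_horizontalMatrix fun x => (hp x).contMDiffAt) fun x hx =>
      fr.bijective_horizontalMatrix (surjective_mfderiv_of_isSubmersionAt (hp x)) hx.1 hx.2).comp
    contMDiffOn_fst fun _ hz => hz.1).clm_apply
    ((contMDiffOn_trivializationAt_snd y₀).comp contMDiffOn_snd fun _ hz => hz.2)

lemma tangentMap_horizontalLift (hp : Function.Surjective (mfderiv 𝓘(ℝ, E) 𝓘(ℝ, E') p x))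
    (hx : x ∈ U) (hpx : p x ∈ (chartAt E' y₀).source) {n : TangentBundle 𝓘(ℝ, E') N}
    (hn : n.proj = p x) :
    tangentMap 𝓘(ℝ, E) 𝓘(ℝ, E') p ⟨x, fr.frame x (fr.horizontalLift y₀ x n)⟩ = n := by
  let e := trivializationAt E' (TangentSpace 𝓘(ℝ, E') : N → Type _) y₀
  have hlift : tangentMap 𝓘(ℝ, E) 𝓘(ℝ, E') p ⟨x, fr.frame x (fr.horizontalLift y₀ x n)⟩ ∈
      e.source := e.mem_source.2 hpx
  have hn' : n ∈ e.source := e.mem_source.2 (hn ▸ hpx)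
  refine e.injOn hlift hn' (Prod.ext ?_ ?_)
  · exact (e.coe_fst hlift).trans (hn.symm.trans (e.coe_fst hn').symm)
  · exact (trivializationAt_snd_eq hpx _).trans
      (clm_apply_inverse_apply (fr.bijective_horizontalMatrix hp hx hpx) (e n).2)

end LocalFrame

variable {S_N : ∀ v : TangentBundle 𝓘(ℝ, E') N, TangentSpace 𝓘(ℝ, E').tangent v}
  {S_H : ∀ v : TangentBundle 𝓘(ℝ, E) M, TangentSpace 𝓘(ℝ, E).tangent v}
  {γ : ℝ → TangentBundle 𝓘(ℝ, E) M}

lemma IsSprayLift.isFlowLine_tangentMap (hS_H : IsSprayLift A S_N S_H)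
    (hp : ContMDiff 𝓘(ℝ, E) 𝓘(ℝ, E') ∞ p) (hγ : IsFlowLine A.horizontal S_H γ) :
    IsFlowLine (fun _ => ⊤) S_N (tangentMap 𝓘(ℝ, E) 𝓘(ℝ, E') p ∘ γ) := by
  refine ⟨fun t _ => (Submodule.mem_top :
    (tangentMap 𝓘(ℝ, E) 𝓘(ℝ, E') p (γ t)).2 ∈
      (⊤ : Submodule ℝ (TangentSpace 𝓘(ℝ, E') (tangentMap 𝓘(ℝ, E) 𝓘(ℝ, E') p (γ t)).proj))),
    fun t ht => ?_⟩
  have hTp := (hp.contMDiff_tangentMap (m := ∞) (by simp)).mdifferentiable (by simp) (γ t)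
  have h := hasMFDerivWithinAt_comp_velocity (hγ.2 t ht) hTp.hasMFDerivAt
  rwa [hS_H.related _ (hγ.1 t ht)] at h

lemma IsSprayLift.tangentMap_mem_expDomain (hS_H : IsSprayLift A S_N S_H)
    (hp : ContMDiff 𝓘(ℝ, E) 𝓘(ℝ, E') ∞ p) {h : TangentBundle 𝓘(ℝ, E) M}
    (hh : h ∈ expDomain A.horizontal S_H) :
    tangentMap 𝓘(ℝ, E) 𝓘(ℝ, E') p h ∈ expDomain (fun _ => ⊤) S_N := by
  obtain ⟨γ, hγ, rfl⟩ := hh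
  exact ⟨_, hS_H.isFlowLine_tangentMap hp hγ, rfl⟩

lemma IsSprayLift.map_sprayExp [CompleteSpace E] [CompleteSpace E'] [T2Space M] [T2Space N]
    (hS_H : IsSprayLift A S_N S_H) (hS_N : IsSpray (fun _ => ⊤) S_N)
    (hp : ContMDiff 𝓘(ℝ, E) 𝓘(ℝ, E') ∞ p) {h : TangentBundle 𝓘(ℝ, E) M}
    (hh : h ∈ expDomain A.horizontal S_H) :
    p (sprayExp A.horizontal S_H h) =
      sprayExp (fun _ => ⊤) S_N (tangentMap 𝓘(ℝ, E) 𝓘(ℝ, E') p h) := by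
  obtain ⟨γ, hγ, rfl⟩ := hh
  rw [hS_H.isSpray.sprayExp_eq A.smooth.hasLocalFrames hγ]
  exact (hS_N.sprayExp_eq hasLocalFrames_top (hS_H.isFlowLine_tangentMap hp hγ)).symm

end HorizontalLift

/-! ### The transport chart and its inverse -/

section Transport

variable {E : Type u} [NormedAddCommGroup E] [NormedSpace ℝ E]
  {M : Type*} [TopologicalSpace M] [ChartedSpace E M] [IsManifold 𝓘(ℝ, E) ∞ M]
  {F G : Type*} [NormedAddCommGroup F] [NormedSpace ℝ F] [NormedAddCommGroup G] [NormedSpace ℝ G]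
  {V H : ∀ x : M, Submodule ℝ (TangentSpace 𝓘(ℝ, E) x)} {x₀ : M} {U : Set M}
  {S : ∀ v : TangentBundle 𝓘(ℝ, E) M, TangentSpace 𝓘(ℝ, E).tangent v}
  {K : ∀ v : TangentBundle 𝓘(ℝ, E) M,
    TangentSpace 𝓘(ℝ, E).tangent v → TangentSpace 𝓘(ℝ, E) v.proj}

lemma AdaptedFrame.frame_coord_add_frame_coord (fr : AdaptedFrame V H x₀ U F G) {x : M}
    (hVH : Codisjoint (V x) (H x)) (hx : x ∈ U) (v : TangentSpace 𝓘(ℝ, E) x) :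
    fr.ver.frame x (fr.ver.coord x v) + fr.hor.frame x (fr.hor.coord x v) = v := by
  obtain ⟨a, ha, b, hb, rfl⟩ :=
    Submodule.mem_sup.1 (hVH.eq_top ▸ Submodule.mem_top : v ∈ V x ⊔ H x)
  rw [map_add (fr.ver.coord x), map_add (fr.hor.coord x), fr.ver_coord_eq_zero x hx b hb,
    fr.hor_coord_eq_zero x hx a ha, add_zero, zero_add, fr.ver.frame_coord x hx a ha,
    fr.hor.frame_coord x hx b hb]

namespace TransportChart

variable (C : TransportChart V H S K x₀ U F G)

/-- The base point of a tangent vector, with the coordinates of its component in `H`. -/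
def coord (u : TangentBundle 𝓘(ℝ, E) M) : M × G := (u.proj, C.frame.hor.coord u.1 u.2)

/-- The tangent vectors whose component in `H` is the initial value of a flow line of the chart. -/
def source : Set (TangentBundle 𝓘(ℝ, E) M) := C.coord ⁻¹' C.dom

/-- The map `(v, h) ↦ P_{0,1}^{c_h} (v)` in the chart. -/
def transport (u : TangentBundle 𝓘(ℝ, E) M) : TangentBundle 𝓘(ℝ, E) M :=
  ⟨C.endpoint (C.coord u), C.frame.ver.frame (C.endpoint (C.coord u))
    (C.matrix (C.coord u) (C.frame.ver.coord u.1 u.2))⟩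

/-- The tangent vector whose component in `H` has the coordinates `z.2` at `z.1`, and whose
component in `V` is carried to `w` by parallel transport. -/
def untransport (z : M × G) (w : TangentBundle 𝓘(ℝ, E) M) : TangentBundle 𝓘(ℝ, E) M :=
  ⟨z.1, C.frame.ver.frame z.1 ((C.matrix z).inverse (C.frame.ver.coord w.1 w.2)) +
    C.frame.hor.frame z.1 z.2⟩

variable {z : M × G} {u w : TangentBundle 𝓘(ℝ, E) M}

lemma fst_mem (hz : z ∈ C.dom) : z.1 ∈ U := by
  obtain ⟨γ, B, -, hγ₀, hB, -, -⟩ := C.exists_transport z hz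
  simpa only [hγ₀] using hB.mem 0 (left_mem_Icc.2 zero_le_one)

lemma endpoint_mem (hz : z ∈ C.dom) : C.endpoint z ∈ U := by
  obtain ⟨γ, B, -, -, hB, hγ₁, -⟩ := C.exists_transport z hz
  exact hγ₁ ▸ hB.mem 1 (right_mem_Icc.2 zero_le_one)

lemma mem_expDomain (hz : z ∈ C.dom) :
    (⟨z.1, C.frame.hor.frame z.1 z.2⟩ : TangentBundle 𝓘(ℝ, E) M) ∈ expDomain H S :=
  let ⟨γ, _, hγ, hγ₀, _⟩ := C.exists_transport z hz
  ⟨γ, hγ, hγ₀⟩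

lemma bijective_matrix (hz : z ∈ C.dom) : Function.Bijective (C.matrix z) := by
  obtain ⟨e, he⟩ := C.isUnit_matrix z hz
  rw [← he]
  exact (ContinuousLinearEquiv.unitsEquiv ℝ F e).bijective

lemma contMDiffOn_coord : ContMDiffOn 𝓘(ℝ, E).tangent (𝓘(ℝ, E).prod 𝓘(ℝ, G)) ∞ C.coord
    {u | u.proj ∈ U} :=
  (contMDiff_proj (TangentSpace 𝓘(ℝ, E))).contMDiffOn.prodMk C.frame.hor.contMDiffOn_coord

lemma isOpen_source : IsOpen C.source := by
  have hopen : IsOpen {u : TangentBundle 𝓘(ℝ, E) M | u.proj ∈ U} :=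
    C.frame.ver.isOpen_base.preimage (FiberBundle.continuous_proj E _)
  have hsource : C.source = {u | u.proj ∈ U} ∩ C.coord ⁻¹' C.dom :=
    (inter_eq_right.2 fun u (hu : C.coord u ∈ C.dom) => C.fst_mem hu).symm
  exact hsource ▸ C.contMDiffOn_coord.continuousOn.isOpen_inter_preimage hopen C.isOpen_dom

lemma contMDiffOn_transport :
    ContMDiffOn 𝓘(ℝ, E).tangent 𝓘(ℝ, E).tangent ∞ C.transport C.source := by
  have hcoord : ContMDiffOn 𝓘(ℝ, E).tangent (𝓘(ℝ, E).prod 𝓘(ℝ, G)) ∞ C.coord C.source :=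
    C.contMDiffOn_coord.mono fun u hu => C.fst_mem hu
  have hver := C.frame.ver.contMDiffOn_coord.mono
    (fun u hu => C.fst_mem hu : C.source ⊆ {u | u.proj ∈ U})
  exact C.frame.ver.contMDiffOn_frame.comp
    ((C.contMDiffOn_endpoint.comp hcoord fun _ hu => hu).prodMk
      ((C.contMDiffOn_matrix.comp hcoord fun _ hu => hu).clm_apply hver))
    fun u hu => ⟨C.endpoint_mem hu, mem_univ _⟩

lemma transport_mem (hu : u ∈ C.source) : C.transport u ∈ totalSet V :=
  C.frame.ver.frame_mem _ (C.endpoint_mem hu) _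

lemma coord_untransport (hz : z.1 ∈ U) : C.coord (C.untransport z w) = z :=
  Prod.ext rfl <| by
    refine (map_add (C.frame.hor.coord z.1) _ _).trans ?_
    rw [C.frame.hor_coord_eq_zero _ hz _ (C.frame.ver.frame_mem _ hz _), zero_add,
      C.frame.hor.coord_frame _ hz]

lemma untransport_mem_source (hz : z ∈ C.dom) : C.untransport z w ∈ C.source := by
  rwa [source, mem_preimage, C.coord_untransport (C.fst_mem hz)]

section Flow

variable [T2Space M] (hH : HasLocalFrames H) (hS : IsSpray H S)
include hH hS

lemma sprayExp_eq (hz : z ∈ C.dom) :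
    sprayExp H S ⟨z.1, C.frame.hor.frame z.1 z.2⟩ = C.endpoint z := by
  obtain ⟨γ, -, hγ, hγ₀, -, hγ₁, -⟩ := C.exists_transport z hz
  rw [← hγ₀, hS.sprayExp_eq hH hγ, hγ₁]

lemma exists_isParallelAlong (hz : z ∈ C.dom) (ξ : F) : ∃ η,
    IsParallelAlong V K
      (fun t => sprayExp H S (fibreScale t ⟨z.1, C.frame.hor.frame z.1 z.2⟩)) η ∧
      η 0 = ⟨z.1, C.frame.ver.frame z.1 ξ⟩ := by
  obtain ⟨γ, B, hγ, hγ₀, hB, -, -⟩ := C.exists_transport z hz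
  rw [← hγ₀, isParallelAlong_congr fun t ht => hS.sprayExp_fibreScale hH hγ ht]
  have hη := hB.exists_isParallelAlong C.isChristoffelForm ξ
  rwa [congrArg TotalSpace.proj hγ₀] at hη

lemma parallelTransport_eq (hz : z ∈ C.dom) (ξ : F) :
    parallelTransport V K
      (fun t => sprayExp H S (fibreScale t ⟨z.1, C.frame.hor.frame z.1 z.2⟩))
      ⟨z.1, C.frame.ver.frame z.1 ξ⟩ =
    ⟨C.endpoint z, C.frame.ver.frame (C.endpoint z) (C.matrix z ξ)⟩ := by
  obtain ⟨γ, B, hγ, hγ₀, hB, hγ₁, hB₁⟩ := C.exists_transport z hz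
  have hη := hB.parallelTransport_eq C.contMDiffOn_christoffel C.isChristoffelForm ξ
  rw [congrArg TotalSpace.proj hγ₀] at hη
  rw [← hγ₀, parallelTransport_congr fun t ht => hS.sprayExp_fibreScale hH hγ ht, hη, hγ₁, hB₁]

lemma endpoint_zero : C.endpoint (x₀, 0) = x₀ := by
  rw [← C.sprayExp_eq hH hS C.mem_dom, map_zero]
  exact hS.sprayExp_eq hH (hS.isFlowLine_zeroVec x₀)

end Flow

lemma coord_zeroVec : C.coord (zeroVec x₀) = (x₀, 0) :=
  Prod.ext rfl (map_zero (C.frame.hor.coord x₀))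

variable [CompleteSpace F]

lemma contMDiffOn_untransport (hVH : ∀ x, IsCompl (V x) (H x)) :
    ContMDiffOn ((𝓘(ℝ, E).prod 𝓘(ℝ, G)).prod 𝓘(ℝ, E).tangent) 𝓘(ℝ, E).tangent ∞
      (fun a : (M × G) × TangentBundle 𝓘(ℝ, E) M => C.untransport a.1 a.2)
      (C.dom ×ˢ {w | w.proj ∈ U}) := by
  have hver : ContMDiffOn ((𝓘(ℝ, E).prod 𝓘(ℝ, G)).prod 𝓘(ℝ, E).tangent) 𝓘(ℝ, F) ∞
      (fun a : (M × G) × TangentBundle 𝓘(ℝ, E) M =>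
        (C.matrix a.1).inverse (C.frame.ver.coord a.2.1 a.2.2)) (C.dom ×ˢ {w | w.proj ∈ U}) :=
    ((contMDiffOn_clm_inverse C.contMDiffOn_matrix fun z hz => C.bijective_matrix hz).comp
      contMDiffOn_fst fun _ ha => ha.1).clm_apply
      (C.frame.ver.contMDiffOn_coord.comp contMDiffOn_snd fun _ ha => ha.2)
  exact (C.frame.ver.isFrameOn.coprod C.frame.hor.isFrameOn hVH
    C.frame.ver.base_subset).contMDiffOn.comp
    ((contMDiff_fst.comp contMDiff_fst).contMDiffOn.prodMk
      (hver.prodMk_space (contMDiff_snd.comp contMDiff_fst).contMDiffOn))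
    fun a ha => ⟨C.fst_mem ha.1, mem_univ _⟩

lemma transport_untransport (hz : z ∈ C.dom) (hproj : w.proj = C.endpoint z)
    (hw : w ∈ totalSet V) : C.transport (C.untransport z w) = w := by
  have hzU := C.fst_mem hz
  have hver : C.frame.ver.coord z.1 (C.untransport z w).2 =
      (C.matrix z).inverse (C.frame.ver.coord w.1 w.2) := by
    refine (map_add (C.frame.ver.coord z.1) _ _).trans ?_
    rw [C.frame.ver_coord_eq_zero _ hzU _ (C.frame.hor.frame_mem _ hzU _), add_zero,
      C.frame.ver.coord_frame _ hzU]
  have heq : C.transport (C.untransport z w) =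
      ⟨C.endpoint z, C.frame.ver.frame (C.endpoint z) (C.frame.ver.coord w.1 w.2)⟩ := by
    rw [transport, C.coord_untransport hzU]
    refine congrArg (fun ξ => (⟨_, C.frame.ver.frame (C.endpoint z) ξ⟩ : TangentBundle _ M)) ?_
    exact (congrArg (C.matrix z) hver).trans (clm_apply_inverse_apply (C.bijective_matrix hz) _)
  rw [heq, ← hproj]
  exact congrArg (TotalSpace.mk w.proj) (C.frame.ver.frame_coord _ (hproj ▸ C.endpoint_mem hz) _ hw)

lemma untransport_transport (hVH : Codisjoint (V u.proj) (H u.proj)) (hu : u ∈ C.source) :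
    C.untransport (C.coord u) (C.transport u) = u := by
  have hver : (C.matrix (C.coord u)).inverse
      (C.frame.ver.coord (C.transport u).1 (C.transport u).2) = C.frame.ver.coord u.1 u.2 :=
    (congrArg (C.matrix (C.coord u)).inverse
      (C.frame.ver.coord_frame _ (C.endpoint_mem hu) _)).trans
      (clm_inverse_apply_apply (C.bijective_matrix hu) _)
  refine congrArg (TotalSpace.mk u.proj) ?_
  rw [hver]
  exact C.frame.frame_coord_add_frame_coord hVH (C.fst_mem hu) u.2

end TransportChart

end Transport

/-! ### Local additions from local sections -/

section Sections

variable {E₁ H₁ E₂ H₂ : Type*} [NormedAddCommGroup E₁] [NormedSpace ℝ E₁] [TopologicalSpace H₁]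
  [NormedAddCommGroup E₂] [NormedSpace ℝ E₂] [TopologicalSpace H₂]
  {I : ModelWithCorners ℝ E₁ H₁} {J : ModelWithCorners ℝ E₂ H₂}
  {X : Type*} [TopologicalSpace X] [ChartedSpace H₁ X]
  {Y : Type*} [TopologicalSpace Y] [ChartedSpace H₂ Y] {f : X → Y} {D D' : Set X} {y : Y}

lemma IsDiffeoOntoImage.exists_inverse (h : IsDiffeoOntoImage I J f D) :
    ∃ g : Y → X, ContMDiffOn J I ∞ g (f '' D) ∧ MapsTo g (f '' D) D ∧ InvOn g f D (f '' D) := by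
  obtain ⟨-, g, hg, hgf⟩ := h
  exact ⟨g, hg, forall_mem_image.2 fun x hx => (hgf hx).symm ▸ hx, hgf,
    forall_mem_image.2 fun x hx => congrArg f (hgf hx)⟩

lemma IsDiffeoOntoImage.injOn (h : IsDiffeoOntoImage I J f D) : InjOn f D :=
  let ⟨_, _, hgf⟩ := h.2
  hgf.injOn

variable (I J) in
/-- Near `y` the map `f` has a smooth section with values in `D`. -/
def HasSmoothSectionAt (f : X → Y) (D : Set X) (y : Y) : Prop :=
  ∃ g : Y → X, ∀ᶠ z in 𝓝 y, ContMDiffAt J I ∞ g z ∧ g z ∈ D ∧ f (g z) = z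

lemma isOpen_setOf_hasSmoothSectionAt : IsOpen {y | HasSmoothSectionAt I J f D y} :=
  isOpen_iff_mem_nhds.2 fun _ ⟨g, hg⟩ => hg.eventually_nhds.mono fun _ hz => ⟨g, hz⟩

lemma HasSmoothSectionAt.mono (h : HasSmoothSectionAt I J f D y) (hD : D ⊆ D') :
    HasSmoothSectionAt I J f D' y :=
  let ⟨g, hg⟩ := h
  ⟨g, hg.mono fun _ hz => ⟨hz.1, hD hz.2.1, hz.2.2⟩⟩

lemma HasSmoothSectionAt.restrict (h : HasSmoothSectionAt I J f D y) :
    HasSmoothSectionAt I J f (D ∩ f ⁻¹' {z | HasSmoothSectionAt I J f D z}) y := by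
  obtain ⟨g, hg⟩ := h
  refine ⟨g, hg.eventually_nhds.mono fun z hz => ?_⟩
  obtain ⟨hgz, hmem, heq⟩ := hz.self_of_nhds
  exact ⟨hgz, ⟨hmem, show HasSmoothSectionAt I J f D (f (g z)) from heq.symm ▸ ⟨g, hz⟩⟩, heq⟩

lemma isOpen_image_of_hasSmoothSectionAt (h : ∀ x ∈ D, HasSmoothSectionAt I J f D (f x)) :
    IsOpen (f '' D) := by
  refine isOpen_iff_mem_nhds.2 (forall_mem_image.2 fun x hx => ?_)
  obtain ⟨g, hg⟩ := h x hx
  exact hg.mono fun z hz => ⟨g z, hz.2⟩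

lemma isDiffeoOntoImage_of_injOn [Nonempty (Y → X)] (hf : ContMDiffOn I J ∞ f D)
    (hinj : InjOn f D) (h : ∀ x ∈ D, HasSmoothSectionAt I J f D (f x)) :
    IsDiffeoOntoImage I J f D := by
  obtain ⟨g, hg⟩ : ∃ g : Y → X, LeftInvOn g f D := by
    classical
    obtain ⟨g₀⟩ := ‹Nonempty (Y → X)›
    refine ⟨fun y => if hy : y ∈ f '' D then hy.choose else g₀ y, fun x hx => ?_⟩
    have hy : f x ∈ f '' D := mem_image_of_mem f hx
    simp only [dif_pos hy]
    exact hinj hy.choose_spec.1 hx hy.choose_spec.2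
  refine ⟨hf, g, forall_mem_image.2 fun x hx => ?_, hg⟩
  obtain ⟨s, hs⟩ := h x hx
  have heq : g =ᶠ[𝓝 (f x)] s := hs.mono fun z hz =>
    (congrArg g hz.2.2).symm.trans (hg hz.2.1)
  exact (hs.self_of_nhds.1.congr_of_eventuallyEq heq).contMDiffWithinAt

end Sections

theorem exists_isLocalAddition {E : Type u} [NormedAddCommGroup E] [NormedSpace ℝ E]
    {M : Type*} [TopologicalSpace M] [ChartedSpace E M] [IsManifold 𝓘(ℝ, E) ∞ M]
    {σ : TangentBundle 𝓘(ℝ, E) M → M} {Q : Set (TangentBundle 𝓘(ℝ, E) M)}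
    (hinj : InjOn (fun u => (u.proj, σ u)) Q)
    (hloc : ∀ x, ∃ D ⊆ Q, IsOpen D ∧ zeroVec x ∈ D ∧ σ (zeroVec x) = x ∧
      ContMDiffOn 𝓘(ℝ, E).tangent (𝓘(ℝ, E).prod 𝓘(ℝ, E)) ∞ (fun u => (u.proj, σ u)) D ∧
      HasSmoothSectionAt 𝓘(ℝ, E).tangent (𝓘(ℝ, E).prod 𝓘(ℝ, E)) (fun u => (u.proj, σ u)) D
        (x, x)) :
    ∃ Ω ⊆ Q, IsLocalAddition Ω σ := by
  choose D hDQ hDo hzero hσ hsmooth hsec using hloc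
  set Ψ : TangentBundle 𝓘(ℝ, E) M → M × M := fun u => (u.proj, σ u)
  have hΨD := ContMDiffOn.iUnion_of_isOpen hsmooth hDo
  let good := {z | HasSmoothSectionAt 𝓘(ℝ, E).tangent (𝓘(ℝ, E).prod 𝓘(ℝ, E)) Ψ (⋃ x, D x) z}
  let Ω := (⋃ x, D x) ∩ Ψ ⁻¹' good
  have hΩ : ∀ u ∈ Ω, HasSmoothSectionAt 𝓘(ℝ, E).tangent (𝓘(ℝ, E).prod 𝓘(ℝ, E)) Ψ Ω (Ψ u) :=
    fun u hu => HasSmoothSectionAt.restrict hu.2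
  have hΩQ : Ω ⊆ Q := inter_subset_left.trans (iUnion_subset hDQ)
  have : Nonempty (M × M → TangentBundle 𝓘(ℝ, E) M) := ⟨fun z => zeroVec z.1⟩
  refine ⟨Ω, hΩQ, ⟨?_, fun x => ?_, hσ, isOpen_image_of_hasSmoothSectionAt hΩ,
    isDiffeoOntoImage_of_injOn (hΨD.mono inter_subset_left) (hinj.mono hΩQ) hΩ⟩⟩
  · exact hΨD.continuousOn.isOpen_inter_preimage (isOpen_iUnion hDo)
      isOpen_setOf_hasSmoothSectionAt
  · refine ⟨mem_iUnion_of_mem x (hzero x), ?_⟩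
    have hΨx : Ψ (zeroVec x) = (x, x) := Prod.ext rfl (hσ x)
    rw [mem_preimage, hΨx]
    exact (hsec x).mono (subset_iUnion D x)

/-! ### The lifted local addition -/

section Addition

variable {E : Type u} [NormedAddCommGroup E] [NormedSpace ℝ E]
  {M : Type*} [TopologicalSpace M] [ChartedSpace E M] [IsManifold 𝓘(ℝ, E) ∞ M]
  {E' : Type*} [NormedAddCommGroup E'] [NormedSpace ℝ E']
  {N : Type*} [TopologicalSpace N] [ChartedSpace E' N]
  {p : M → N} {A : EhresmannConnection E E' p}
  {S_H : ∀ v : TangentBundle 𝓘(ℝ, E) M, TangentSpace 𝓘(ℝ, E).tangent v}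
  {K : ∀ v : TangentBundle 𝓘(ℝ, E) M,
    TangentSpace 𝓘(ℝ, E).tangent v → TangentSpace 𝓘(ℝ, E) v.proj}
  {F G : Type*} [NormedAddCommGroup F] [NormedSpace ℝ F] [NormedAddCommGroup G] [NormedSpace ℝ G]
  {x₀ : M} {U : Set M} {u u' : TangentBundle 𝓘(ℝ, E) M} {z : M × G}

lemma IsLocalAdditionOn.map_eq {O : Set (TangentBundle 𝓘(ℝ, E) M)}
    {σ : TangentBundle 𝓘(ℝ, E) M → M} (h : IsLocalAdditionOn E' p O σ) (hu : u ∈ O) :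
    p (σ u) = p u.proj := by
  obtain ⟨O', -, hO'⟩ := h.isRelOpen_image
  exact (hO' ▸ mem_image_of_mem _ hu : (u.proj, σ u) ∈ fibreProduct p ∩ O').1.symm

lemma EhresmannConnection.contMDiffOn_horPart (A : EhresmannConnection E E' p)
    (fr : AdaptedFrame (vertical E E' p) A.horizontal x₀ U F G) :
    ContMDiffOn 𝓘(ℝ, E).tangent 𝓘(ℝ, E).tangent ∞ A.horPart {u | u.proj ∈ U} :=
  (fr.hor.contMDiffOn_frame.comp
    ((contMDiff_proj (TangentSpace 𝓘(ℝ, E))).contMDiffOn.prodMk fr.hor.contMDiffOn_coord)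
    fun _ hu => ⟨hu, mem_univ _⟩).congr fun _ hu => A.horPart_eq fr hu

namespace TransportChart

variable (C : TransportChart (vertical E E' p) A.horizontal S_H K x₀ U F G)
  {O : Set (TangentBundle 𝓘(ℝ, E) M)} {Ω_N : Set (TangentBundle 𝓘(ℝ, E') N)}

lemma horPart_eq (hu : u ∈ C.source) :
    A.horPart u = ⟨(C.coord u).1, C.frame.hor.frame (C.coord u).1 (C.coord u).2⟩ :=
  A.horPart_eq C.frame (C.fst_mem hu)

lemma coord_horPart (hu : u.proj ∈ U) : C.coord (A.horPart u) = C.coord u := by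
  rw [A.horPart_eq C.frame hu]
  exact Prod.ext rfl (C.frame.hor.coord_frame _ hu _)

lemma horPart_untransport (hz : z ∈ C.dom) :
    A.horPart (C.untransport z u) = ⟨z.1, C.frame.hor.frame z.1 z.2⟩ := by
  rw [C.horPart_eq (C.untransport_mem_source hz), C.coord_untransport (C.fst_mem hz)]

section Flow

variable [T2Space M] (hH : HasLocalFrames A.horizontal) (hS : IsSpray A.horizontal S_H)
include hH hS

lemma exists_isParallelAlong_horCurve (hu : u ∈ C.source) : ∃ η,
    IsParallelAlong (vertical E E' p) K (horCurve A S_H (A.horPart u)) η ∧ η 0 = A.verPart u := by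
  rw [C.horPart_eq hu, A.verPart_eq C.frame (C.fst_mem hu)]
  exact C.exists_isParallelAlong hH hS hu _

lemma transported_eq (hu : u ∈ C.source) : transported A S_H K u = C.transport u := by
  rw [transported, C.horPart_eq hu, A.verPart_eq C.frame (C.fst_mem hu)]
  exact C.parallelTransport_eq hH hS hu _

lemma transport_zeroVec : C.transport (zeroVec x₀) = zeroVec x₀ := by
  have hend : C.endpoint (C.coord (zeroVec x₀)) = x₀ := by
    rw [C.coord_zeroVec, C.endpoint_zero hH hS]
  have hzero : C.frame.ver.frame (C.endpoint (C.coord (zeroVec x₀)))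
      (C.matrix (C.coord (zeroVec x₀)) (C.frame.ver.coord x₀ 0)) = 0 := by
    rw [map_zero, map_zero, map_zero]
  exact (congrArg (TotalSpace.mk _) hzero).trans (congrArg zeroVec hend)

lemma eq_of_transported_eq [CompleteSpace F] (hu : u ∈ C.source)
    (hhor : A.horPart u' = A.horPart u)
    (htr : transported A S_H K u' = transported A S_H K u) : u' = u := by
  have hproj : u'.proj = u.proj := congrArg (fun w => w.proj) hhor
  have hcoord : C.coord u' = C.coord u := by
    rw [← C.coord_horPart (hproj ▸ C.fst_mem hu), hhor, C.coord_horPart (C.fst_mem hu)]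
  have hu' : u' ∈ C.source := show C.coord u' ∈ C.dom from hcoord ▸ hu
  rw [← C.untransport_transport (A.isCompl _).codisjoint hu',
    ← C.untransport_transport (A.isCompl _).codisjoint hu, hcoord,
    ← C.transported_eq hH hS hu', ← C.transported_eq hH hS hu, htr]

end Flow

end TransportChart

variable {σ_N : TangentBundle 𝓘(ℝ, E') N → N} {σ_V : TangentBundle 𝓘(ℝ, E) M → M}
  {O : Set (TangentBundle 𝓘(ℝ, E) M)} {Ω_N : Set (TangentBundle 𝓘(ℝ, E') N)}

/-- The requirements on a vector `u = v + h` of the domain of the lifted local addition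
`Σ_M (u) = σ_V (P_{0,1}^{c_h} (v))`: it is well defined at `u`, with `Tp (h)` in the domain `Ω_N` of
the local addition of `N`, and `P_{0,1}^{c_h}` is injective. -/
structure IsAdmissible (A : EhresmannConnection E E' p)
    (S_H : ∀ v : TangentBundle 𝓘(ℝ, E) M, TangentSpace 𝓘(ℝ, E).tangent v)
    (K : ∀ v : TangentBundle 𝓘(ℝ, E) M,
      TangentSpace 𝓘(ℝ, E).tangent v → TangentSpace 𝓘(ℝ, E) v.proj)
    (Ω_N : Set (TangentBundle 𝓘(ℝ, E') N)) (O : Set (TangentBundle 𝓘(ℝ, E) M))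
    (u : TangentBundle 𝓘(ℝ, E) M) : Prop where
  mem_expDomain : A.horPart u ∈ expDomain A.horizontal S_H
  exists_isParallelAlong : ∃ η,
    IsParallelAlong (vertical E E' p) K (horCurve A S_H (A.horPart u)) η ∧ η 0 = A.verPart u
  transported_mem : transported A S_H K u ∈ O
  tangentMap_mem : tangentMap 𝓘(ℝ, E) 𝓘(ℝ, E') p (A.horPart u) ∈ Ω_N
  eq_of_transported_eq : ∀ ⦃u'⦄, A.horPart u' = A.horPart u →
    transported A S_H K u' = transported A S_H K u → u' = u

namespace IsAdmissible

lemma fibreScale_mem_expDomain (h : IsAdmissible A S_H K Ω_N O u)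
    (hS : IsSpray A.horizontal S_H) {t : ℝ} (ht : t ∈ Icc (0 : ℝ) 1) :
    fibreScale t (A.horPart u) ∈ expDomain A.horizontal S_H := by
  obtain ⟨γ, hγ, hγ₀⟩ := h.mem_expDomain
  exact hγ₀ ▸ hS.fibreScale_mem_expDomain hγ ht

lemma transported_proj (h : IsAdmissible A S_H K Ω_N O u) :
    (transported A S_H K u).proj = sprayExp A.horizontal S_H (A.horPart u) := by
  have hex := h.exists_isParallelAlong
  have hproj := (hex.choose_spec.1 1 (right_mem_Icc.2 zero_le_one)).1
  have hone : fibreScale 1 (A.horPart u) = A.horPart u :=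
    congrArg (TotalSpace.mk u.proj) (one_smul ℝ _)
  rw [transported, parallelTransport, dif_pos hex, hproj, horCurve, hone]

variable [CompleteSpace E] [CompleteSpace E'] [T2Space M] [T2Space N] [IsManifold 𝓘(ℝ, E') ∞ N]
  {S_N : ∀ v : TangentBundle 𝓘(ℝ, E') N, TangentSpace 𝓘(ℝ, E').tangent v}
  (hp : ContMDiff 𝓘(ℝ, E) 𝓘(ℝ, E') ∞ p)
  (hS_N : IsSpray (fun _ => ⊤) S_N) (hS_H : IsSprayLift A S_N S_H)
  (hσ_N : EqOn σ_N (sprayExp (fun _ => ⊤) S_N) (Ω_N ∩ expDomain (fun _ => ⊤) S_N))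
  (hlocp : IsLocalAdditionOn E' p O σ_V)
include hp hS_N hS_H hσ_N hlocp

lemma map_sigma (h : IsAdmissible A S_H K Ω_N O u) :
    p (σ_V (transported A S_H K u)) =
      σ_N (tangentMap 𝓘(ℝ, E) 𝓘(ℝ, E') p (A.horPart u)) := by
  rw [hlocp.map_eq h.transported_mem, h.transported_proj,
    hS_H.map_sprayExp hS_N hp h.mem_expDomain,
    hσ_N ⟨h.tangentMap_mem, hS_H.tangentMap_mem_expDomain hp h.mem_expDomain⟩]

lemma eq_of_sigma_eq (h : IsAdmissible A S_H K Ω_N O u) (h' : IsAdmissible A S_H K Ω_N O u')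
    (hlocN : IsLocalAddition Ω_N σ_N) (hproj : u'.proj = u.proj)
    (hσ : σ_V (transported A S_H K u') = σ_V (transported A S_H K u)) : u' = u := by
  have hTp : tangentMap 𝓘(ℝ, E) 𝓘(ℝ, E') p (A.horPart u') =
      tangentMap 𝓘(ℝ, E) 𝓘(ℝ, E') p (A.horPart u) := by
    refine hlocN.diffeo.injOn h'.tangentMap_mem h.tangentMap_mem
      (Prod.ext (congrArg p hproj) ?_)
    change σ_N _ = σ_N _
    rw [← map_sigma hp hS_N hS_H hσ_N hlocp h, ← map_sigma hp hS_N hS_H hσ_N hlocp h', hσ]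
  have hhor : A.horPart u' = A.horPart u := A.horPart_eq_of_tangentMap_eq hproj hTp
  refine h.eq_of_transported_eq hhor
    (hlocp.diffeo.injOn h'.transported_mem h.transported_mem (Prod.ext ?_ hσ))
  change (transported A S_H K u').proj = (transported A S_H K u).proj
  rw [h.transported_proj, h'.transported_proj, hhor]

end IsAdmissible

end Addition

section Section

variable {E : Type u} [NormedAddCommGroup E] [NormedSpace ℝ E]
  {M : Type*} [TopologicalSpace M] [ChartedSpace E M] [IsManifold 𝓘(ℝ, E) ∞ M]
  {E' : Type*} [NormedAddCommGroup E'] [NormedSpace ℝ E'] [CompleteSpace E']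
  {N : Type*} [TopologicalSpace N] [ChartedSpace E' N] [IsManifold 𝓘(ℝ, E') ∞ N]
  {p : M → N} {A : EhresmannConnection E E' p}
  {σ_N : TangentBundle 𝓘(ℝ, E') N → N} {Ω_N : Set (TangentBundle 𝓘(ℝ, E') N)}
  {σ_V : TangentBundle 𝓘(ℝ, E) M → M} {O : Set (TangentBundle 𝓘(ℝ, E) M)}
  {F G : Type*} [NormedAddCommGroup F] [NormedSpace ℝ F]
  [NormedAddCommGroup G] [NormedSpace ℝ G] [CompleteSpace G] {x₀ : M} {U : Set M}
  (hp : ∀ x, IsSubmersionAt 𝓘(ℝ, E) 𝓘(ℝ, E') ∞ p x) (hlocN : IsLocalAddition Ω_N σ_N)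
include hp hlocN

lemma IsLocalAddition.exists_horizontal_section (fr : LocalFrame A.horizontal x₀ U G)
    (hx₀ : x₀ ∈ U) : ∃ q : M × M → G, q (x₀, x₀) = 0 ∧ ∀ᶠ z in 𝓝 (x₀, x₀),
      ContMDiffAt (𝓘(ℝ, E).prod 𝓘(ℝ, E)) 𝓘(ℝ, G) ∞ q z ∧
      tangentMap 𝓘(ℝ, E) 𝓘(ℝ, E') p ⟨z.1, fr.frame z.1 (q z)⟩ ∈ Ω_N ∧
      σ_N (tangentMap 𝓘(ℝ, E) 𝓘(ℝ, E') p ⟨z.1, fr.frame z.1 (q z)⟩) = p z.2 := by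
  have hpc : ContMDiff 𝓘(ℝ, E) 𝓘(ℝ, E') ∞ p := fun x => (hp x).contMDiffAt
  obtain ⟨g, hg, hgΩ, hgleft, hgright⟩ := hlocN.diffeo.exists_inverse
  let W : Set (M × M) := Prod.fst ⁻¹' (U ∩ p ⁻¹' (chartAt E' (p x₀)).source) ∩
    Prod.map p p ⁻¹' ((fun n => (n.proj, σ_N n)) '' Ω_N)
  have hW : IsOpen W := ((fr.isOpen_base.inter ((chartAt E' (p x₀)).open_source.preimage
    hpc.continuous)).preimage continuous_fst).inter
      (hlocN.isOpen_image.preimage (hpc.continuous.prodMap hpc.continuous))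
  have hzero : (fun n => (n.proj, σ_N n)) (zeroVec (p x₀)) = (p x₀, p x₀) :=
    Prod.ext rfl (hlocN.map_zero _)
  have hproj : ∀ z ∈ W, (g (p z.1, p z.2)).proj = p z.1 := fun z hz =>
    congrArg Prod.fst (hgright hz.2)
  have hlift : ∀ z ∈ W, tangentMap 𝓘(ℝ, E) 𝓘(ℝ, E') p
      ⟨z.1, fr.frame z.1 (fr.horizontalLift (p x₀) z.1 (g (p z.1, p z.2)))⟩ = g (p z.1, p z.2) :=
    fun z hz => fr.tangentMap_horizontalLift (surjective_mfderiv_of_isSubmersionAt (hp _))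
      hz.1.1 hz.1.2 (hproj z hz)
  have hq := (fr.contMDiffOn_horizontalLift (y₀ := p x₀) hp).comp
    (contMDiffOn_fst.prodMk (hg.comp (hpc.prodMap hpc).contMDiffOn fun z (hz : z ∈ W) => hz.2))
    fun z hz => ⟨hz.1, (congrArg (· ∈ (chartAt E' (p x₀)).source) (hproj z hz)).mpr hz.1.2⟩
  refine ⟨fun z => fr.horizontalLift (p x₀) z.1 (g (p z.1, p z.2)), ?_, ?_⟩
  · have hg₀ : g (p x₀, p x₀) = zeroVec (p x₀) := hzero ▸ hgleft (hlocN.zero_mem _)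
    exact (congrArg _ hg₀).trans <| fr.horizontalLift_zeroVec (mem_chart_source E' (p x₀))
  · filter_upwards [hW.mem_nhds ⟨⟨hx₀, mem_chart_source E' (p x₀)⟩, zeroVec (p x₀),
      hlocN.zero_mem _, hzero⟩] with z hz
    rw [hlift z hz]
    exact ⟨hq.contMDiffAt (hW.mem_nhds hz), hgΩ hz.2, congrArg Prod.snd (hgright hz.2)⟩

variable [CompleteSpace E] [T2Space M] [T2Space N]
  {S_N : ∀ v : TangentBundle 𝓘(ℝ, E') N, TangentSpace 𝓘(ℝ, E').tangent v}
  {S_H : ∀ v : TangentBundle 𝓘(ℝ, E) M, TangentSpace 𝓘(ℝ, E).tangent v}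
  {K : ∀ v : TangentBundle 𝓘(ℝ, E) M,
    TangentSpace 𝓘(ℝ, E).tangent v → TangentSpace 𝓘(ℝ, E) v.proj}
  (hS_N : IsSpray (fun _ => ⊤) S_N) (hS_H : IsSprayLift A S_N S_H)
  (hσ_N : EqOn σ_N (sprayExp (fun _ => ⊤) S_N) (Ω_N ∩ expDomain (fun _ => ⊤) S_N))
  (hlocp : IsLocalAdditionOn E' p O σ_V)
  (C : TransportChart (vertical E E' p) A.horizontal S_H K x₀ U F G)
include hS_N hS_H hσ_N hlocp

namespace TransportChart

lemma exists_endpoint_section : ∃ q : M × M → G, ∀ᶠ z in 𝓝 (x₀, x₀),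
    ContMDiffAt (𝓘(ℝ, E).prod 𝓘(ℝ, E)) (𝓘(ℝ, E).prod 𝓘(ℝ, G)) ∞ (fun z => (z.1, q z)) z ∧
      (z.1, q z) ∈ C.dom ∧
      tangentMap 𝓘(ℝ, E) 𝓘(ℝ, E') p ⟨z.1, C.frame.hor.frame z.1 (q z)⟩ ∈ Ω_N ∧
      (C.endpoint (z.1, q z), z.2) ∈ (fun v => (v.proj, σ_V v)) '' O := by
  have hpc : ContMDiff 𝓘(ℝ, E) 𝓘(ℝ, E') ∞ p := fun x => (hp x).contMDiffAt
  have hH := A.smooth.hasLocalFrames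
  obtain ⟨q, hq₀, hq⟩ := hlocN.exists_horizontal_section hp C.frame.hor (C.fst_mem C.mem_dom)
  obtain ⟨O', hO', himage⟩ := hlocp.isRelOpen_image
  have hqcont : ContinuousAt (fun z => (z.1, q z)) (x₀, x₀) :=
    continuousAt_fst.prodMk hq.self_of_nhds.1.continuousAt
  have hdom₀ : (x₀, q (x₀, x₀)) ∈ C.dom := hq₀.symm ▸ C.mem_dom
  have hendpoint : ContinuousAt (fun z => (C.endpoint (z.1, q z), z.2)) (x₀, x₀) :=
    (ContinuousAt.comp (x := (x₀, x₀)) (f := fun z : M × M => (z.1, q z)) (g := C.endpoint)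
      (C.contMDiffOn_endpoint.continuousOn.continuousAt (C.isOpen_dom.mem_nhds hdom₀))
      hqcont).prodMk continuousAt_snd
  have hO'₀ : (C.endpoint (x₀, q (x₀, x₀)), x₀) ∈ O' := by
    rw [hq₀, C.endpoint_zero hH hS_H.isSpray]
    exact (himage ▸ ⟨zeroVec x₀, hlocp.zero_mem x₀, Prod.ext rfl (hlocp.map_zero x₀)⟩ :
      (x₀, x₀) ∈ fibreProduct p ∩ O').2
  refine ⟨q, ?_⟩
  filter_upwards [hq, hqcont.eventually_mem (C.isOpen_dom.mem_nhds hdom₀),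
    hendpoint.eventually_mem (hO'.mem_nhds hO'₀)] with z ⟨hqz, hTp, hσ⟩ hdom hzO'
  refine ⟨contMDiffAt_fst.prodMk hqz, hdom, hTp, himage ▸ ⟨?_, hzO'⟩⟩
  change p (C.endpoint (z.1, q z)) = p z.2
  have hmem := C.mem_expDomain hdom
  rw [← C.sprayExp_eq hH hS_H.isSpray hdom, hS_H.map_sprayExp hS_N hpc hmem, ← hσ,
    hσ_N ⟨hTp, hS_H.tangentMap_mem_expDomain hpc hmem⟩]

lemma exists_section : ∃ (q : M × M → G) (w : M × M → TangentBundle 𝓘(ℝ, E) M),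
    ∀ᶠ z in 𝓝 (x₀, x₀),
      ContMDiffAt (𝓘(ℝ, E).prod 𝓘(ℝ, E)) ((𝓘(ℝ, E).prod 𝓘(ℝ, G)).prod 𝓘(ℝ, E).tangent) ∞
        (fun z => ((z.1, q z), w z)) z ∧ (z.1, q z) ∈ C.dom ∧
      tangentMap 𝓘(ℝ, E) 𝓘(ℝ, E') p ⟨z.1, C.frame.hor.frame z.1 (q z)⟩ ∈ Ω_N ∧
      w z ∈ O ∧ (w z).proj = C.endpoint (z.1, q z) ∧ σ_V (w z) = z.2 := by
  obtain ⟨q, hq⟩ := C.exists_endpoint_section hp hlocN hS_N hS_H hσ_N hlocp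
  obtain ⟨g, hg, hgO, -, hgright⟩ := hlocp.diffeo.exists_inverse
  refine ⟨q, fun z => g (C.endpoint (z.1, q z), z.2), ?_⟩
  filter_upwards [hq, (hq.mono fun z hz => hz.2.2.2).eventually_nhds]
    with z ⟨hqz, hdom, hTp, hmem⟩ hmem'
  refine ⟨hqz.prodMk ?_, hdom, hTp, hgO hmem, congrArg Prod.fst (hgright hmem),
    congrArg Prod.snd (hgright hmem)⟩
  have hpair : ContMDiffAt (𝓘(ℝ, E).prod 𝓘(ℝ, E)) (𝓘(ℝ, E).prod 𝓘(ℝ, E)) ∞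
      (fun z => (C.endpoint (z.1, q z), z.2)) z :=
    ((C.contMDiffOn_endpoint.contMDiffAt (C.isOpen_dom.mem_nhds hdom)).comp z hqz).prodMk
      contMDiffAt_snd
  exact ((hg _ hmem).comp z (hpair.contMDiffWithinAt (s := _ ⁻¹' _)) fun _ h => h).contMDiffAt
    hmem'

end TransportChart

end Section

section Chart

variable {E : Type u} [NormedAddCommGroup E] [NormedSpace ℝ E]
  {M : Type*} [TopologicalSpace M] [ChartedSpace E M] [IsManifold 𝓘(ℝ, E) ∞ M]
  {E' : Type*} [NormedAddCommGroup E'] [NormedSpace ℝ E']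
  {N : Type*} [TopologicalSpace N] [ChartedSpace E' N]
  {p : M → N} {A : EhresmannConnection E E' p}
  {S_H : ∀ v : TangentBundle 𝓘(ℝ, E) M, TangentSpace 𝓘(ℝ, E).tangent v}
  {K : ∀ v : TangentBundle 𝓘(ℝ, E) M,
    TangentSpace 𝓘(ℝ, E).tangent v → TangentSpace 𝓘(ℝ, E) v.proj}
  {F G : Type*} [NormedAddCommGroup F] [NormedSpace ℝ F] [NormedAddCommGroup G] [NormedSpace ℝ G]
  {x₀ : M} {U : Set M} {u : TangentBundle 𝓘(ℝ, E) M}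
  (C : TransportChart (vertical E E' p) A.horizontal S_H K x₀ U F G)
  {O : Set (TangentBundle 𝓘(ℝ, E) M)} {Ω_N : Set (TangentBundle 𝓘(ℝ, E') N)}

namespace TransportChart

/-- The part of the domain of the lifted local addition which is described by the chart `C`. -/
def additionSource (Ω_N : Set (TangentBundle 𝓘(ℝ, E') N)) (O : Set (TangentBundle 𝓘(ℝ, E) M)) :
    Set (TangentBundle 𝓘(ℝ, E) M) :=
  {u ∈ C.source | C.transport u ∈ O ∧ tangentMap 𝓘(ℝ, E) 𝓘(ℝ, E') p (A.horPart u) ∈ Ω_N}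

lemma isOpen_additionSource [IsManifold 𝓘(ℝ, E') ∞ N] (hp : ContMDiff 𝓘(ℝ, E) 𝓘(ℝ, E') ∞ p)
    (hΩ_N : IsOpen Ω_N) (hO : IsRelOpen O (totalSet (vertical E E' p))) :
    IsOpen (C.additionSource Ω_N O) := by
  obtain ⟨O', hO', rfl⟩ := hO
  have hcont := C.contMDiffOn_transport.continuousOn.prodMk
    ((hp.contMDiff_tangentMap (m := ∞) (by simp)).continuous.comp_continuousOn
      ((A.contMDiffOn_horPart C.frame).continuousOn.mono fun _ hu => C.fst_mem hu))
  have heq : C.additionSource Ω_N (totalSet (vertical E E' p) ∩ O') =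
      C.source ∩ (fun u => (C.transport u, tangentMap 𝓘(ℝ, E) 𝓘(ℝ, E') p (A.horPart u))) ⁻¹'
        (O' ×ˢ Ω_N) :=
    Set.ext fun u => and_congr_right fun hu => and_congr_left' (and_iff_right (C.transport_mem hu))
  exact heq ▸ hcont.isOpen_inter_preimage C.isOpen_source (hO'.prod hΩ_N)

variable [T2Space M] (hH : HasLocalFrames A.horizontal) (hS : IsSpray A.horizontal S_H)
include hH hS

lemma zeroVec_mem_additionSource (hΩ_N : zeroVec (p x₀) ∈ Ω_N) (hO : zeroVec x₀ ∈ O) :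
    zeroVec x₀ ∈ C.additionSource Ω_N O := by
  refine ⟨?_, ?_, ?_⟩
  · rw [source, mem_preimage, C.coord_zeroVec]
    exact C.mem_dom
  · rwa [C.transport_zeroVec hH hS]
  · rwa [A.horPart_zeroVec, tangentMap_zeroVec]

lemma isAdmissible [CompleteSpace F] (hu : u ∈ C.additionSource Ω_N O) :
    IsAdmissible A S_H K Ω_N O u where
  mem_expDomain := C.horPart_eq hu.1 ▸ C.mem_expDomain hu.1
  exists_isParallelAlong := C.exists_isParallelAlong_horCurve hH hS hu.1
  transported_mem := C.transported_eq hH hS hu.1 ▸ hu.2.1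
  tangentMap_mem := hu.2.2
  eq_of_transported_eq _ := C.eq_of_transported_eq hH hS hu.1

lemma contMDiffOn_additionSource {σ_V : TangentBundle 𝓘(ℝ, E) M → M}
    (hσ_V : ContMDiffOn 𝓘(ℝ, E).tangent 𝓘(ℝ, E) ∞ σ_V O) :
    ContMDiffOn 𝓘(ℝ, E).tangent (𝓘(ℝ, E).prod 𝓘(ℝ, E)) ∞
      (fun u => (u.proj, σ_V (transported A S_H K u))) (C.additionSource Ω_N O) :=
  ((contMDiff_proj (TangentSpace 𝓘(ℝ, E))).contMDiffOn.prodMk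
    (hσ_V.comp (C.contMDiffOn_transport.mono fun _ hu => hu.1) fun _ hu => hu.2.1)).congr
    fun u hu => congrArg (fun w => (u.proj, σ_V w)) (C.transported_eq hH hS hu.1)

end TransportChart

end Chart

section Theorem

variable {E : Type u} [NormedAddCommGroup E] [NormedSpace ℝ E] [CompleteSpace E]
  {M : Type*} [TopologicalSpace M] [ChartedSpace E M] [IsManifold 𝓘(ℝ, E) ∞ M] [T2Space M]
  {E' : Type*} [NormedAddCommGroup E'] [NormedSpace ℝ E'] [CompleteSpace E']
  {N : Type*} [TopologicalSpace N] [ChartedSpace E' N] [IsManifold 𝓘(ℝ, E') ∞ N] [T2Space N]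
  {p : M → N} (hp : ∀ x, IsSubmersionAt 𝓘(ℝ, E) 𝓘(ℝ, E') ∞ p x)
  {A : EhresmannConnection E E' p}
  {S_N : ∀ v : TangentBundle 𝓘(ℝ, E') N, TangentSpace 𝓘(ℝ, E').tangent v}
  (hS_N : IsSpray (fun _ => ⊤) S_N)
  {σ_N : TangentBundle 𝓘(ℝ, E') N → N} {Ω_N : Set (TangentBundle 𝓘(ℝ, E') N)}
  (hσ_N : EqOn σ_N (sprayExp (fun _ => ⊤) S_N) (Ω_N ∩ expDomain (fun _ => ⊤) S_N))
  (hlocN : IsLocalAddition Ω_N σ_N)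
  {S_H : ∀ v : TangentBundle 𝓘(ℝ, E) M, TangentSpace 𝓘(ℝ, E).tangent v}
  (hS_H : IsSprayLift A S_N S_H)
  {σ_V : TangentBundle 𝓘(ℝ, E) M → M} {O : Set (TangentBundle 𝓘(ℝ, E) M)}
  (hlocp : IsLocalAdditionOn E' p O σ_V)
  {K : ∀ v : TangentBundle 𝓘(ℝ, E) M,
    TangentSpace 𝓘(ℝ, E).tangent v → TangentSpace 𝓘(ℝ, E) v.proj}
include hp hS_N hσ_N hlocN hS_H hlocp

lemma TransportChart.hasSmoothSectionAt_additionSource {F G : Type*}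
    [NormedAddCommGroup F] [NormedSpace ℝ F] [CompleteSpace F]
    [NormedAddCommGroup G] [NormedSpace ℝ G] [CompleteSpace G] {x₀ : M} {U : Set M}
    (C : TransportChart (vertical E E' p) A.horizontal S_H K x₀ U F G) :
    HasSmoothSectionAt 𝓘(ℝ, E).tangent (𝓘(ℝ, E).prod 𝓘(ℝ, E))
      (fun u => (u.proj, σ_V (transported A S_H K u))) (C.additionSource Ω_N O) (x₀, x₀) := by
  obtain ⟨q, w, hqw⟩ := C.exists_section hp hlocN hS_N hS_H hσ_N hlocp
  refine ⟨fun z => C.untransport (z.1, q z) (w z), hqw.mono fun z hz => ?_⟩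
  obtain ⟨hsmooth, hdom, hTp, hwO, hproj, hσ⟩ := hz
  have hwU : (w z).proj ∈ U := hproj ▸ C.endpoint_mem hdom
  have hwV : w z ∈ totalSet (vertical E E' p) := by
    obtain ⟨O', -, rfl⟩ := hlocp.isRelOpen
    exact hwO.1
  have hmem : C.untransport (z.1, q z) (w z) ∈ C.source := C.untransport_mem_source hdom
  have htransport := C.transport_untransport hdom hproj hwV
  have hopen : IsOpen (C.dom ×ˢ {v : TangentBundle 𝓘(ℝ, E) M | v.proj ∈ U}) :=
    C.isOpen_dom.prod (C.frame.hor.isOpen_base.preimage (FiberBundle.continuous_proj E _))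
  refine ⟨((C.contMDiffOn_untransport A.isCompl).contMDiffAt
    (hopen.mem_nhds (x := ((z.1, q z), w z)) ⟨hdom, hwU⟩)).comp z hsmooth, ⟨hmem, ?_, ?_⟩,
    Prod.ext rfl ?_⟩
  · rwa [htransport]
  · rwa [C.horPart_untransport hdom]
  · change σ_V (transported A S_H K (C.untransport (z.1, q z) (w z))) = z.2
    rw [C.transported_eq A.smooth.hasLocalFrames hS_H.isSpray hmem, htransport, hσ]

theorem mainTheorem2_general (hK : IsLinearConnection (vertical E E' p) K) :
    ∃ Ω_M : Set (TangentBundle 𝓘(ℝ, E) M),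
      (∀ u ∈ Ω_M,
        (∀ t ∈ Icc (0 : ℝ) 1, fibreScale t (A.horPart u) ∈ expDomain A.horizontal S_H) ∧
        (∃ η : ℝ → TangentBundle 𝓘(ℝ, E) M,
          IsParallelAlong (vertical E E' p) K (horCurve A S_H (A.horPart u)) η ∧
          η 0 = A.verPart u) ∧
        transported A S_H K u ∈ O) ∧
      IsLocalAddition Ω_M (fun u => σ_V (transported A S_H K u)) ∧
      ∀ u ∈ Ω_M,
        tangentMap 𝓘(ℝ, E) 𝓘(ℝ, E') p (A.horPart u) ∈ Ω_N ∧
        p (σ_V (transported A S_H K u)) =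
          σ_N (tangentMap 𝓘(ℝ, E) 𝓘(ℝ, E') p (A.horPart u)) := by
  have hpc : ContMDiff 𝓘(ℝ, E) 𝓘(ℝ, E') ∞ p := fun x => (hp x).contMDiffAt
  have hH := A.smooth.hasLocalFrames
  have hS := hS_H.isSpray
  obtain ⟨Ω, hΩ, hloc⟩ := exists_isLocalAddition (σ := fun u => σ_V (transported A S_H K u))
    (Q := {u | IsAdmissible A S_H K Ω_N O u})
    (fun u hu v hv huv => hv.eq_of_sigma_eq hpc hS_N hS_H hσ_N hlocp hu hlocN
      (congrArg Prod.fst huv) (congrArg Prod.snd huv)) fun x => by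
    obtain ⟨U, F, G, _, _, _, _, _, _, ⟨C⟩⟩ := exists_transportChart hK hH A.isCompl hS x
    have hzero := C.zeroVec_mem_additionSource hH hS (hlocN.zero_mem _) (hlocp.zero_mem x)
    refine ⟨C.additionSource Ω_N O, fun u hu => C.isAdmissible hH hS hu,
      C.isOpen_additionSource hpc hlocN.isOpen hlocp.isRelOpen, hzero, ?_,
      C.contMDiffOn_additionSource hH hS (contMDiff_snd.comp_contMDiffOn hlocp.diffeo.1),
      C.hasSmoothSectionAt_additionSource hp hS_N hσ_N hlocN hS_H hlocp⟩
    rw [C.transported_eq hH hS hzero.1, C.transport_zeroVec hH hS, hlocp.map_zero]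
  refine ⟨Ω, fun u hu => ?_, hloc, fun u hu => ?_⟩
  · have h := hΩ hu
    exact ⟨fun t => h.fibreScale_mem_expDomain hS, h.exists_isParallelAlong, h.transported_mem⟩
  · exact ⟨(hΩ hu).tangentMap_mem, (hΩ hu).map_sigma hpc hS_N hS_H hσ_N hlocp⟩

end Theorem

end SubmersionAddition

end

open SubmersionAddition in
theorem mainTheorem2
    {E : Type*} [NormedAddCommGroup E] [NormedSpace ℝ E] [CompleteSpace E]
    {E' : Type*} [NormedAddCommGroup E'] [NormedSpace ℝ E'] [CompleteSpace E']
    {M : Type*} [TopologicalSpace M] [ChartedSpace E M] [IsManifold 𝓘(ℝ, E) ∞ M] [T2Space M]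
    {N : Type*} [TopologicalSpace N] [ChartedSpace E' N] [IsManifold 𝓘(ℝ, E') ∞ N] [T2Space N]
    (hM : IsSmoothlyParacompact E M) (hN : IsSmoothlyParacompact E' N)
    -- a surjective submersion with an Ehresmann connection
    (p : M → N) (hp : ∀ x, IsSubmersionAt 𝓘(ℝ, E) 𝓘(ℝ, E') ∞ p x)
    (hp_surj : Function.Surjective p)
    (A : EhresmannConnection E E' p)
    -- a spray on `N` whose exponential is a local addition with domain `Ω_N`
    (S_N : ∀ v : TangentBundle 𝓘(ℝ, E') N, TangentSpace 𝓘(ℝ, E').tangent v)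
    (hS_N : IsSpray (fun _ => ⊤) S_N)
    (Ω_N : Set (TangentBundle 𝓘(ℝ, E') N))
    (hΩ_N : Ω_N ⊆ expDomain (fun _ => ⊤) S_N)
    (hlocN : IsLocalAddition Ω_N (sprayExp (fun _ => ⊤) S_N))
    -- its lift to the horizontal bundle
    (S_H : ∀ v : TangentBundle 𝓘(ℝ, E) M, TangentSpace 𝓘(ℝ, E).tangent v)
    (hS_H : IsSprayLift A S_N S_H)
    -- a spray on the vertical bundle whose exponential is a local addition on `p` with domain `O`
    (S_V : ∀ v : TangentBundle 𝓘(ℝ, E) M, TangentSpace 𝓘(ℝ, E).tangent v)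
    (hS_V : IsSpray (vertical E E' p) S_V)
    (O : Set (TangentBundle 𝓘(ℝ, E) M))
    (hO : O ⊆ expDomain (vertical E E' p) S_V)
    (hlocp : IsLocalAdditionOn E' p O (sprayExp (vertical E E' p) S_V))
    -- a linear connection on the vertical bundle
    (K : ∀ v : TangentBundle 𝓘(ℝ, E) M,
      TangentSpace 𝓘(ℝ, E).tangent v → TangentSpace 𝓘(ℝ, E) v.proj)
    (hK : IsLinearConnection (vertical E E' p) K) :
    ∃ Ω_M : Set (TangentBundle 𝓘(ℝ, E) M),
      -- `Σ_M` is well defined on `Ω_M`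
      (∀ u ∈ Ω_M,
        (∀ t ∈ Icc (0 : ℝ) 1, fibreScale t (A.horPart u) ∈ expDomain A.horizontal S_H) ∧
        (∃ η : ℝ → TangentBundle 𝓘(ℝ, E) M,
          IsParallelAlong (vertical E E' p) K (horCurve A S_H (A.horPart u)) η ∧
          η 0 = A.verPart u) ∧
        transported A S_H K u ∈ O) ∧
      -- it is a local addition
      IsLocalAddition Ω_M (sigmaMap A S_H S_V K) ∧
      -- and the square over `p` commutes
      ∀ u ∈ Ω_M,
        tangentMap 𝓘(ℝ, E) 𝓘(ℝ, E') p (A.horPart u) ∈ Ω_N ∧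
        p (sigmaMap A S_H S_V K u) =
          sprayExp (fun _ => ⊤) S_N (tangentMap 𝓘(ℝ, E) 𝓘(ℝ, E') p (A.horPart u)) :=
  mainTheorem2_general hp hS_N (fun _ _ => rfl) hlocN hS_H hlocp hK
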